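/- Let $0<q<1$. Let $\mathcal A=\mathcal A(\mathrm{SU}_q(2))$ be the algebra generated by $a,a^*,c,c^*$ with $ac=qca$, $ac^*=qc^*a$, $cc^*=c^*c$, $a^*a+c^*c=aa^*+q^2cc^*=1$ (and the adjoint relations). Consider Woronowicz's $4D_+$ bicovariant calculus, with basis $\omega_-,\omega_+,\omega_0,\omega_z$ of left-invariant 1-forms, $\omega_-^*=-\omega_+$, $\omega_0^*=-\omega_0$, $\omega_z^*=-\omega_z$. Its right module structure is $\omega_b\,x=\sum_a(f_{ba}\triangleright x)\,\omega_a$, where $\Delta(L_a)=1\otimes L_a+\sum_bL_b\otimes f_{ba}$ for the dual basis $L_-=q^{1/2}FK^{-1}$, $L_+=q^{-1/2}EK^{-1}$, $L_0=\frac{q(K^2-1)+q^{-1}(K^{-2}-1)}{(q-q^{-1})^2}+FE$, $L_z=\frac{K^{-2}-1}{q-q^{-1}}$ of the quantum tangent space; here $KE=qEK$, $KF=q^{-1}FK$, $[E,F]=\frac{K^2-K^{-2}}{q-q^{-1}}$, $\Delta K=K\otimes K$, $\Delta E=E\otimes K+K^{-1}\otimes E$, $\Delta F=F\otimes K+K^{-1}\otimes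 F$, $h\triangleright x=x_{(1)}\langle h,x_{(2)}\rangle$, and the nonzero pairings of generators are $\langle K^{\pm1},a\rangle=q^{\mp1/2}$, $\langle K^{\pm1},a^*\rangle=q^{\pm1/2}$, $\langle E,c\rangle=1$, $\langle F,c^*\rangle=-q^{-1}$. Let $\sigma$ be its braiding (the bimodule map with $\sigma(\omega\otimes\eta)=\eta\otimes\omega$ for $\omega$ left-invariant and $\eta$ right-invariant). For each sign put $\mathfrak P^{\pm}(p)=\sigma^{\pm1}_{j_1}\cdots\sigma^{\pm1}_{j_n}$ for a reduced word $p=\tau_{j_1}\cdots\tau_{j_n}$, and let $A^{(k)}_\pm=\sum_{p\in S_k}\mathrm{sign}(p)\,\mathfrak P^\pm(p)$ be the antisymmetrisers. Let $B^{\pm}_{k,N-k}$ be the signed shuffle operators, with $A^{(N)}_\pm=(A^{(k)}_\pm\otimes A^{(N-k)}_\pm)B^\pm_{k,N-k}$. Let $\Omega^k_\pm=\mathrm{Range}\,A^{(k)}_\pm$ be the $k$-forms and $\Omega^k_{\pm\,\mathrm{inv}}$ the left-invariant ones. The conjugation is extended by $(A^{(k)}_\pm t)^*=A^{(k)}_\pm(t^*)$,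 where $(\omega_{a_1}\otimes\cdots\otimes\omega_{a_k})^*=(-1)^{k(k-1)/2}\,\omega_{a_k}^*\otimes\cdots\otimes\omega_{a_1}^*$. A contraction is a map $\Gamma:\Omega^1_{\rm inv}\times\Omega^1_{\rm inv}\to\mathbb C$, antilinear in the first and linear in the second argument, extended by $\Gamma(\omega_{a_1}\otimes\cdots\otimes\omega_{a_k},\omega_{b_1}\otimes\cdots\otimes\omega_{b_N})=\big(\prod_{i\le k}\Gamma(\omega_{a_i},\omega_{b_i})\big)\,\omega_{b_{k+1}}\otimes\cdots\otimes\omega_{b_N}$. It is $\mathrm U(1)$-coinvariant if $\Gamma(\omega_a,\omega_b)=0$ whenever $n_a\ne n_b$, where $(n_-,n_+,n_0,n_z)=(-2,2,0,0)$. For real $m\neq0$ put $\vartheta=im\,\omega_-\otimes\omega_+\otimes\omega_0\otimes\omega_z$ and $\mu=A^{(4)}_\pm(\vartheta)$. If $\xi\in\Omega^k_{\pm\,\mathrm{inv}}$ is nonzero with $A^{(k)}_\pm\xi=\lambda^\pm_\xi\,\xi$ and $A^{(k)}_\pm\xi^*=\lambda^\pm_{\xi^*}\,\xi^*$ we call $\xi$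 an eigenform. The Hodge operator $\mathfrak T^\pm:\Omega^k_{\pm\,\mathrm{inv}}\to\Omega^{4-k}_{\pm\,\mathrm{inv}}$ of $\Gamma$ is the linear map with $$\mathfrak T^\pm(\xi)=\frac{\lambda^\pm_{\xi^*}}{\lambda^\pm_\xi}\Big(A^{(4-k)}_\pm\big(\Gamma(\xi,B^\pm_{k,4-k}\vartheta)\big)\Big)^*$$ for all eigenforms $\xi$. A $\mathrm U(1)$-coinvariant contraction is called real and maximally hermitian for $\mathfrak T^\pm$ if - $\mathfrak T^\pm(\mu)\ne0$; - $\mathfrak T^\pm(\phi^*)=(\mathfrak T^\pm\phi)^*$ for every left-invariant 1-form $\phi$; - $(\mathfrak T^\pm)^2\phi=-(\mathfrak T^\pm)^2(1)\,\phi$ for every left-invariant 1-form $\phi$; - $(\mathfrak T^\pm)^2$ is constant on each eigenspace of each $A^{(k)}_\pm$ on $\Omega^k_{\pm\,\mathrm{inv}}$, $0\le k\le4$. Put $\det_q\Gamma_\pm=\Gamma\big(i\,\omega_-\otimes\omega_+\otimes\omega_0\otimes\omega_z,\;A^{(4)}_\pm(i\,\omega_-\otimes\omega_+\otimes\omega_0\otimes\omega_z)\big)$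 and $\mathrm{sgn}\,\Gamma_\pm=\det_q\Gamma_\pm/|\det_q\Gamma_\pm|$. **Proposition.** 1. For every $\mathrm U(1)$-coinvariant $\Gamma$ and every real $m\ne0$ the operators $\mathfrak T^\pm$ exist and are unique. 2. The set of real and maximally hermitian contractions for $\mathfrak T^+$ equals the one for $\mathfrak T^-$, and it does not depend on $m$. 3. $\Omega^k_+=\Omega^k_-$ for $0\le k\le4$, as submodules of $\Omega^{\otimes k}$. 4. If $\Gamma$ is real and maximally hermitian (for one, hence both signs), then $\mathrm{sgn}\,\Gamma_+=\mathrm{sgn}\,\Gamma_-=:\mathrm{sgn}\,\Gamma$ and there is a real $m\ne0$ such that the following holds for both signs. - For every eigenform $\xi$ of degree $k$, $$(\mathfrak T^\pm)^2\xi=(-1)^{k(4-k)}\,\mathrm{sgn}\,\Gamma\;\frac{\lambda^\pm_\xi}{\lambda^\pm_{\xi^*}}\;\xi,\qquad \lambda^\pm_{\xi^*}\,(\mathfrak T^\pm\xi)^*=\lambda^\pm_\xi\,\mathfrak T^\pm(\xi^*).$$ - There are unique linear maps $\star^L_\pm,\star^R_\pm:\Omega^k_\pm\to\Omega^{4-k}_\pm$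 with $\star^L_\pm(x\,\omega)=x\,\mathfrak T^\pm(\omega)$ and $\star^R_\pm(\omega\,x)=\mathfrak T^\pm(\omega)\,x$ for $x\in\mathcal A$ and $\omega\in\Omega^k_{\pm\,\mathrm{inv}}$. - For every $k$-form $\phi$, $$\star^L_\pm\star^L_\mp\phi=(-1)^{k(4-k)}\,\mathrm{sgn}\,\Gamma\;\phi,\qquad \star^R_\pm\star^R_\mp\phi=(-1)^{k(4-k)}\,\mathrm{sgn}\,\Gamma\;\phi.$$ -/

import Mathlib

namespace SUq2

noncomputable section

/-! ## The algebra `A(SU_q(2))` -/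

/-- The generators `a`, `a*`, `c`, `c*`. -/
inductive Gen : Type
  | a | aStar | c | cStar

/-- The defining relations of `A(SU_q(2))`, together with their adjoints. -/
inductive Rel (q : ℝ) : FreeAlgebra ℂ Gen → FreeAlgebra ℂ Gen → Prop
  | ac : Rel q (FreeAlgebra.ι ℂ Gen.a * FreeAlgebra.ι ℂ Gen.c)
      ((q : ℂ) • (FreeAlgebra.ι ℂ Gen.c * FreeAlgebra.ι ℂ Gen.a))
  | ac' : Rel q (FreeAlgebra.ι ℂ Gen.a * FreeAlgebra.ι ℂ Gen.cStar)
      ((q : ℂ) • (FreeAlgebra.ι ℂ Gen.cStar * FreeAlgebra.ι ℂ Gen.a))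
  | ca : Rel q (FreeAlgebra.ι ℂ Gen.cStar * FreeAlgebra.ι ℂ Gen.aStar)
      ((q : ℂ) • (FreeAlgebra.ι ℂ Gen.aStar * FreeAlgebra.ι ℂ Gen.cStar))
  | ca' : Rel q (FreeAlgebra.ι ℂ Gen.c * FreeAlgebra.ι ℂ Gen.aStar)
      ((q : ℂ) • (FreeAlgebra.ι ℂ Gen.aStar * FreeAlgebra.ι ℂ Gen.c))
  | cc : Rel q (FreeAlgebra.ι ℂ Gen.c * FreeAlgebra.ι ℂ Gen.cStar)
      (FreeAlgebra.ι ℂ Gen.cStar * FreeAlgebra.ι ℂ Gen.c)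
  | unit₁ : Rel q (FreeAlgebra.ι ℂ Gen.aStar * FreeAlgebra.ι ℂ Gen.a +
      FreeAlgebra.ι ℂ Gen.cStar * FreeAlgebra.ι ℂ Gen.c) 1
  | unit₂ : Rel q (FreeAlgebra.ι ℂ Gen.a * FreeAlgebra.ι ℂ Gen.aStar +
      ((q : ℂ) ^ 2) • (FreeAlgebra.ι ℂ Gen.c * FreeAlgebra.ι ℂ Gen.cStar)) 1

/-- The complex algebra `A(SU_q(2))`. -/
def Alg (q : ℝ) : Type := RingQuot (Rel q)

instance (q : ℝ) : Ring (Alg q) := inferInstanceAs (Ring (RingQuot (Rel q)))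

instance (q : ℝ) : Algebra ℂ (Alg q) := inferInstanceAs (Algebra ℂ (RingQuot (Rel q)))

/-- The quotient map from the free algebra. -/
def quot (q : ℝ) : FreeAlgebra ℂ Gen →ₐ[ℂ] Alg q := RingQuot.mkAlgHom ℂ (Rel q)

theorem quot_rel {q : ℝ} {x y : FreeAlgebra ℂ Gen} (h : Rel q x y) : quot q x = quot q y :=
  RingQuot.mkAlgHom_rel ℂ h

/-- The image of a generator in `A(SU_q(2))`. -/
def gen (q : ℝ) (x : Gen) : Alg q := quot q (FreeAlgebra.ι ℂ x)

/-- The fundamental corepresentation `U = [[a, -q c*], [c, a*]]`. -/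
def fund (q : ℝ) : Matrix (Fin 2) (Fin 2) (Alg q) :=
  !![gen q Gen.a, -((q : ℂ) • gen q Gen.cStar); gen q Gen.c, gen q Gen.aStar]

/-! ## The right module structure of the `4D₊` calculus

The pairing of `h ∈ U_q(su(2))` with the entries of `U` is the matrix `(⟨h, U_ij⟩)`; this is an
algebra representation, given on the generators `K`, `K⁻¹`, `E`, `F` by the next four matrices. -/

def repK (q : ℝ) : Matrix (Fin 2) (Fin 2) ℂ := !![((√q : ℝ) : ℂ)⁻¹, 0; 0, ((√q : ℝ) : ℂ)]

def repKinv (q : ℝ) : Matrix (Fin 2) (Fin 2) ℂ := !![((√q : ℝ) : ℂ), 0; 0, ((√q : ℝ) : ℂ)⁻¹]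

def repE : Matrix (Fin 2) (Fin 2) ℂ := !![0, 0; 1, 0]

def repF : Matrix (Fin 2) (Fin 2) ℂ := !![0, 1; 0, 0]

/-- The elements `f_{ba} ∈ U_q(su(2))`, in the representation above, that are determined by
`Δ(L_a) = 1 ⊗ L_a + ∑_b L_b ⊗ f_{ba}` for the basis
`L₋ = q^{1/2} F K⁻¹`, `L₊ = q^{-1/2} E K⁻¹`,
`L₀ = (q (K² - 1) + q⁻¹ (K⁻² - 1)) / (q - q⁻¹)² + F E`, `L_z = (K⁻² - 1) / (q - q⁻¹)`
of the quantum tangent space.  The index set `{-, +, 0, z}` is coded as `0, 1, 2, 3`. -/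
def fRep (q : ℝ) : Fin 4 → Fin 4 → Matrix (Fin 2) (Fin 2) ℂ
  | 0, 0 => 1
  | 0, 2 => ((√q : ℝ) : ℂ)⁻¹ • (repK q * repE)
  | 1, 1 => 1
  | 1, 2 => ((√q : ℝ) : ℂ)⁻¹ • (repF * repK q)
  | 2, 2 => repK q * repK q
  | 3, 0 => ((q : ℂ) - (q : ℂ)⁻¹) • (((√q : ℝ) : ℂ) • (repF * repKinv q))
  | 3, 1 => ((q : ℂ) - (q : ℂ)⁻¹) • (((√q : ℝ) : ℂ)⁻¹ • (repE * repKinv q))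
  | 3, 2 => ((q : ℂ) - (q : ℂ)⁻¹) • (repF * repE) +
      ((q : ℂ)⁻¹ / ((q : ℂ) - (q : ℂ)⁻¹)) • (repKinv q * repKinv q - repK q * repK q)
  | 3, 3 => repKinv q * repKinv q
  | _, _ => 0

/-- The matrix `(f_{ba} ▷ U_ij)_{ba}`, where `h ▷ U_ij = ∑_k U_ik ⟨h, U_kj⟩`. -/
def fAct (q : ℝ) (i j : Fin 2) : Matrix (Fin 4) (Fin 4) (Alg q) :=
  Matrix.of fun b a => ∑ k : Fin 2, fRep q b a k j • fund q i k

/-- The values of `x ↦ (f_{ba} ▷ x)_{ba}` on the generators. -/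
def fGen (q : ℝ) : Gen → Matrix (Fin 4) (Fin 4) (Alg q)
  | Gen.a => fAct q 0 0
  | Gen.aStar => fAct q 1 1
  | Gen.c => fAct q 1 0
  | Gen.cStar => -((q : ℂ)⁻¹ • fAct q 0 1)

theorem gen_ac (q : ℝ) : gen q .a * gen q .c = (q:ℂ) • (gen q .c * gen q .a) := by
  simpa only [gen, map_mul, map_smul, map_add, map_one] using quot_rel (Rel.ac (q := q))
theorem gen_ac' (q : ℝ) : gen q .a * gen q .cStar = (q:ℂ) • (gen q .cStar * gen q .a) := by
  simpa only [gen, map_mul, map_smul, map_add, map_one] using quot_rel (Rel.ac' (q := q))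
theorem gen_ca (q : ℝ) : gen q .cStar * gen q .aStar = (q:ℂ) • (gen q .aStar * gen q .cStar) := by
  simpa only [gen, map_mul, map_smul, map_add, map_one] using quot_rel (Rel.ca (q := q))
theorem gen_ca' (q : ℝ) : gen q .c * gen q .aStar = (q:ℂ) • (gen q .aStar * gen q .c) := by
  simpa only [gen, map_mul, map_smul, map_add, map_one] using quot_rel (Rel.ca' (q := q))
theorem gen_cc (q : ℝ) : gen q .c * gen q .cStar = gen q .cStar * gen q .c := by
  simpa only [gen, map_mul, map_smul, map_add, map_one] using quot_rel (Rel.cc (q := q))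
theorem gen_unit₁ (q : ℝ) : gen q .aStar * gen q .a = 1 - gen q .cStar * gen q .c := by
  rw [eq_sub_iff_add_eq]
  simpa only [gen, map_mul, map_smul, map_add, map_one] using quot_rel (Rel.unit₁ (q := q))
theorem gen_unit₂ (q : ℝ) :
    gen q .a * gen q .aStar = 1 - ((q:ℂ)^2) • (gen q .cStar * gen q .c) := by
  rw [eq_sub_iff_add_eq, ← gen_cc]
  simpa only [gen, map_mul, map_smul, map_add, map_one] using quot_rel (Rel.unit₂ (q := q))

theorem fRep_eq {q : ℝ} (h0 : 0 < q) (h1 : q < 1) (b a : Fin 4) : fRep q b a =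
    match b, a with
    | 0, 0 => 1
    | 0, 2 => !![0, 0; 1, 0]
    | 1, 1 => 1
    | 1, 2 => !![0, 1; 0, 0]
    | 2, 2 => !![(q : ℂ)⁻¹, 0; 0, (q : ℂ)]
    | 3, 0 => !![0, (q : ℂ) - (q : ℂ)⁻¹; 0, 0]
    | 3, 1 => !![0, 0; (q : ℂ) - (q : ℂ)⁻¹, 0]
    | 3, 2 => !![(q : ℂ), 0; 0, -(q : ℂ)⁻¹]
    | 3, 3 => !![(q : ℂ), 0; 0, (q : ℂ)⁻¹]
    | _, _ => 0 := by
  have hs : ((√q : ℝ) : ℂ) ≠ 0 := by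
    exact_mod_cast (Real.sqrt_pos.2 h0).ne'
  have hq : (q : ℂ) = ((√q : ℝ) : ℂ) * ((√q : ℝ) : ℂ) := by
    exact_mod_cast (Real.mul_self_sqrt h0.le).symm
  have hq0 : (q : ℂ) ≠ 0 := by exact_mod_cast h0.ne'
  have hd : (q : ℂ) - (q : ℂ)⁻¹ ≠ 0 := by
    have : q - q⁻¹ ≠ 0 := by
      have := (one_lt_inv₀ h0).2 h1
      linarith
    exact_mod_cast this
  have e1 : ((√q : ℝ) : ℂ)⁻¹ * ((√q : ℝ) : ℂ)⁻¹ = (q : ℂ)⁻¹ := by rw [hq, mul_inv]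
  have e2 : (q : ℂ)⁻¹ / ((q : ℂ) - (q : ℂ)⁻¹) * ((q : ℂ) - (q : ℂ)⁻¹) = (q : ℂ)⁻¹ :=
    div_mul_cancel₀ _ hd
  have e3 : (q : ℂ)⁻¹ / ((q : ℂ) - (q : ℂ)⁻¹) * ((q : ℂ)⁻¹ - (q : ℂ)) = -(q : ℂ)⁻¹ := by
    rw [← neg_sub (q : ℂ) (q : ℂ)⁻¹, mul_neg, e2]
  fin_cases b <;> fin_cases a <;> ext i j <;> fin_cases i <;> fin_cases j <;>
    simp [fRep, repK, repKinv, repE, repF, hs, ← hq, e1, e2, e3]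

/-- The matrix with entries `M b a • X`. -/
def scal {q : ℝ} (X : Alg q) (M : Matrix (Fin 4) (Fin 4) ℂ) : Matrix (Fin 4) (Fin 4) (Alg q) :=
  Matrix.of fun b a => M b a • X

theorem scal_mul {q : ℝ} (X Y : Alg q) (M N : Matrix (Fin 4) (Fin 4) ℂ) :
    scal X M * scal Y N = scal (X * Y) (M * N) := by
  ext b a
  simp only [scal, Matrix.mul_apply, Matrix.of_apply, Finset.sum_smul]
  exact Finset.sum_congr rfl fun k _ => smul_mul_smul_comm _ _ _ _

theorem scal_add_left {q : ℝ} (X Y : Alg q) (M : Matrix (Fin 4) (Fin 4) ℂ) :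
    scal (X + Y) M = scal X M + scal Y M := by
  ext b a; exact smul_add (M b a) X Y

theorem scal_sub_left {q : ℝ} (X Y : Alg q) (M : Matrix (Fin 4) (Fin 4) ℂ) :
    scal (X - Y) M = scal X M - scal Y M := by
  ext b a; exact smul_sub (M b a) X Y

theorem scal_smul_left {q : ℝ} (r : ℂ) (X : Alg q) (M : Matrix (Fin 4) (Fin 4) ℂ) :
    scal (r • X) M = r • scal X M := by
  ext b a; exact smul_comm (M b a) r X

theorem scal_sub_right {q : ℝ} (X : Alg q) (M N : Matrix (Fin 4) (Fin 4) ℂ) :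
    scal X (M - N) = scal X M - scal X N := by
  ext b a; exact sub_smul (M b a) (N b a) X

theorem scal_smul_right {q : ℝ} (r : ℂ) (X : Alg q) (M : Matrix (Fin 4) (Fin 4) ℂ) :
    scal X (r • M) = r • scal X M := by
  ext b a; exact mul_smul r (M b a) X

theorem scal_one {q : ℝ} : scal (1 : Alg q) 1 = 1 := by
  ext b a
  by_cases h : b = a
  · subst h; simp [scal]
  · simp [scal, h]

def fA (q : ℝ) : Matrix (Fin 4) (Fin 4) ℂ :=
  !![1, 0, 0, 0; 0, 1, 0, 0; 0, 0, (q : ℂ)⁻¹, 0; 0, 0, (q : ℂ), (q : ℂ)]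

def fD (q : ℝ) : Matrix (Fin 4) (Fin 4) ℂ :=
  !![1, 0, 0, 0; 0, 1, 0, 0; 0, 0, (q : ℂ), 0; 0, 0, -(q : ℂ)⁻¹, (q : ℂ)⁻¹]

def fC (q : ℝ) : Matrix (Fin 4) (Fin 4) ℂ :=
  !![0, 0, 1, 0; 0, 0, 0, 0; 0, 0, 0, 0; 0, (q : ℂ) - (q : ℂ)⁻¹, 0, 0]

def fB (q : ℝ) : Matrix (Fin 4) (Fin 4) ℂ :=
  !![0, 0, 0, 0; 0, 0, -(q : ℂ)⁻¹, 0; 0, 0, 0, 0; -(q : ℂ)⁻¹ * ((q : ℂ) - (q : ℂ)⁻¹), 0, 0, 0]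

theorem fAct_eq {q : ℝ} (h0 : 0 < q) (h1 : q < 1) (i : Fin 2) :
    fAct q i 0 = scal (fund q i 0) (fA q) + scal (fund q i 1) (fC q) ∧
    fAct q i 1 = -((q : ℂ) • scal (fund q i 0) (fB q)) + scal (fund q i 1) (fD q) := by
  have hq0 : (q : ℂ) ≠ 0 := by exact_mod_cast h0.ne'
  have h (j k : Fin 2) : Matrix.of (fun b a => fRep q b a k j) =
      !![!![fA q, -((q : ℂ) • fB q); fC q, fD q] k j] 0 0 := by
    ext b a
    rw [Matrix.of_apply, fRep_eq h0 h1]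
    fin_cases k <;> fin_cases j <;> fin_cases b <;> fin_cases a <;>
      simp [fA, fB, fC, fD, hq0]
  have h' (j : Fin 2) : fAct q i j = scal (fund q i 0) (Matrix.of fun b a => fRep q b a 0 j) +
      scal (fund q i 1) (Matrix.of fun b a => fRep q b a 1 j) := by
    ext b a
    simp only [fAct, scal, Fin.sum_univ_two, Matrix.of_apply, Matrix.add_apply]
  rw [h', h', h, h, h, h, ← neg_smul, ← neg_smul, ← scal_smul_right]
  exact ⟨rfl, rfl⟩

theorem fGen_a {q : ℝ} (h0 : 0 < q) (h1 : q < 1) : fGen q .a =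
    scal (gen q .a) (fA q) - (q : ℂ) • scal (gen q .cStar) (fC q) := by
  have h : fund q 0 1 = (-(q : ℂ)) • gen q .cStar := by
    rw [neg_smul]; rfl
  rw [fGen, (fAct_eq h0 h1 0).1, h, scal_smul_left, neg_smul, sub_eq_add_neg]
  rfl

theorem fGen_c {q : ℝ} (h0 : 0 < q) (h1 : q < 1) : fGen q .c =
    scal (gen q .c) (fA q) + scal (gen q .aStar) (fC q) :=
  (fAct_eq h0 h1 1).1

theorem fGen_aStar {q : ℝ} (h0 : 0 < q) (h1 : q < 1) : fGen q .aStar =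
    scal (gen q .aStar) (fD q) - (q : ℂ) • scal (gen q .c) (fB q) := by
  rw [fGen, (fAct_eq h0 h1 1).2, neg_add_eq_sub]
  rfl

theorem fGen_cStar {q : ℝ} (h0 : 0 < q) (h1 : q < 1) : fGen q .cStar =
    scal (gen q .a) (fB q) + scal (gen q .cStar) (fD q) := by
  have hq0 : (q : ℂ) ≠ 0 := by exact_mod_cast h0.ne'
  have h : fund q 0 1 = (-(q : ℂ)) • gen q .cStar := by
    rw [neg_smul]; rfl
  have h' : fund q 0 0 = gen q .a := rfl
  rw [fGen, (fAct_eq h0 h1 0).2, h, h', scal_smul_left]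
  match_scalars <;> field_simp

theorem f_ac {q : ℝ} (h0 : 0 < q) : fA q * fC q = (q : ℂ) • (fC q * fA q) := by
  have hq0 : (q : ℂ) ≠ 0 := by exact_mod_cast h0.ne'
  ext b a
  fin_cases b <;> fin_cases a <;> simp [fA, fC, Matrix.mul_apply, Fin.sum_univ_four, hq0]

theorem f_ab {q : ℝ} (h0 : 0 < q) : fA q * fB q = (q : ℂ) • (fB q * fA q) := by
  have hq0 : (q : ℂ) ≠ 0 := by exact_mod_cast h0.ne'
  ext b a
  fin_cases b <;> fin_cases a <;> simp [fA, fB, Matrix.mul_apply, Fin.sum_univ_four, hq0]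

theorem f_bd {q : ℝ} (h0 : 0 < q) : fB q * fD q = (q : ℂ) • (fD q * fB q) := by
  have hq0 : (q : ℂ) ≠ 0 := by exact_mod_cast h0.ne'
  ext b a
  fin_cases b <;> fin_cases a <;> simp [fD, fB, Matrix.mul_apply, Fin.sum_univ_four, hq0]

theorem f_cd {q : ℝ} (h0 : 0 < q) : fC q * fD q = (q : ℂ) • (fD q * fC q) := by
  have hq0 : (q : ℂ) ≠ 0 := by exact_mod_cast h0.ne'
  ext b a
  fin_cases b <;> fin_cases a <;> simp [fD, fC, Matrix.mul_apply, Fin.sum_univ_four, hq0]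

theorem f_cb {q : ℝ} (h0 : 0 < q) : fC q * fB q = fB q * fC q := by
  have hq0 : (q : ℂ) ≠ 0 := by exact_mod_cast h0.ne'
  ext b a
  fin_cases b <;> fin_cases a <;> simp [fB, fC, Matrix.mul_apply, Fin.sum_univ_four, mul_comm]

theorem f_da {q : ℝ} (h0 : 0 < q) : fD q * fA q = 1 - fB q * fC q := by
  have hq0 : (q : ℂ) ≠ 0 := by exact_mod_cast h0.ne'
  ext b a
  fin_cases b <;> fin_cases a <;> simp [fA, fB, fC, fD, Matrix.mul_apply, Fin.sum_univ_four, hq0] <;>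
    field_simp <;> ring

theorem f_ad {q : ℝ} (h0 : 0 < q) : fA q * fD q = 1 - ((q : ℂ) ^ 2) • (fB q * fC q) := by
  have hq0 : (q : ℂ) ≠ 0 := by exact_mod_cast h0.ne'
  ext b a
  fin_cases b <;> fin_cases a <;> simp [fA, fB, fC, fD, Matrix.mul_apply, Fin.sum_univ_four, hq0] <;> field_simp <;> ring

theorem fGen_rel {q : ℝ} (h0 : 0 < q) (h1 : q < 1) ⦃x y : FreeAlgebra ℂ Gen⦄ (h : Rel q x y) :
    FreeAlgebra.lift ℂ (fGen q) x = FreeAlgebra.lift ℂ (fGen q) y := by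
  cases h <;>
  simp only [map_mul, map_smul, map_add, map_one, FreeAlgebra.lift_ι_apply, fGen_a h0 h1,
    fGen_c h0 h1, fGen_aStar h0 h1, fGen_cStar h0 h1, mul_add, add_mul, mul_sub, sub_mul,
    smul_mul_assoc, mul_smul_comm, scal_mul, gen_ac, gen_ac', gen_ca, gen_ca', gen_cc, gen_unit₁,
    gen_unit₂, f_ac h0, f_ab h0, f_bd h0, f_cd h0, f_cb h0, f_da h0, f_ad h0, scal_sub_left,
    scal_smul_left, scal_sub_right, scal_smul_right, ← scal_one] <;>
  match_scalars <;> ring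
/-- The algebra map `x ↦ (f_{ba} ▷ x)_{ba}`. -/
def fHom {q : ℝ} (hq : q ∈ Set.Ioo (0 : ℝ) 1) : Alg q →ₐ[ℂ] Matrix (Fin 4) (Fin 4) (Alg q) :=
  RingQuot.liftAlgHom ℂ ⟨FreeAlgebra.lift ℂ (fGen q), fGen_rel hq.1 hq.2⟩

/-! ## Tensors

`Ω^{⊗k}(SU_q(2))` is a free left `A(SU_q(2))`-module on the tensors
`ω_{b_1} ⊗ ... ⊗ ω_{b_k}`; a tensor is represented by the function `b ↦` coefficient of
`ω_{b_1} ⊗ ... ⊗ ω_{b_k}`.  Coefficients in `R = A(SU_q(2))` give all tensors, coefficients in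
`R = ℂ` give the left-invariant ones. -/

/-- Tensors of degree `k` with coefficients in `R`; the left-invariant forms `ω₋, ω₊, ω₀, ω_z` are
numbered `0, 1, 2, 3`. -/
abbrev Tens (R : Type) (k : ℕ) : Type := (Fin k → Fin 4) → R

/-- A complex matrix (entry `M b a` is the coefficient of `ω_b` in the image of `ω_a`) as a left
`R`-linear map on tensors. -/
def act {R : Type} [Ring R] [Algebra ℂ R] {k : ℕ}
    (M : Matrix (Fin k → Fin 4) (Fin k → Fin 4) ℂ) : Tens R k →ₗ[R] Tens R k where
  toFun t := fun b => ∑ a, M b a • t a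
  map_add' t u := by
    funext b
    simp [smul_add, Finset.sum_add_distrib]
  map_smul' r t := by
    funext b
    simp [Finset.mul_sum]

/-- The tensor `ω_{a_1} ⊗ ... ⊗ ω_{a_k} · x`, from `ω_b · x = ∑_a (f_{ba} ▷ x) ω_a`: the
coefficient of `ω_{b_1} ⊗ ... ⊗ ω_{b_k}`. -/
def basisMul {q : ℝ} (hq : q ∈ Set.Ioo (0 : ℝ) 1) :
    (k : ℕ) → Alg q → (Fin k → Fin 4) → (Fin k → Fin 4) → Alg q
  | 0, x, _, _ => x
  | k + 1, x, a, b => fHom hq (basisMul hq k x (Fin.tail a) (Fin.tail b)) (a 0) (b 0)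

/-- The product `ω · x` of a left-invariant tensor with `x ∈ A(SU_q(2))`. -/
def mulRight {q : ℝ} (hq : q ∈ Set.Ioo (0 : ℝ) 1) {k : ℕ} (ω : Tens ℂ k) (x : Alg q) :
    Tens (Alg q) k :=
  fun b => ∑ a, ω a • basisMul hq k x a b

/-- The product `x · ω` of `x ∈ A(SU_q(2))` with a left-invariant tensor. -/
def mulLeft {q : ℝ} {k : ℕ} (x : Alg q) (ω : Tens ℂ k) : Tens (Alg q) k :=
  fun b => ω b • x

/-! ## The braiding -/

/-- The coefficients of `ω_x ⊗ ω_y`. -/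
def e (x y : Fin 4) : Matrix (Fin 4) (Fin 4) ℂ := Matrix.single x y 1

/-- `σ(ω_x ⊗ ω_y)` for the braiding `σ` of the `4D₊` calculus. -/
def braid (q : ℂ) : Fin 4 → Fin 4 → Matrix (Fin 4) (Fin 4) ℂ
  | 0, 0 => e 0 0
  | 1, 1 => e 1 1
  | 2, 2 => e 2 2
  | 0, 2 => (1 - q ^ 2) • e 0 2 + e 2 0
  | 2, 0 => q ^ 2 • e 0 2
  | 0, 3 => (1 + q ^ 2) • e 0 2 + e 3 0
  | 3, 0 => -(1 + q⁻¹ ^ 2) • e 0 2 + q⁻¹ ^ 2 • e 0 3 + (1 - q⁻¹ ^ 2) • e 3 0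
  | 3, 2 => -(q - q⁻¹) ^ 2 • e 3 2 + e 2 3 - (q - q⁻¹) ^ 2 • e 0 1 + (q - q⁻¹) ^ 2 • e 1 0
  | 2, 3 => e 3 2
  | 3, 3 => (q ^ 2 - q⁻¹ ^ 2) • e 3 2 + e 3 3 + (q ^ 2 - q⁻¹ ^ 2) • e 0 1
      - (q ^ 2 - q⁻¹ ^ 2) • e 1 0
  | 0, 1 => -e 3 2 + e 1 0
  | 1, 0 => e 3 2 + e 0 1
  | 1, 2 => (1 - q⁻¹ ^ 2) • e 1 2 + e 2 1
  | 2, 1 => q⁻¹ ^ 2 • e 1 2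
  | 1, 3 => -(1 + q⁻¹ ^ 2) • e 1 2 + e 3 1
  | 3, 1 => (1 + q ^ 2) • e 1 2 + q ^ 2 • e 1 3 + (1 - q ^ 2) • e 3 1

/-- `σ⁻¹(ω_x ⊗ ω_y)`. -/
def braidInv (q : ℂ) : Fin 4 → Fin 4 → Matrix (Fin 4) (Fin 4) ℂ
  | 0, 0 => e 0 0
  | 1, 1 => e 1 1
  | 2, 2 => e 2 2
  | 0, 2 => q⁻¹ ^ 2 • e 2 0
  | 2, 0 => e 0 2 + (1 - q⁻¹ ^ 2) • e 2 0
  | 0, 3 => (1 + q ^ 2) • e 2 0 + (1 - q ^ 2) • e 0 3 + q ^ 2 • e 3 0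
  | 3, 0 => -(1 + q⁻¹ ^ 2) • e 2 0 + e 0 3
  | 3, 2 => e 2 3
  | 2, 3 => e 3 2 - (q - q⁻¹) ^ 2 • e 2 3 - (q - q⁻¹) ^ 2 • e 0 1 + (q - q⁻¹) ^ 2 • e 1 0
  | 3, 3 => (q ^ 2 - q⁻¹ ^ 2) • e 2 3 + e 3 3 + (q ^ 2 - q⁻¹ ^ 2) • e 0 1
      - (q ^ 2 - q⁻¹ ^ 2) • e 1 0
  | 0, 1 => -e 2 3 + e 1 0
  | 1, 0 => e 2 3 + e 0 1
  | 1, 2 => q ^ 2 • e 2 1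
  | 2, 1 => e 1 2 + (1 - q ^ 2) • e 2 1
  | 1, 3 => -(1 + q⁻¹ ^ 2) • e 2 1 + (1 - q⁻¹ ^ 2) • e 1 3 + q⁻¹ ^ 2 • e 3 1
  | 3, 1 => (1 + q ^ 2) • e 2 1 + e 1 3

/-- `σ^{±}` as a matrix on pairs of indices; the sign `+` is `true`, the sign `-` is `false`. -/
def sigma (q : ℝ) (s : Bool) : Matrix (Fin 4 × Fin 4) (Fin 4 × Fin 4) ℂ :=
  Matrix.of fun b a => if s then braid q a.1 a.2 b.1 b.2 else braidInv q a.1 a.2 b.1 b.2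

/-- The two tables are inverse to each other. -/
theorem sigma_mul_sigma {q : ℝ} (h0 : 0 < q) : sigma q true * sigma q false = 1 := by
  have hq0 : (q : ℂ) ≠ 0 := by exact_mod_cast h0.ne'
  ext ⟨b₁, b₂⟩ ⟨a₁, a₂⟩
  rw [Matrix.mul_apply, Fintype.sum_prod_type]
  fin_cases a₁ <;> fin_cases a₂ <;>
    simp [Fin.sum_univ_four, sigma, braid, braidInv, e, Matrix.single, Matrix.one_apply] <;>
    fin_cases b₁ <;> fin_cases b₂ <;> simp <;> field_simp <;> ring

/-- `σ^{±}_j`: the braiding in the places `j, j + 1` (counted from `0`), the identity elsewhere. -/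
def sigmaAt (q : ℝ) (s : Bool) (k j : ℕ) : Matrix (Fin k → Fin 4) (Fin k → Fin 4) ℂ :=
  Matrix.of fun b a =>
    if h : j + 1 < k then
      if ∀ i : Fin k, (i : ℕ) ≠ j → (i : ℕ) ≠ j + 1 → b i = a i then
        sigma q s (b ⟨j, by omega⟩, b ⟨j + 1, h⟩) (a ⟨j, by omega⟩, a ⟨j + 1, h⟩)
      else 0
    else 0

/-- The transposition `τ_j` of the neighbours `j, j + 1`. -/
def nbr (k j : ℕ) : Equiv.Perm (Fin k) :=
  if h : j + 1 < k then Equiv.swap ⟨j, by omega⟩ ⟨j + 1, h⟩ else 1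

/-- A reduced word of a permutation: as long as `p` has a descent `p(j) > p(j+1)`, split off
`τ_j` on the right, `p = (p τ_j) τ_j`, which lowers the length by one.  The first argument bounds
the number of steps. -/
def reducedWord {k : ℕ} : ℕ → Equiv.Perm (Fin k) → List ℕ
  | 0, _ => []
  | n + 1, p =>
    match (List.range (k - 1)).find? fun j =>
        decide (∃ h : j + 1 < k, p ⟨j + 1, h⟩ < p ⟨j, by omega⟩) with
    | none => []
    | some j => reducedWord n (p * nbr k j) ++ [j]

/-- The operator `𝔓^{±}(p) = σ^{±}_{j_1} ⋯ σ^{±}_{j_n}` of `p = τ_{j_1} ⋯ τ_{j_n}` (reduced); by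
the braid relation it does not depend on the reduced word.  A permutation of `k` letters has length
at most `k * k`. -/
def permOp (q : ℝ) (s : Bool) {k : ℕ} (p : Equiv.Perm (Fin k)) :
    Matrix (Fin k → Fin 4) (Fin k → Fin 4) ℂ :=
  ((reducedWord (k * k) p).map (sigmaAt q s k)).prod

/-- The antisymmetriser `A^{(k)}_{±} = ∑_p sign(p) 𝔓^{±}(p)`. -/
def antisym (q : ℝ) (s : Bool) (k : ℕ) : Matrix (Fin k → Fin 4) (Fin k → Fin 4) ℂ :=
  ∑ p : Equiv.Perm (Fin k), ((Equiv.Perm.sign p : ℤ) : ℂ) • permOp q s p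

/-- The shuffles `p(1) < ... < p(k)`, `p(k+1) < ... < p(n)`. -/
def IsShuffle {n : ℕ} (k : ℕ) (p : Equiv.Perm (Fin n)) : Prop :=
  ∀ i j : Fin n, i < j → ((j : ℕ) < k ∨ k ≤ (i : ℕ)) → p i < p j

open Classical in
/-- `B^{±}_{k,n-k}`, the signed sum over the shuffles.  As in the factorisation
`A^{(n)} = (A^{(k)} ⊗ A^{(n-k)}) B_{k,n-k}`, the shuffle `p` puts the factor in the place `p(i)`
into the place `i`, that is, it acts as `𝔓^{±}(p⁻¹)`. -/
def shuffleOp (q : ℝ) (s : Bool) (k n : ℕ) : Matrix (Fin n → Fin 4) (Fin n → Fin 4) ℂ :=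
  ∑ p : Equiv.Perm (Fin n) with IsShuffle k p,
    ((Equiv.Perm.sign p : ℤ) : ℂ) • permOp q s p⁻¹

/-! ## Exterior forms -/

/-- The `k`-forms `Range A^{(k)}_{±}`, with coefficients in `R`. -/
def formsOver (q : ℝ) (s : Bool) (R : Type) [Ring R] [Algebra ℂ R] (k : ℕ) :
    Submodule R (Tens R k) :=
  LinearMap.range (act (R := R) (antisym q s k))

/-- The left-invariant `k`-forms `Ω^k_{± inv}(SU_q(2))`. -/
abbrev InvForms (q : ℝ) (s : Bool) (k : ℕ) : Submodule ℂ (Tens ℂ k) := formsOver q s ℂ k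

/-- The `k`-forms `Ω^k_{±}(SU_q(2))`. -/
abbrev Forms (q : ℝ) (s : Bool) (k : ℕ) : Submodule (Alg q) (Tens (Alg q) k) :=
  formsOver q s (Alg q) k

/-- The exterior form `A^{(k)}_{±}(t)` of a left-invariant tensor `t`; for example
`A^{(2)}_{+}(ω_a ⊗ ω_b) = ω_a ∧ ω_b`. -/
def wedge (q : ℝ) (s : Bool) {k : ℕ} : Tens ℂ k →ₗ[ℂ] InvForms q s k :=
  (act (R := ℂ) (antisym q s k)).rangeRestrict

/-- The antisymmetriser acting on left-invariant forms. -/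
def antisymForm (q : ℝ) (s : Bool) {k : ℕ} : InvForms q s k →ₗ[ℂ] InvForms q s k :=
  (wedge q s).comp (InvForms q s k).subtype

/-- `ω₋* = -ω₊`, `ω₊* = -ω₋`, `ω₀* = -ω₀`, `ω_z* = -ω_z`: the index of `-ω_a*`. -/
def bar : Fin 4 → Fin 4 := ![1, 0, 2, 3]

/-- The antilinear map with
`ω_{a_1} ⊗ ... ⊗ ω_{a_k} ↦ (-1)^{k(k-1)/2} ω_{a_k}* ⊗ ... ⊗ ω_{a_1}*`. -/
def tensStar {k : ℕ} (t : Tens ℂ k) : Tens ℂ k :=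
  fun b => (-1) ^ (k * (k - 1) / 2 + k) * starRingEnd ℂ (t fun i => bar (b (Fin.rev i)))

/-- The `*`-structure on left-invariant forms, determined by the one on 1-forms and by
`(θ ∧ θ')* = (-1)^{kk'} θ'* ∧ θ*`: the `*` of `A^{(k)}_{±}(t)` is `A^{(k)}_{±}(t*)`.  (Independent
of the choice of `t`, because `ker A^{(k)}_{±}` is stable under `*`.) -/
def formStar (q : ℝ) (s : Bool) {k : ℕ} (ξ : InvForms q s k) : InvForms q s k :=
  wedge q s (tensStar (Classical.choose ξ.2))

/-! ## Contractions and Hodge operators -/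

/-- The extension of a sesquilinear contraction with coefficients `Γ_{ab} = Γ(ω_a, ω_b)`
(antilinear in the first argument) to tensors:
`Γ(ω_{a_1} ⊗ ... ⊗ ω_{a_k}, ω_{b_1} ⊗ ... ⊗ ω_{b_n})
  = (∏_{i ≤ k} Γ_{a_i b_i}) ω_{b_{k+1}} ⊗ ... ⊗ ω_{b_n}`, with `n = k + j`. -/
def contract (Γ : Matrix (Fin 4) (Fin 4) ℂ) {k j n : ℕ} (h : k + j = n)
    (ξ : Tens ℂ k) (t : Tens ℂ n) : Tens ℂ j :=
  fun c => ∑ a : Fin k → Fin 4, ∑ b : Fin k → Fin 4,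
    starRingEnd ℂ (ξ a) * (∏ i, Γ (a i) (b i)) * t (Fin.append b c ∘ Fin.cast h.symm)

/-- The tensor `i m ω₋ ⊗ ω₊ ⊗ ω₀ ⊗ ω_z`. -/
def volTens (m : ℝ) : Tens ℂ 4 := fun b => if b = ![0, 1, 2, 3] then Complex.I * m else 0

/-- The volume form `μ = i m ω₋ ∧ ω₊ ∧ ω₀ ∧ ω_z`. -/
def vol (q : ℝ) (s : Bool) (m : ℝ) : InvForms q s 4 := wedge q s (volTens m)

/-- The left-invariant form `1`. -/
def oneForm (q : ℝ) (s : Bool) : InvForms q s 0 := wedge q s fun _ => 1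

/-- The left-invariant 0-form as a complex number. -/
def scalar {q : ℝ} {s : Bool} (ξ : InvForms q s 0) : ℂ := ξ.1 Fin.elim0

/-- `ξ` is a (nonzero) eigenform of the antisymmetriser, with eigenvalue `l`. -/
def IsEigenform (q : ℝ) (s : Bool) {k : ℕ} (ξ : InvForms q s k) (l : ℂ) : Prop :=
  ξ ≠ 0 ∧ antisymForm q s ξ = l • ξ

/-- Families of linear maps `Ω^k_{± inv} → Ω^j_{± inv}`, `k + j = 4`. -/
abbrev InvOp (q : ℝ) (s : Bool) : Type :=
  ∀ k j : ℕ, k + j = 4 → (InvForms q s k →ₗ[ℂ] InvForms q s j)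

/-- `T` is the Hodge operator `𝔗^{±}` of the contraction `Γ` and of the scale `m`: if `ξ` and `ξ*`
are eigenforms of the antisymmetriser with eigenvalues `l = λ_ξ` and `l' = λ_{ξ*}`, then
`𝔗(ξ) = (λ_{ξ*} / λ_ξ) (A^{(4-k)}(Γ(ξ, B_{k,4-k} ϑ)))*` with `ϑ = i m ω₋ ⊗ ω₊ ⊗ ω₀ ⊗ ω_z`. -/
def IsHodge (q : ℝ) (s : Bool) (m : ℝ) (Γ : Matrix (Fin 4) (Fin 4) ℂ) (T : InvOp q s) : Prop :=
  ∀ (k j : ℕ) (h : k + j = 4) (ξ : InvForms q s k) (l l' : ℂ),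
    IsEigenform q s ξ l → IsEigenform q s (formStar q s ξ) l' →
    T k j h ξ = (l' / l) • formStar q s (wedge q s
      (contract Γ h ξ.1 (act (shuffleOp q s k 4) (volTens m))))

/-- The operator `T²` on left-invariant `k`-forms. -/
def sq {q : ℝ} {s : Bool} (T : InvOp q s) (k j : ℕ) (h : k + j = 4) :
    InvForms q s k →ₗ[ℂ] InvForms q s k :=
  (T j k ((Nat.add_comm j k).trans h)).comp (T k j h)

/-- The weights `n_a` of the right `U(1)`-coaction `δ(ω_a) = ω_a ⊗ z^{n_a}`. -/
def weight : Fin 4 → ℤ := ![-2, 2, 0, 0]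

/-- `U(1)`-coinvariant contractions. -/
def IsCoinvariant (Γ : Matrix (Fin 4) (Fin 4) ℂ) : Prop :=
  ∀ a b, weight a ≠ weight b → Γ a b = 0

/-- The contraction `Γ`, with Hodge operator `T`, is invertible, real and maximally hermitian. -/
structure IsRealMaxHerm (q : ℝ) (s : Bool) (m : ℝ) (T : InvOp q s) : Prop where
  invertible : T 4 0 rfl (vol q s m) ≠ 0
  real : ∀ φ : InvForms q s 1, T 1 3 rfl (formStar q s φ) = formStar q s (T 1 3 rfl φ)
  hermitian : ∀ φ : InvForms q s 1,
    sq T 1 3 rfl φ = -(scalar (sq T 0 4 rfl (oneForm q s)) • φ)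
  maximal : ∀ (k j : ℕ) (h : k + j = 4) (l : ℂ), ∃ c : ℂ, ∀ ξ : InvForms q s k,
    antisymForm q s ξ = l • ξ → sq T k j h ξ = c • ξ

/-- The set of `U(1)`-coinvariant, real and maximally hermitian contractions for `𝔗^{±}`. -/
def realMaxHerm (q : ℝ) (s : Bool) (m : ℝ) : Set (Matrix (Fin 4) (Fin 4) ℂ) :=
  {Γ | IsCoinvariant Γ ∧ ∃ T : InvOp q s, IsHodge q s m Γ T ∧ IsRealMaxHerm q s m T}

/-- The quantum determinant
`Γ_{±}(i ω₋ ⊗ ω₊ ⊗ ω₀ ⊗ ω_z, i ω₋ ∧ ω₊ ∧ ω₀ ∧ ω_z)`. -/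
def detq (q : ℝ) (s : Bool) (Γ : Matrix (Fin 4) (Fin 4) ℂ) : ℂ :=
  contract Γ (rfl : 4 + 0 = 4) (volTens 1) (vol q s 1).1 Fin.elim0

/-- `sgn Γ_{±} = det_q Γ_{±} / |det_q Γ_{±}|`. -/
def sgn (q : ℝ) (s : Bool) (Γ : Matrix (Fin 4) (Fin 4) ℂ) : ℂ :=
  detq q s Γ / (‖detq q s Γ‖ : ℂ)

/-! ## Hodge dualities on all forms -/

/-- Families of linear maps `Ω^k_{±} → Ω^j_{±}`, `k + j = 4`. -/
abbrev FormOp (q : ℝ) (s : Bool) : Type :=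
  ∀ k j : ℕ, k + j = 4 → (Forms q s k →ₗ[ℂ] Forms q s j)

/-- `S` extends `T` to all forms left `A(SU_q(2))`-linearly: `S(x ω) = x T(ω)`. -/
def IsLeftExtension {q : ℝ} {s : Bool} (T : InvOp q s) (S : FormOp q s) : Prop :=
  ∀ (k j : ℕ) (h : k + j = 4) (x : Alg q) (ω : InvForms q s k),
    ∃ hx : mulLeft x ω.1 ∈ Forms q s k, (S k j h ⟨mulLeft x ω.1, hx⟩).1 = mulLeft x (T k j h ω).1

/-- `S` extends `T` to all forms right `A(SU_q(2))`-linearly: `S(ω x) = T(ω) x`. -/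
def IsRightExtension {q : ℝ} (hq : q ∈ Set.Ioo (0 : ℝ) 1) {s : Bool} (T : InvOp q s)
    (S : FormOp q s) : Prop :=
  ∀ (k j : ℕ) (h : k + j = 4) (x : Alg q) (ω : InvForms q s k),
    ∃ hx : mulRight hq ω.1 x ∈ Forms q s k,
      (S k j h ⟨mulRight hq ω.1 x, hx⟩).1 = mulRight hq (T k j h ω).1 x

end

end SUq2

/-!
The proof reduces the proposition to linear algebra in the exterior algebra of left-invariant
forms, whose homogeneous parts have the dimensions `1, 4, 6, 4, 1`, and from there to finite
identities over `ℤ[t, t⁻¹]`, where `t = q²`.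

*Computation.* The coefficients of the braiding are Laurent polynomials in `t` with integer
coefficients. A tensor is represented by a formal sum of words (`LinComb`), the operators act on
such sums, and an identity of formal sums in the indeterminate `t`, which the kernel checks by
evaluation, yields the identity of tensors for every `q`.

*Coordinates.* By the braid relations the antisymmetriser is right divisible by every `1 - σ_j`
(`antisym_eq_mul`). So the relations `ω_x ∧ ω_y = ...` of degree `2` may be applied inside a word,
and every word has a normal form, a combination of increasing words, modulo the kernel of the
antisymmetriser (`antisym_incl_coords`). This gives isomorphisms `phi` of `Lam k` with the
left-invariant `k`-forms, for both signs, in which the antisymmetrisers and the conjugation become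
explicit matrices. For `k ≠ 2` the antisymmetriser is a real scalar, the same one for both signs.
For `k = 2` the operators `A_+` and `A_-` have the eigenvalues `1 + t` and `1 + t⁻¹`, their sum
and their product are both `(1 + t) (1 + t⁻¹)`, and the conjugation exchanges them. Hence
`A_+ = A_- (A_+ - 1)`, which shows that the spaces of forms coincide, and the factor
`λ_{ξ*} / λ_ξ` in
the definition of the Hodge operator is the value of the operator `opN`, which is `A_{-s} - 1` in
degree `2` for the sign `s`. Since the eigenforms span the forms, the Hodge operator exists and is
unique (`existsUnique_hodge`): it is `opN` followed by the map given by the contraction.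

*Classification.* In coordinates the Hodge operators are matrices of polynomials in the conjugates
of the coefficients of `Γ`. The conditions for a real and maximally hermitian contraction are
solved for each sign (`isSolution_of_real_of_hermitian_of_maximal`). The result is the same for
both signs and all scales, the explicit family `IsSolution` with a real parameter `p ≠ 0` and a
choice of sign. For its members the quantum determinant is `D = -q² (1 - q²)² p⁴`, so that
`sgn Γ = -1`, the Hodge operators square to `± m² D`, times `opN` for the other sign in
degree `2`, and
those for the two signs differ by `opN` (`IsSolution.isDuality`). The claims on eigenforms and on
the composition of the operators for the two signs follow for the scale `m` with `m² D = -1`.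

*Extension to all forms.* Forms are sums of products `x ω` with left-invariant `ω`, which yields
the left extensions. The right extensions are reduced to the left ones by the map `x ω ↦ ω x`
(`flipMul`). It is bijective because the matrices `(f_{ba} ▷ x)` are triangular with automorphisms
of `A(SU_q(2))` on the diagonal (`fHom_sum_bijective`), and it commutes with the antisymmetrisers
because `σ` commutes with the right multiplication (`sigma_fHom`), which has to be checked only on
generators.
-/

namespace SUq2

/-! ### Formal combinations with Laurent monomial coefficients -/

/-- A formal finite sum of terms `c t^e · x`, stored as triples `(x, e, c)`; the indeterminate `t`
stands for `q²` (for `q` in the study of the right multiplication).  Such sums can be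
compared by evaluation, which reduces identities between tensors
to finite computations with integers. -/
abbrev LinComb (α : Type) : Type := List (α × ℤ × ℤ)

namespace LinComb

variable {α β E F : Type} [AddCommGroup E] [Module ℂ E] [AddCommGroup F] [Module ℂ F]

/-- The value of a formal sum at `t`, where `f x` is substituted for `x`. -/
noncomputable def eval (t : ℂ) (f : α → E) (c : LinComb α) : E :=
  (c.map fun x => ((x.2.2 : ℂ) * t ^ x.2.1) • f x.1).sum

/-- The multiple by `c t^e`. -/
def scale (e c : ℤ) (l : LinComb α) : LinComb α := l.map fun x => (x.1, x.2.1 + e, x.2.2 * c)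

/-- Substitution of formal sums for the basis elements of a formal sum. -/
def bind (l : LinComb α) (g : α → LinComb β) : LinComb β :=
  l.flatMap fun x => scale x.2.1 x.2.2 (g x.1)

/-- Adds one term to a formal sum, merging it with a term with the same monomial. -/
def insertTerm [DecidableEq α] (x : α × ℤ × ℤ) : LinComb α → LinComb α
  | [] => [x]
  | y :: l =>
    if y.1 = x.1 ∧ y.2.1 = x.2.1 then (y.1, y.2.1, y.2.2 + x.2.2) :: l else y :: insertTerm x l

/-- Collects the terms with equal monomials and drops those with coefficient `0`. -/
def collect [DecidableEq α] (l : LinComb α) : LinComb α :=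
  (l.foldr insertTerm []).filter fun x => x.2.2 ≠ 0

/-- The difference of two formal sums. -/
def sub (l m : LinComb α) : LinComb α := l ++ scale 0 (-1) m

@[simp] theorem eval_nil (t : ℂ) (f : α → E) : eval t f [] = 0 := rfl

@[simp] theorem eval_cons (t : ℂ) (f : α → E) (x : α × ℤ × ℤ) (l : LinComb α) :
    eval t f (x :: l) = ((x.2.2 : ℂ) * t ^ x.2.1) • f x.1 + eval t f l := rfl

@[simp] theorem eval_append (t : ℂ) (f : α → E) (l m : LinComb α) :
    eval t f (l ++ m) = eval t f l + eval t f m := by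
  simp [eval]

theorem eval_scale {t : ℂ} (ht : t ≠ 0) (f : α → E) (e c : ℤ) (l : LinComb α) :
    eval t f (scale e c l) = ((c : ℂ) * t ^ e) • eval t f l := by
  induction l with
  | nil => simp [scale]
  | cons x l ih =>
    have : scale e c (x :: l) = (x.1, x.2.1 + e, x.2.2 * c) :: scale e c l := rfl
    rw [this, eval_cons, eval_cons, ih, smul_add, smul_smul]
    push_cast
    rw [zpow_add₀ ht]
    ring_nf

theorem eval_bind {t : ℂ} (ht : t ≠ 0) (f : β → E) (l : LinComb α) (g : α → LinComb β) :
    eval t f (l.bind g) = eval t (fun x => eval t f (g x)) l := by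
  induction l with
  | nil => rfl
  | cons x l ih =>
    have : bind (x :: l) g = scale x.2.1 x.2.2 (g x.1) ++ bind l g := rfl
    rw [this, eval_append, ih, eval_scale ht, eval_cons]

theorem eval_sub {t : ℂ} (ht : t ≠ 0) (f : α → E) (l m : LinComb α) :
    eval t f (l.sub m) = eval t f l - eval t f m := by
  rw [sub, eval_append, eval_scale ht]
  simp [sub_eq_add_neg]

theorem eval_insertTerm [DecidableEq α] (t : ℂ) (f : α → E) (x : α × ℤ × ℤ) (l : LinComb α) :
    eval t f (insertTerm x l) = ((x.2.2 : ℂ) * t ^ x.2.1) • f x.1 + eval t f l := by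
  induction l with
  | nil => rfl
  | cons y l ih =>
    rw [insertTerm]
    split_ifs with h
    · rw [eval_cons, eval_cons, ← h.1, ← h.2]
      push_cast
      module
    · rw [eval_cons, ih, eval_cons]
      module

theorem eval_collect [DecidableEq α] (t : ℂ) (f : α → E) (l : LinComb α) :
    eval t f l.collect = eval t f l := by
  have h1 (m : LinComb α) : eval t f (m.filter fun x => x.2.2 ≠ 0) = eval t f m := by
    induction m with
    | nil => rfl
    | cons x m ih =>
      by_cases hx : x.2.2 = 0
      · rw [List.filter_cons_of_neg (by simpa using hx), ih, eval_cons, hx]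
        simp
      · rw [List.filter_cons_of_pos (by simpa using hx), eval_cons, eval_cons, ih]
  rw [collect, h1]
  induction l with
  | nil => rfl
  | cons x l ih => rw [List.foldr_cons, eval_insertTerm, ih, eval_cons]

/-- Two formal sums with the same collected form have the same values. -/
theorem eval_eq_of_collect_sub [DecidableEq α] {t : ℂ} (ht : t ≠ 0) (f : α → E) {l m : LinComb α}
    (h : (l.sub m).collect = []) : eval t f l = eval t f m := by
  rw [← sub_eq_zero, ← eval_sub ht, ← eval_collect, h, eval_nil]

theorem map_eval (t : ℂ) (g : E →ₗ[ℂ] F) (f : α → E) (l : LinComb α) :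
    g (eval t f l) = eval t (fun x => g (f x)) l := by
  induction l with
  | nil => simp
  | cons x l ih => simp [ih]

theorem eval_congr (t : ℂ) {f g : α → E} {l : LinComb α} (h : ∀ x ∈ l, f x.1 = g x.1) :
    eval t f l = eval t g l := by
  induction l with
  | nil => rfl
  | cons x l ih =>
    rw [eval_cons, eval_cons, h x (by simp), ih fun y hy => h y (by simp [hy])]

theorem eval_map (t : ℂ) (f : β → E) (g : α → β) (l : LinComb α) :
    eval t f (l.map fun x => (g x.1, x.2)) = eval t (fun x => f (g x)) l := by
  induction l with
  | nil => rfl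
  | cons x l ih => rw [List.map_cons, eval_cons, ih, eval_cons]

end LinComb

/-! ### Words and the braiding -/

/-- The tensor `ω_{l_1} ⊗ ... ⊗ ω_{l_k}` of a word `l` of length `k`. -/
noncomputable def wordT (k : ℕ) (l : List (Fin 4)) : Tens ℂ k :=
  Pi.single (fun i : Fin k => l.getD i 0) 1

/-- The images `σ^{±}(ω_x ⊗ ω_y)` as formal sums, with `t = q²`. -/
def sigmaTab : Bool → Fin 4 → Fin 4 → LinComb (Fin 4 × Fin 4)
  | _, 0, 0 => [((0, 0), 0, 1)]
  | _, 1, 1 => [((1, 1), 0, 1)]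
  | _, 2, 2 => [((2, 2), 0, 1)]
  | true, 0, 2 => [((0, 2), 0, 1), ((0, 2), 1, -1), ((2, 0), 0, 1)]
  | true, 2, 0 => [((0, 2), 1, 1)]
  | true, 0, 3 => [((0, 2), 0, 1), ((0, 2), 1, 1), ((3, 0), 0, 1)]
  | true, 3, 0 => [((0, 2), 0, -1), ((0, 2), -1, -1), ((0, 3), -1, 1), ((3, 0), 0, 1),
      ((3, 0), -1, -1)]
  | true, 3, 2 => [((3, 2), 1, -1), ((3, 2), 0, 2), ((3, 2), -1, -1), ((2, 3), 0, 1),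
      ((0, 1), 1, -1), ((0, 1), 0, 2), ((0, 1), -1, -1),
      ((1, 0), 1, 1), ((1, 0), 0, -2), ((1, 0), -1, 1)]
  | true, 2, 3 => [((3, 2), 0, 1)]
  | true, 3, 3 => [((3, 2), 1, 1), ((3, 2), -1, -1), ((3, 3), 0, 1), ((0, 1), 1, 1),
      ((0, 1), -1, -1), ((1, 0), 1, -1), ((1, 0), -1, 1)]
  | true, 0, 1 => [((3, 2), 0, -1), ((1, 0), 0, 1)]
  | true, 1, 0 => [((3, 2), 0, 1), ((0, 1), 0, 1)]
  | true, 1, 2 => [((1, 2), 0, 1), ((1, 2), -1, -1), ((2, 1), 0, 1)]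
  | true, 2, 1 => [((1, 2), -1, 1)]
  | true, 1, 3 => [((1, 2), 0, -1), ((1, 2), -1, -1), ((3, 1), 0, 1)]
  | true, 3, 1 => [((1, 2), 0, 1), ((1, 2), 1, 1), ((1, 3), 1, 1), ((3, 1), 0, 1), ((3, 1), 1, -1)]
  | false, 0, 2 => [((2, 0), -1, 1)]
  | false, 2, 0 => [((0, 2), 0, 1), ((2, 0), 0, 1), ((2, 0), -1, -1)]
  | false, 0, 3 => [((2, 0), 0, 1), ((2, 0), 1, 1), ((0, 3), 0, 1), ((0, 3), 1, -1), ((3, 0), 1, 1)]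
  | false, 3, 0 => [((2, 0), 0, -1), ((2, 0), -1, -1), ((0, 3), 0, 1)]
  | false, 3, 2 => [((2, 3), 0, 1)]
  | false, 2, 3 => [((3, 2), 0, 1), ((2, 3), 1, -1), ((2, 3), 0, 2), ((2, 3), -1, -1),
      ((0, 1), 1, -1), ((0, 1), 0, 2), ((0, 1), -1, -1),
      ((1, 0), 1, 1), ((1, 0), 0, -2), ((1, 0), -1, 1)]
  | false, 3, 3 => [((2, 3), 1, 1), ((2, 3), -1, -1), ((3, 3), 0, 1), ((0, 1), 1, 1),
      ((0, 1), -1, -1), ((1, 0), 1, -1), ((1, 0), -1, 1)]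
  | false, 0, 1 => [((2, 3), 0, -1), ((1, 0), 0, 1)]
  | false, 1, 0 => [((2, 3), 0, 1), ((0, 1), 0, 1)]
  | false, 1, 2 => [((2, 1), 1, 1)]
  | false, 2, 1 => [((1, 2), 0, 1), ((2, 1), 0, 1), ((2, 1), 1, -1)]
  | false, 1, 3 => [((2, 1), 0, -1), ((2, 1), -1, -1), ((1, 3), 0, 1), ((1, 3), -1, -1),
      ((3, 1), -1, 1)]
  | false, 3, 1 => [((2, 1), 0, 1), ((2, 1), 1, 1), ((1, 3), 0, 1)]

theorem sum_single_smul {E : Type} [AddCommGroup E] [Module ℂ E] (F : Fin 4 × Fin 4 → E)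
    (x y : Fin 4) : ∑ b : Fin 4 × Fin 4, e x y b.1 b.2 • F b = F (x, y) := by
  rw [Finset.sum_eq_single (x, y)]
  · simp [e]
  · rintro ⟨b₁, b₂⟩ _ hb
    rw [e, Matrix.single_apply_of_ne, zero_smul]
    rintro ⟨rfl, rfl⟩
    exact hb rfl
  · simp

theorem sum_sigma_smul {q : ℝ} (h0 : 0 < q) {E : Type} [AddCommGroup E] [Module ℂ E] (s : Bool)
    (x y : Fin 4) (F : Fin 4 × Fin 4 → E) :
    ∑ b, sigma q s b (x, y) • F b = LinComb.eval ((q : ℂ) ^ 2) F (sigmaTab s x y) := by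
  have hq0 : (q : ℂ) ≠ 0 := by exact_mod_cast h0.ne'
  have hm : ((q : ℂ) ^ 2) ^ (-1 : ℤ) = (q : ℂ)⁻¹ ^ 2 := by rw [zpow_neg_one, inv_pow]
  have hw : ((q : ℂ) - (q : ℂ)⁻¹) ^ 2 = (q : ℂ) ^ 2 - 2 + (q : ℂ)⁻¹ ^ 2 := by
    field_simp
    ring
  cases s <;> fin_cases x <;> fin_cases y <;>
    simp [sigma, braid, braidInv, sigmaTab, LinComb.eval_cons, add_smul, sub_smul, mul_smul,
      Finset.sum_add_distrib, Finset.sum_sub_distrib, ← Finset.smul_sum, sum_single_smul, -inv_pow,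
      -zpow_neg, -Int.reduceNeg, hm, hw] <;> try module

open LinComb

theorem LinComb.forall_collect {α : Type} [DecidableEq α] {P : α → Prop} {l : LinComb α}
    (hl : ∀ x ∈ l, P x.1) : ∀ x ∈ l.collect, P x.1 := by
  have h1 (x : α × ℤ × ℤ) (l : LinComb α) (hx : P x.1) (hl : ∀ y ∈ l, P y.1) :
      ∀ y ∈ insertTerm x l, P y.1 := by
    induction l with
    | nil => intro y hy; simp [insertTerm] at hy; simpa [hy] using hx
    | cons z l ih =>
      intro y hy
      rw [insertTerm] at hy
      split_ifs at hy with h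
      · rcases List.mem_cons.1 hy with rfl | hy
        exacts [hl z (by simp), hl y (by simp [hy])]
      · rcases List.mem_cons.1 hy with rfl | hy
        exacts [hl y (by simp), ih (fun y hy => hl y (by simp [hy])) y hy]
  have h2 : ∀ x ∈ l.foldr insertTerm [], P x.1 := by
    induction l with
    | nil => simp
    | cons z l ih =>
      exact h1 z _ (hl z (by simp)) (ih fun y hy => hl y (by simp [hy]))
  exact fun x hx => h2 x (List.mem_filter.1 hx).1

theorem act_mul {R : Type} [Ring R] [Algebra ℂ R] {k : ℕ}
    (M N : Matrix (Fin k → Fin 4) (Fin k → Fin 4) ℂ) (x : Tens R k) :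
    act (M * N) x = act M (act N x) := by
  funext b
  simp only [act, LinearMap.coe_mk, AddHom.coe_mk, Matrix.mul_apply, Finset.sum_smul,
    Finset.smul_sum, mul_smul]
  exact Finset.sum_comm

theorem act_one {R : Type} [Ring R] [Algebra ℂ R] {k : ℕ} (x : Tens R k) :
    act (1 : Matrix (Fin k → Fin 4) (Fin k → Fin 4) ℂ) x = x := by
  funext b
  simp [act, Matrix.one_apply]

theorem act_add {R : Type} [Ring R] [Algebra ℂ R] {k : ℕ}
    (M N : Matrix (Fin k → Fin 4) (Fin k → Fin 4) ℂ) (x : Tens R k) :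
    act (M + N) x = act M x + act N x := by
  funext b
  simp [act, add_smul, Finset.sum_add_distrib]

theorem act_sub {R : Type} [Ring R] [Algebra ℂ R] {k : ℕ}
    (M N : Matrix (Fin k → Fin 4) (Fin k → Fin 4) ℂ) (x : Tens R k) :
    act (M - N) x = act M x - act N x := by
  funext b
  simp [act, sub_smul, Finset.sum_sub_distrib]

theorem act_smul {R : Type} [Ring R] [Algebra ℂ R] {k : ℕ} (r : ℂ)
    (M : Matrix (Fin k → Fin 4) (Fin k → Fin 4) ℂ) (x : Tens R k) :
    act (r • M) x = r • act M x := by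
  funext b
  simp [act, mul_smul, Finset.smul_sum]

/-- Every tensor is the combination of the basis words given by its coefficients. -/
theorem sum_smul_wordT {k : ℕ} (t : Tens ℂ k) : t = ∑ b, t b • wordT k (List.ofFn b) := by
  have h (b : Fin k → Fin 4) : wordT k (List.ofFn b) = Pi.single b 1 := by
    rw [wordT]
    congr 1
    funext i
    simp [List.getD]
  funext c
  simp [h, Finset.sum_apply, Pi.single_apply]

theorem getD_append_cons_cons (u v : List (Fin 4)) (x y : Fin 4) (i : ℕ) :
    (u ++ x :: y :: v).getD i 0 =
      if i = u.length then x else if i = u.length + 1 then y else (u ++ 0 :: 0 :: v).getD i 0 := by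
  induction u generalizing i with
  | nil => rcases i with _ | _ | i <;> simp
  | cons a u ih =>
    rcases i with _ | i
    · simp
    · simpa using ih i

theorem act_sigmaAt_wordT (q : ℝ) (s : Bool) {k : ℕ} (u v : List (Fin 4)) (x y : Fin 4)
    (hk : (u ++ x :: y :: v).length = k) :
    act (sigmaAt q s k u.length) (wordT k (u ++ x :: y :: v)) =
      ∑ b, sigma q s b (x, y) • wordT k (u ++ b.1 :: b.2 :: v) := by
  have hj : u.length + 1 < k := by
    simp only [List.length_append, List.length_cons] at hk
    omega
  funext c
  have h1 : act (sigmaAt q s k u.length) (wordT k (u ++ x :: y :: v)) c =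
      sigmaAt q s k u.length c fun i : Fin k => (u ++ x :: y :: v).getD i 0 := by
    simp [act, wordT, Pi.single_apply]
  have hw (b : Fin 4 × Fin 4) : wordT k (u ++ b.1 :: b.2 :: v) c =
      if (∀ i : Fin k, (i : ℕ) ≠ u.length → (i : ℕ) ≠ u.length + 1 →
        c i = (u ++ x :: y :: v).getD i 0) then
        (if b = (c ⟨u.length, by omega⟩, c ⟨u.length + 1, hj⟩) then 1 else 0) else 0 := by
    rw [wordT, Pi.single_apply, ← ite_and]
    congr 1
    apply propext
    constructor
    · intro h
      subst h
      refine ⟨fun i hi hi' => ?_, ?_⟩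
      · change (u ++ b.1 :: b.2 :: v).getD i 0 = _
        rw [getD_append_cons_cons, getD_append_cons_cons u v x y, if_neg hi, if_neg hi', if_neg hi,
          if_neg hi']
      · change b = ((u ++ b.1 :: b.2 :: v).getD u.length 0,
          (u ++ b.1 :: b.2 :: v).getD (u.length + 1) 0)
        rw [getD_append_cons_cons, getD_append_cons_cons]
        simp
    · rintro ⟨h, h'⟩
      funext i
      rw [getD_append_cons_cons]
      split_ifs with hi hi'
      · rw [h']
        exact congrArg c (Fin.ext hi)
      · rw [h']
        exact congrArg c (Fin.ext hi')
      · rw [h i hi hi', getD_append_cons_cons, if_neg hi, if_neg hi']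
  rw [h1, sigmaAt, Matrix.of_apply, dif_pos hj, Finset.sum_apply]
  simp only [Pi.smul_apply, smul_eq_mul, hw]
  have e1 : (u ++ x :: y :: v).getD u.length 0 = x := by
    rw [getD_append_cons_cons]; simp
  have e2 : (u ++ x :: y :: v).getD (u.length + 1) 0 = y := by
    rw [getD_append_cons_cons]; simp
  split_ifs with h
  · simp only [e1, e2]
    simp
  · simp

/-- The braiding in the places `j, j + 1` of a word. -/
def sigmaWord (s : Bool) : ℕ → List (Fin 4) → LinComb (List (Fin 4))
  | 0, x :: y :: v => (sigmaTab s x y).map fun z => (z.1.1 :: z.1.2 :: v, z.2)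
  | j + 1, x :: w => (sigmaWord s j w).map fun z => (x :: z.1, z.2)
  | _, _ => []

theorem sigmaWord_append (s : Bool) (u v : List (Fin 4)) (x y : Fin 4) :
    sigmaWord s u.length (u ++ x :: y :: v) =
      (sigmaTab s x y).map fun z => (u ++ z.1.1 :: z.1.2 :: v, z.2) := by
  induction u with
  | nil => rfl
  | cons a u ih => simp [sigmaWord, ih]

/-- A formal sum of words of length `k`. -/
def Homog (k : ℕ) (c : LinComb (List (Fin 4))) : Prop := ∀ x ∈ c, x.1.length = k

theorem exists_split {j : ℕ} {w : List (Fin 4)} (h : j + 1 < w.length) :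
    ∃ u x y v, w = u ++ x :: y :: v ∧ u.length = j := by
  induction j generalizing w with
  | zero =>
    rcases w with _ | ⟨x, _ | ⟨y, v⟩⟩
    · simp at h
    · simp at h
    · exact ⟨[], x, y, v, rfl, rfl⟩
  | succ j ih =>
    rcases w with _ | ⟨a, w⟩
    · simp at h
    · obtain ⟨u, x, y, v, rfl, hu⟩ := ih (w := w) (by simpa using h)
      exact ⟨a :: u, x, y, v, rfl, by simp [hu]⟩

/-- The tensor that a formal sum of words stands for. -/
noncomputable abbrev val (q : ℝ) (k : ℕ) (c : LinComb (List (Fin 4))) : Tens ℂ k :=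
  eval ((q : ℂ) ^ 2) (wordT k) c

/-- The braiding in the places `j, j + 1`, on formal sums of words. -/
def sigmaComb (s : Bool) (j : ℕ) (c : LinComb (List (Fin 4))) : LinComb (List (Fin 4)) :=
  (c.bind (sigmaWord s j)).collect

theorem Homog.append {k : ℕ} {c d : LinComb (List (Fin 4))} (hc : Homog k c) (hd : Homog k d) :
    Homog k (c ++ d) := by
  intro x hx
  rcases List.mem_append.1 hx with h | h
  exacts [hc x h, hd x h]

theorem Homog.scale {k : ℕ} {c : LinComb (List (Fin 4))} (hc : Homog k c) (a b : ℤ) :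
    Homog k (scale a b c) := by
  intro x hx
  obtain ⟨y, hy, rfl⟩ := List.mem_map.1 hx
  exact hc y hy

theorem Homog.collect {k : ℕ} {c : LinComb (List (Fin 4))} (hc : Homog k c) :
    Homog k c.collect :=
  LinComb.forall_collect (α := List (Fin 4)) (P := fun w => w.length = k) hc

theorem Homog.sigmaComb {k j : ℕ} (hj : j + 1 < k) {s : Bool} {c : LinComb (List (Fin 4))}
    (hc : Homog k c) : Homog k (sigmaComb s j c) := by
  refine Homog.collect fun x hx => ?_
  obtain ⟨y, hy, hx⟩ := List.mem_flatMap.1 hx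
  obtain ⟨z, hz, rfl⟩ := List.mem_map.1 hx
  have hyk := hc y hy
  obtain ⟨u, a, b, v, huv, rfl⟩ := exists_split (w := y.1) (hyk ▸ hj)
  rw [huv, sigmaWord_append] at hz
  obtain ⟨z', -, rfl⟩ := List.mem_map.1 hz
  rw [← hyk, huv]
  simp

/-- The braiding acts locally: the letters `u` before and `v` after the affected ones are kept. -/
theorem act_sigmaAt_eval {q : ℝ} (h0 : 0 < q) {k n j i : ℕ} (hj : j + 1 < n) (s : Bool)
    (u v : List (Fin 4)) (hk : u.length + n + v.length = k) (hi : u.length + j = i)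
    {c : LinComb (List (Fin 4))} (hc : Homog n c) :
    act (sigmaAt q s k i) (eval ((q : ℂ) ^ 2) (fun z => wordT k (u ++ z ++ v)) c) =
      eval ((q : ℂ) ^ 2) (fun z => wordT k (u ++ z ++ v)) (sigmaComb s j c) := by
  have ht : (q : ℂ) ^ 2 ≠ 0 := pow_ne_zero _ (by exact_mod_cast h0.ne')
  subst hi
  rw [sigmaComb, eval_collect, eval_bind ht, map_eval]
  refine eval_congr _ fun x hx => ?_
  obtain ⟨u', a, b, v', huv, rfl⟩ := exists_split (w := x.1) (hc x hx ▸ hj)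
  have hx' := hc x hx
  have h := act_sigmaAt_wordT q s (k := k) (u ++ u') (v' ++ v) a b (by
    rw [huv] at hx'
    simp only [List.length_append, List.length_cons] at hx' ⊢
    omega)
  rw [List.length_append] at h
  simp only [huv, sigmaWord_append, List.append_assoc, List.cons_append] at h ⊢
  rw [h, sum_sigma_smul h0 s a b fun b => wordT k (u ++ (u' ++ b.1 :: b.2 :: (v' ++ v))),
    eval_map _ _ fun z : Fin 4 × Fin 4 => u' ++ z.1 :: z.2 :: v']
  simp

theorem val_sigmaComb {q : ℝ} (h0 : 0 < q) {k j : ℕ} (hj : j + 1 < k) (s : Bool)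
    {c : LinComb (List (Fin 4))} (hc : Homog k c) :
    val q k (sigmaComb s j c) = act (sigmaAt q s k j) (val q k c) := by
  simpa using (act_sigmaAt_eval h0 hj s [] [] (by simp) (by simp) hc).symm

/-! ### The braid relations -/

/-- The braid relation on `ω_a ⊗ ω_b ⊗ ω_c`: an identity of formal sums with coefficients in
`ℤ[t, t⁻¹]`, which holds for all `q` once it is checked for the indeterminate `t = q²`. -/
theorem braidRel_comb (s : Bool) (a b c : Fin 4) :
    ((sigmaComb s 0 (sigmaComb s 1 (sigmaComb s 0 [([a, b, c], 0, 1)]))).sub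
      (sigmaComb s 1 (sigmaComb s 0 (sigmaComb s 1 [([a, b, c], 0, 1)])))).collect = [] := by
  revert s a b c
  decide +kernel

theorem ext_wordT {k : ℕ} {M N : Matrix (Fin k → Fin 4) (Fin k → Fin 4) ℂ}
    (h : ∀ l : List (Fin 4), l.length = k → act M (wordT k l) = act N (wordT k l)) : M = N := by
  have e (M : Matrix (Fin k → Fin 4) (Fin k → Fin 4) ℂ) (a b) :
      M b a = act M (wordT k (List.ofFn a)) b := by
    have : wordT k (List.ofFn a) = Pi.single a 1 := by
      rw [wordT]
      congr 1
      funext i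
      simp [List.getD]
    simp [this, act, Pi.single_apply]
  ext b a
  rw [e M, e N, h _ (by simp)]

theorem homog_single {k : ℕ} {w : List (Fin 4)} (hw : w.length = k) (a b : ℤ) :
    Homog k [(w, a, b)] := by
  intro x hx
  rw [List.mem_singleton.1 hx]
  exact hw

theorem sigmaAt_braid {q : ℝ} (h0 : 0 < q) (s : Bool) {k j : ℕ} (hj : j + 2 < k) :
    sigmaAt q s k j * (sigmaAt q s k (j + 1) * sigmaAt q s k j) =
      sigmaAt q s k (j + 1) * (sigmaAt q s k j * sigmaAt q s k (j + 1)) := by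
  have ht : (q : ℂ) ^ 2 ≠ 0 := pow_ne_zero _ (by exact_mod_cast h0.ne')
  refine ext_wordT fun l hl => ?_
  obtain ⟨u, a, w, hw, rfl⟩ : ∃ u a w, l = u ++ a :: w ∧ u.length = j :=
    ⟨l.take j, l[j], l.drop (j + 1), by
      rw [List.getElem_cons_drop, List.take_append_drop], by
      rw [List.length_take]; omega⟩
  obtain ⟨b, c, v, rfl⟩ : ∃ b c v, w = b :: c :: v := by
    subst hw
    rcases w with _ | ⟨b, _ | ⟨c, v⟩⟩
    · simp at hl; omega
    · simp at hl; omega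
    · exact ⟨b, c, v, rfl⟩
  subst hw
  have hk : u.length + 3 + v.length = k := by
    simp only [List.length_append, List.length_cons] at hl
    omega
  have h1 : wordT k (u ++ a :: b :: c :: v) =
      eval ((q : ℂ) ^ 2) (fun z => wordT k (u ++ z ++ v)) [([a, b, c], 0, 1)] := by
    simp
  have hH : Homog 3 [([a, b, c], 0, 1)] := homog_single rfl _ _
  have e0 {c : LinComb (List (Fin 4))} (hc : Homog 3 c) :=
    act_sigmaAt_eval h0 (j := 0) (by norm_num) s u v hk rfl hc
  have e1 {c : LinComb (List (Fin 4))} (hc : Homog 3 c) :=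
    act_sigmaAt_eval h0 (j := 1) (by norm_num) s u v hk rfl hc
  have p0 {c : LinComb (List (Fin 4))} (hc : Homog 3 c) : Homog 3 (sigmaComb s 0 c) :=
    hc.sigmaComb (by norm_num)
  have p1 {c : LinComb (List (Fin 4))} (hc : Homog 3 c) : Homog 3 (sigmaComb s 1 c) :=
    hc.sigmaComb (by norm_num)
  simp only [add_zero] at e0
  rw [h1, act_mul, act_mul, act_mul, act_mul, e0 hH, e1 (p0 hH), e0 (p1 (p0 hH)), e1 hH,
    e0 (p1 hH), e1 (p0 (p1 hH))]
  exact eval_eq_of_collect_sub ht _ (braidRel_comb s a b c)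

/-- The braidings in the first two and in the last two of four places commute. -/
theorem sigmaAt_comm (q : ℝ) (s : Bool) :
    sigmaAt q s 4 2 * sigmaAt q s 4 0 = sigmaAt q s 4 0 * sigmaAt q s 4 2 := by
  refine ext_wordT fun l hl => ?_
  obtain ⟨a, b, c, d, rfl⟩ : ∃ a b c d, l = [a, b, c, d] := by
    match l, hl with
    | [a, b, c, d], _ => exact ⟨a, b, c, d, rfl⟩
  have e0 (a b c d : Fin 4) := act_sigmaAt_wordT q s (k := 4) [] [c, d] a b rfl
  have e2 (a b c d : Fin 4) := act_sigmaAt_wordT q s (k := 4) [a, b] [] c d rfl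
  simp only [List.nil_append, List.length_nil, List.cons_append, List.length_cons, zero_add,
    Nat.reduceAdd] at e0 e2
  simp only [act_mul, e0, e2, map_sum, map_smul, Finset.smul_sum]
  rw [Finset.sum_comm]
  exact Finset.sum_congr rfl fun _ _ => Finset.sum_congr rfl fun _ _ => smul_comm _ _ _

/-! ### The antisymmetrisers as products -/

/-- The alternating sum `1 - σ_{j₁} + σ_{j₂} σ_{j₁} - ...` for a list `j₁, j₂, ...` of places. -/
noncomputable def altMatrix (q : ℝ) (s : Bool) (k : ℕ) :
    List ℕ → Matrix (Fin k → Fin 4) (Fin k → Fin 4) ℂ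
  | [] => 1
  | j :: l => 1 - altMatrix q s k l * sigmaAt q s k j

/-- The alternating sum `1 - σ_{j₁} + σ_{j₂} σ_{j₁} - ...` on formal sums of words. -/
def altComb (s : Bool) : List ℕ → LinComb (List (Fin 4)) → LinComb (List (Fin 4))
  | [], c => c
  | j :: l, c => (c.sub (altComb s l (sigmaComb s j c))).collect

theorem Homog.altComb {k : ℕ} {s : Bool} {l : List ℕ} (hl : ∀ j ∈ l, j + 1 < k)
    {c : LinComb (List (Fin 4))} (hc : Homog k c) : Homog k (altComb s l c) := by
  induction l generalizing c with
  | nil => exact hc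
  | cons j l ih =>
    exact (hc.append ((ih (fun i hi => hl i (by simp [hi]))
      (hc.sigmaComb (hl j (by simp)))).scale _ _)).collect

theorem val_altComb {q : ℝ} (h0 : 0 < q) {k : ℕ} (s : Bool) {l : List ℕ}
    (hl : ∀ j ∈ l, j + 1 < k) {c : LinComb (List (Fin 4))} (hc : Homog k c) :
    val q k (altComb s l c) = act (altMatrix q s k l) (val q k c) := by
  have ht : (q : ℂ) ^ 2 ≠ 0 := pow_ne_zero _ (by exact_mod_cast h0.ne')
  induction l generalizing c with
  | nil => rw [altMatrix, act_one, altComb]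
  | cons j l ih =>
    have hj := hl j (by simp)
    rw [altComb, val, eval_collect, eval_sub ht, altMatrix, act_sub, act_one, act_mul,
      ← val_sigmaComb h0 hj s hc, ← ih (fun i hi => hl i (by simp [hi])) (hc.sigmaComb hj)]

/-- The product of the alternating sums over `k - 2, ..., 0`, over `k - 3, ..., 0`, and so on. -/
def antisymComb (s : Bool) : ℕ → LinComb (List (Fin 4)) → LinComb (List (Fin 4))
  | k + 2, c => altComb s (List.range (k + 1)).reverse (antisymComb s (k + 1) c)
  | _, c => c

/-- The signs and reduced words of the permutations of `k` letters. -/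
def permData (k : ℕ) : Multiset (ℤ × List ℕ) :=
  (Finset.univ : Finset (Equiv.Perm (Fin k))).val.map fun p =>
    ((Equiv.Perm.sign p : ℤ), reducedWord (k * k) p)

/-- The antisymmetriser depends only on the signs and the reduced words of the permutations, a
finite list that the kernel can compute. -/
theorem antisym_eq (q : ℝ) (s : Bool) (k : ℕ) : antisym q s k =
    ((permData k).map fun x => (x.1 : ℂ) • (x.2.map (sigmaAt q s k)).prod).sum := by
  rw [permData, Multiset.map_map]
  rfl

theorem permData_zero : permData 0 = {(1, [])} := by decide +kernel

theorem permData_one : permData 1 = {(1, [])} := by decide +kernel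

theorem permData_two : permData 2 = {(1, []), (-1, [0])} := by decide +kernel

theorem permData_three : permData 3 =
    {(1, []), (-1, [0]), (-1, [1]), (1, [1, 0]), (1, [0, 1]), (-1, [0, 1, 0])} := by
  decide +kernel

theorem permData_four : permData 4 =
    (permData 3 + (permData 3).map fun x => (-x.1, 2 :: x.2)) +
    ((permData 3).map (fun x => (x.1, 1 :: 2 :: x.2)) +
      (permData 3).map fun x => (-x.1, 0 :: 1 :: 2 :: x.2)) := by
  decide +kernel

theorem antisym_zero (q : ℝ) (s : Bool) : antisym q s 0 = 1 := by
  simp [antisym_eq, permData_zero]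

theorem antisym_one (q : ℝ) (s : Bool) : antisym q s 1 = 1 := by
  simp [antisym_eq, permData_one]

theorem antisym_two (q : ℝ) (s : Bool) : antisym q s 2 = altMatrix q s 2 [0] := by
  simp [antisym_eq, permData_two, altMatrix, sub_eq_add_neg]

theorem antisym_three (q : ℝ) (s : Bool) :
    antisym q s 3 = altMatrix q s 3 [1, 0] * altMatrix q s 3 [0] := by
  simp only [antisym_eq, permData_three, altMatrix, Multiset.insert_eq_cons, Multiset.map_cons,
    Multiset.sum_cons, Multiset.map_singleton, Multiset.sum_singleton, List.map_cons, List.map_nil,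
    List.prod_cons, List.prod_nil]
  simp only [Int.cast_neg, Int.cast_one, one_smul, neg_smul]
  noncomm_ring

theorem antisym_four (q : ℝ) (s : Bool) : antisym q s 4 =
    altMatrix q s 4 [2, 1, 0] * (altMatrix q s 4 [1, 0] * altMatrix q s 4 [0]) := by
  simp only [antisym_eq, permData_four, permData_three, altMatrix, Multiset.insert_eq_cons,
    Multiset.map_cons, Multiset.map_add, Multiset.sum_add, Multiset.sum_cons,
    Multiset.map_singleton, Multiset.sum_singleton, List.map_cons, List.map_nil, List.prod_cons,
    List.prod_nil]
  simp only [Int.cast_neg, Int.cast_one, one_smul, neg_smul]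
  noncomm_ring

theorem val_antisymComb {q : ℝ} (h0 : 0 < q) (s : Bool) {k : ℕ} (hk : k ≤ 4)
    {c : LinComb (List (Fin 4))} (hc : Homog k c) :
    val q k (antisymComb s k c) = act (antisym q s k) (val q k c) := by
  have h1 {k : ℕ} {l : List ℕ} (c : LinComb (List (Fin 4))) (hl : ∀ j ∈ l, j + 1 < k)
      (hc : Homog k c) := val_altComb h0 s hl hc
  interval_cases k
  · rw [antisym_zero, act_one]; rfl
  · rw [antisym_one, act_one]; rfl
  · rw [antisym_two]
    exact val_altComb h0 s (by decide) hc
  · rw [antisym_three, act_mul, ← val_altComb h0 s (by decide) hc]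
    exact val_altComb h0 s (by decide) (hc.altComb (by decide))
  · rw [antisym_four, act_mul, act_mul, ← val_altComb h0 s (by decide) hc,
      ← val_altComb h0 s (by decide) (hc.altComb (by decide))]
    exact val_altComb h0 s (by decide) ((hc.altComb (by decide)).altComb (by decide))

/-- In a ring with braid generators `x, y, z`, the alternating sum over the symmetric group of four
letters, with the last factors exchanged. -/
theorem braid_altSum {R : Type*} [Ring R] {x y z : R} (hb : x * (y * x) = y * (x * y))
    (hb' : y * (z * y) = z * (y * z)) (hc : z * x = x * z) :
    (1 - (1 - (1 - x) * y) * z) * ((1 - (1 - x) * y) * (1 - x)) =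
      (1 - x + y * x - z * (y * x)) * ((1 - y + z * y) * (1 - z)) := by
  have hcl (w) : z * (x * w) = x * (z * w) := by rw [← mul_assoc, hc, mul_assoc]
  have hbl (w) : y * (x * (y * w)) = x * (y * (x * w)) := by
    have := congrArg (· * w) hb
    simpa only [mul_assoc] using this.symm
  have hbl' (w) : z * (y * (z * w)) = y * (z * (y * w)) := by
    have := congrArg (· * w) hb'
    simpa only [mul_assoc] using this.symm
  have h3 : z * (y * (x * z)) = y * (z * (y * x)) := by rw [← hc, hbl']
  have h3l (w) : z * (y * (x * (z * w))) = y * (z * (y * (x * w))) := by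
    rw [← hcl, hbl']
  simp only [mul_add, mul_sub, add_mul, sub_mul, mul_one, one_mul, mul_assoc, hc, hcl, ← hb, hbl,
    ← hb', h3, h3l]
  abel

theorem braid_altSum_three {R : Type*} [Ring R] {x y : R} (hb : x * (y * x) = y * (x * y)) :
    (1 - (1 - x) * y) * (1 - x) = (1 - x + y * x) * (1 - y) := by
  simp only [mul_sub, add_mul, sub_mul, mul_one, one_mul, mul_assoc, hb]
  abel

/-- The antisymmetriser is right divisible by each `1 - σ_j`, so it vanishes on `ker (1 - σ_j)`. -/
theorem antisym_eq_mul {q : ℝ} (h0 : 0 < q) (s : Bool) {k j : ℕ} (hk : k ≤ 4) (hj : j + 1 < k) :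
    ∃ X, antisym q s k = X * (1 - sigmaAt q s k j) := by
  interval_cases k
  · omega
  · omega
  · obtain rfl : j = 0 := by omega
    exact ⟨1, by rw [antisym_two, altMatrix, altMatrix, one_mul, one_mul]⟩
  · have hb := sigmaAt_braid h0 s (k := 3) (j := 0) (by norm_num)
    obtain rfl | rfl : j = 0 ∨ j = 1 := by omega
    · exact ⟨altMatrix q s 3 [1, 0], by rw [antisym_three, altMatrix, altMatrix, altMatrix,
        one_mul]⟩
    · have h3 := antisym_three q s
      simp only [altMatrix, one_mul] at h3
      exact ⟨_, h3.trans (braid_altSum_three hb)⟩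
  · have hb := sigmaAt_braid h0 s (k := 4) (j := 0) (by norm_num)
    have hb' := sigmaAt_braid h0 s (k := 4) (j := 1) (by norm_num)
    have h4 := antisym_four q s
    simp only [altMatrix, one_mul] at h4
    obtain rfl | rfl | rfl : j = 0 ∨ j = 1 ∨ j = 2 := by omega
    · exact ⟨_, h4.trans (mul_assoc _ _ _).symm⟩
    · rw [braid_altSum_three hb] at h4
      exact ⟨_, h4.trans (mul_assoc _ _ _).symm⟩
    · rw [braid_altSum hb hb' (sigmaAt_comm q s)] at h4
      exact ⟨_, h4.trans (mul_assoc _ _ _).symm⟩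

/-! ### The exterior algebra in coordinates -/

/-- The number of increasing words of length `k` in the four letters. -/
abbrev dim : ℕ → ℕ
  | 0 => 1
  | 1 => 4
  | 2 => 6
  | 3 => 4
  | 4 => 1
  | _ => 0

/-- The increasing words of length `k`. -/
def basisWord : (k : ℕ) → Fin (dim k) → List (Fin 4)
  | 0, _ => []
  | 1, i => [i]
  | 2, i => ![[0, 1], [0, 2], [0, 3], [1, 2], [1, 3], [2, 3]] i
  | 3, i => ![[0, 1, 2], [0, 1, 3], [0, 2, 3], [1, 2, 3]] i
  | 4, _ => [0, 1, 2, 3]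
  | _ + 5, i => i.elim0

/-- The coordinate space of the left-invariant `k`-forms, `k ≤ 4`, for the basis of the products
`ω_{i_1} ∧ ... ∧ ω_{i_k}` with `i_1 < ... < i_k`. -/
abbrev Lam (k : ℕ) : Type := Fin (dim k) → ℂ

/-- The relations `ω_x ∧ ω_y = ...`, `x ≥ y`, which span the kernel of `1 - σ^{±}`. -/
def straightenPair : Fin 4 → Fin 4 → Option (LinComb (Fin 4 × Fin 4))
  | 0, 0 => some []
  | 1, 1 => some []
  | 2, 2 => some []
  | 1, 0 => some [((0, 1), 0, -1)]
  | 2, 0 => some [((0, 2), 0, -1)]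
  | 2, 1 => some [((1, 2), 0, -1)]
  | 3, 0 => some [((0, 3), -1, -1)]
  | 3, 1 => some [((1, 3), 1, -1)]
  | 3, 2 => some [((0, 1), -1, 1), ((0, 1), 0, -2), ((0, 1), 1, 1), ((2, 3), 0, -1)]
  | 3, 3 => some [((0, 1), -1, 1), ((0, 1), 1, -1)]
  | _, _ => none

/-- One application of a relation, at the first place where the word does not increase. -/
def straightenOnce : List (Fin 4) → Option (LinComb (List (Fin 4)))
  | x :: y :: w =>
    match straightenPair x y with
    | some c => some (c.map fun z => (z.1.1 :: z.1.2 :: w, z.2))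
    | none => (straightenOnce (y :: w)).map fun c => c.map fun z => (x :: z.1, z.2)
  | _ => none

/-- The word with at most `n` rounds of relations applied to it. -/
def straighten : ℕ → List (Fin 4) → LinComb (List (Fin 4))
  | 0, w => [(w, 0, 1)]
  | n + 1, w =>
    match straightenOnce w with
    | some c => (c.bind (straighten n)).collect
    | none => [(w, 0, 1)]

/-- The normal form of a word of length at most `4` as a combination of increasing words. -/
abbrev normalForm (w : List (Fin 4)) : LinComb (List (Fin 4)) := straighten 9 w

/-- Nine rounds of relations suffice: every word of length at most `4` is brought to increasing
words. -/
theorem normalForm_mem {k : ℕ} (hk : k ≤ 4) : ∀ l : Fin k → Fin 4,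
    ∀ y ∈ normalForm (List.ofFn l), ∃ i, y.1 = basisWord k i := by
  interval_cases k <;> decide +kernel

/-- The conjugation of words is compatible with the relations. -/
theorem normalForm_starWord {k : ℕ} (hk : k ≤ 4) : ∀ l : Fin k → Fin 4,
    ((normalForm ((List.ofFn l).reverse.map bar)).sub
      ((normalForm (List.ofFn l)).bind fun w => normalForm (w.reverse.map bar))).collect = [] := by
  interval_cases k <;> decide +kernel

/-- The coordinates of a formal sum of increasing words of length `k`. -/
noncomputable abbrev lam (q : ℝ) (k : ℕ) (c : LinComb (List (Fin 4))) : Lam k :=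
  eval ((q : ℂ) ^ 2) (fun w i => if w = basisWord k i then (1 : ℂ) else 0) c

/-- The tensor with the given coordinates at the increasing words. -/
noncomputable def incl (k : ℕ) : Lam k →ₗ[ℂ] Tens ℂ k :=
  Fintype.linearCombination ℂ fun i => wordT k (basisWord k i)

/-- The coordinates of the class of a tensor modulo the kernel of the antisymmetriser. -/
noncomputable def coords (q : ℝ) (k : ℕ) : Tens ℂ k →ₗ[ℂ] Lam k :=
  Fintype.linearCombination ℂ fun b => lam q k (normalForm (List.ofFn b))

theorem incl_apply {k : ℕ} (x : Lam k) : incl k x = ∑ i, x i • wordT k (basisWord k i) := rfl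

theorem wordT_ofFn {k : ℕ} (b : Fin k → Fin 4) : wordT k (List.ofFn b) = Pi.single b 1 := by
  rw [wordT]
  congr 1
  funext i
  simp [List.getD]

theorem exists_ofFn {k : ℕ} {l : List (Fin 4)} (hl : l.length = k) :
    ∃ b : Fin k → Fin 4, l = List.ofFn b := by
  subst hl
  exact ⟨l.get, (List.ofFn_get l).symm⟩

theorem coords_wordT (q : ℝ) {k : ℕ} {l : List (Fin 4)} (hl : l.length = k) :
    coords q k (wordT k l) = lam q k (normalForm l) := by
  obtain ⟨b, rfl⟩ := exists_ofFn hl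
  rw [wordT_ofFn, coords, Fintype.linearCombination_apply_single, one_smul]

theorem coords_val {q : ℝ} (h0 : 0 < q) {k : ℕ} {c : LinComb (List (Fin 4))} (hc : Homog k c) :
    coords q k (val q k c) = lam q k (c.bind normalForm) := by
  have ht : (q : ℂ) ^ 2 ≠ 0 := pow_ne_zero _ (by exact_mod_cast h0.ne')
  rw [lam, eval_bind ht, val, map_eval]
  exact eval_congr _ fun x hx => coords_wordT q (hc x hx)

theorem basisWord_length {k : ℕ} (i : Fin (dim k)) : (basisWord k i).length = k := by
  match k, i with
  | 0, _ => rfl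
  | 1, _ => rfl
  | 2, i => revert i; decide
  | 3, i => revert i; decide
  | 4, _ => rfl
  | k + 5, i => exact i.elim0

theorem basisWord_injective (k : ℕ) : Function.Injective (basisWord k) := by
  match k with
  | 0 => decide
  | 1 => decide
  | 2 => decide
  | 3 => decide
  | 4 => decide
  | k + 5 => exact fun i => i.elim0

theorem incl_lam (q : ℝ) {k : ℕ} {c : LinComb (List (Fin 4))}
    (hc : ∀ y ∈ c, ∃ i, y.1 = basisWord k i) : incl k (lam q k c) = val q k c := by
  rw [lam, map_eval]
  refine eval_congr _ fun x hx => ?_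
  obtain ⟨i, hi⟩ := hc x hx
  rw [incl_apply, hi, Finset.sum_eq_single i]
  · simp
  · intro j _ hj
    rw [if_neg fun h => hj (basisWord_injective k h).symm, zero_smul]
  · simp

theorem normalForm_basisWord {k : ℕ} (hk : k ≤ 4) :
    ∀ i : Fin (dim k), normalForm (basisWord k i) = [(basisWord k i, 0, 1)] := by
  interval_cases k <;> decide +kernel

theorem coords_incl (q : ℝ) {k : ℕ} (hk : k ≤ 4) (x : Lam k) : coords q k (incl k x) = x := by
  rw [incl_apply, map_sum]
  funext j
  rw [Finset.sum_apply, Finset.sum_eq_single j]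
  · rw [map_smul, coords_wordT q (basisWord_length j), normalForm_basisWord hk]
    simp [lam]
  · intro i _ hi
    rw [map_smul, coords_wordT q (basisWord_length i), normalForm_basisWord hk]
    simp [lam, (basisWord_injective k).eq_iff, hi]
  · simp

/-- The relation for `ω_x ∧ ω_y` holds modulo the kernel of `1 - σ^{±}`. -/
theorem straightenPair_comb (s : Bool) : ∀ x y : Fin 4, ∀ d ∈ straightenPair x y,
    ((sub [([x, y], 0, 1)] (d.map fun z => ([z.1.1, z.1.2], z.2))).sub
      (sigmaComb s 0 (sub [([x, y], 0, 1)] (d.map fun z => ([z.1.1, z.1.2], z.2))))).collect =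
      [] := by
  cases s <;> decide +kernel

theorem straightenOnce_eq {w : List (Fin 4)} {c : LinComb (List (Fin 4))}
    (h : straightenOnce w = some c) : ∃ u x y v, w = u ++ x :: y :: v ∧
      ∃ d ∈ straightenPair x y, c = d.map fun z => (u ++ z.1.1 :: z.1.2 :: v, z.2) := by
  match w with
  | [] => simp [straightenOnce] at h
  | [_] => simp [straightenOnce] at h
  | x :: y :: w =>
    rw [straightenOnce] at h
    rcases hp : straightenPair x y with _ | d
    · rw [hp] at h
      obtain ⟨c', hc', rfl⟩ := Option.map_eq_some_iff.1 h
      obtain ⟨u, x', y', v, hw, d, hd, rfl⟩ := straightenOnce_eq hc'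
      exact ⟨x :: u, x', y', v, by simp [hw], d, hd, by simp⟩
    · rw [hp] at h
      exact ⟨[], x, y, w, rfl, d, by simp [hp], by simpa using h.symm⟩

theorem Homog.straightenOnce {k : ℕ} {w : List (Fin 4)} (hw : w.length = k)
    {c : LinComb (List (Fin 4))} (h : straightenOnce w = some c) : Homog k c := by
  obtain ⟨u, x, y, v, rfl, d, -, rfl⟩ := straightenOnce_eq h
  intro z hz
  obtain ⟨z', -, rfl⟩ := List.mem_map.1 hz
  simpa using hw

/-- The antisymmetriser does not distinguish the two sides of a relation, since it is right
divisible by `1 - σ_j`. -/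
theorem antisym_straightenOnce {q : ℝ} (h0 : 0 < q) (s : Bool) {k : ℕ} (hk : k ≤ 4)
    {w : List (Fin 4)} (hw : w.length = k) {c : LinComb (List (Fin 4))}
    (h : straightenOnce w = some c) :
    act (antisym q s k) (wordT k w) = act (antisym q s k) (val q k c) := by
  have ht : (q : ℂ) ^ 2 ≠ 0 := pow_ne_zero _ (by exact_mod_cast h0.ne')
  obtain ⟨u, x, y, v, rfl, d, hd, rfl⟩ := straightenOnce_eq h
  have hk' : u.length + 2 + v.length = k := by
    simp only [List.length_append, List.length_cons] at hw
    omega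
  obtain ⟨X, hX⟩ := antisym_eq_mul h0 s (k := k) (j := u.length) hk (by omega)
  set c' : LinComb (List (Fin 4)) := sub [([x, y], 0, 1)] (d.map fun z => ([z.1.1, z.1.2], z.2))
    with hc'
  have hH : Homog 2 c' := by
    refine (homog_single rfl _ _).append (Homog.scale ?_ _ _)
    intro z hz
    obtain ⟨z', -, rfl⟩ := List.mem_map.1 hz
    rfl
  have h2 : wordT k (u ++ x :: y :: v) -
      val q k (d.map fun z => (u ++ z.1.1 :: z.1.2 :: v, z.2)) =
        eval ((q : ℂ) ^ 2) (fun z => wordT k (u ++ z ++ v)) c' := by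
    rw [hc', eval_sub ht, val, eval_map _ _ fun z : Fin 4 × Fin 4 => u ++ z.1 :: z.2 :: v,
      eval_map _ _ fun z : Fin 4 × Fin 4 => [z.1, z.2]]
    simp
  have h3 := act_sigmaAt_eval h0 (j := 0) (by norm_num) s u v hk' rfl hH
  rw [← sub_eq_zero, ← map_sub, h2, hX, act_mul, act_sub, act_one]
  rw [add_zero] at h3
  rw [h3, eval_eq_of_collect_sub ht _ (straightenPair_comb s x y d hd), sub_self, map_zero]

theorem antisym_straighten {q : ℝ} (h0 : 0 < q) (s : Bool) {k : ℕ} (hk : k ≤ 4) (n : ℕ)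
    {w : List (Fin 4)} (hw : w.length = k) :
    act (antisym q s k) (wordT k w) = act (antisym q s k) (val q k (straighten n w)) := by
  have ht : (q : ℂ) ^ 2 ≠ 0 := pow_ne_zero _ (by exact_mod_cast h0.ne')
  induction n generalizing w with
  | zero => simp [straighten]
  | succ n ih =>
    rw [straighten]
    rcases hc : straightenOnce w with _ | c
    · simp
    · rw [antisym_straightenOnce h0 s hk hw hc]
      simp only [val, eval_collect, eval_bind ht, map_eval]
      exact eval_congr _ fun x hx => by rw [ih (Homog.straightenOnce hw hc x hx), val, map_eval]

/-- The antisymmetriser factors through the coordinates. -/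
theorem antisym_incl_coords {q : ℝ} (h0 : 0 < q) (s : Bool) {k : ℕ} (hk : k ≤ 4) (t : Tens ℂ k) :
    act (antisym q s k) (incl k (coords q k t)) = act (antisym q s k) t := by
  conv_rhs => rw [sum_smul_wordT t]
  rw [coords, Fintype.linearCombination_apply, map_sum, map_sum, map_sum]
  refine Finset.sum_congr rfl fun b _ => ?_
  rw [map_smul, map_smul, map_smul, incl_lam q (normalForm_mem hk b),
    ← antisym_straighten h0 s hk 9 (by simp)]

/-! ### The conjugation -/

theorem tensStar_add {k : ℕ} (t u : Tens ℂ k) : tensStar (t + u) = tensStar t + tensStar u := by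
  funext b
  simp [tensStar, mul_add]

theorem tensStar_smul {k : ℕ} (r : ℂ) (t : Tens ℂ k) :
    tensStar (r • t) = starRingEnd ℂ r • tensStar t := by
  funext b
  simp only [tensStar, Pi.smul_apply, smul_eq_mul, map_mul]
  ring

theorem bar_bar (i : Fin 4) : bar (bar i) = i := by
  revert i; decide

theorem tensStar_tensStar {k : ℕ} (t : Tens ℂ k) : tensStar (tensStar t) = t := by
  funext b
  simp only [tensStar, bar_bar, Fin.rev_rev, map_mul, map_pow, map_neg, map_one,
    RingHomCompTriple.comp_apply, RingHom.id_apply]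
  rw [← mul_assoc, ← mul_pow]
  norm_num

/-- The conjugation as a semilinear map. -/
noncomputable def tensStarₗ (k : ℕ) : Tens ℂ k →ₛₗ[starRingEnd ℂ] Tens ℂ k where
  toFun := tensStar
  map_add' := tensStar_add
  map_smul' := tensStar_smul

theorem tensStar_wordT {k : ℕ} (l : Fin k → Fin 4) : tensStar (wordT k (List.ofFn l)) =
    (-1 : ℂ) ^ (k * (k - 1) / 2 + k) • wordT k ((List.ofFn l).reverse.map bar) := by
  have h : (List.ofFn l).reverse.map bar = List.ofFn fun i => bar (l i.rev) := by
    refine List.ext_getElem (by simp) fun i h₁ h₂ => ?_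
    simp only [List.getElem_map, List.getElem_reverse, List.getElem_ofFn, List.length_ofFn]
    congr 3
    change k - 1 - i = k - (i + 1)
    omega
  funext b
  rw [h, wordT_ofFn, wordT_ofFn]
  simp only [tensStar, Pi.smul_apply, smul_eq_mul, Pi.single_apply]
  have : ((fun i : Fin k => bar (b i.rev)) = l) ↔ (b = fun i => bar (l i.rev)) := by
    constructor
    · rintro rfl
      funext i
      simp [bar_bar]
    · rintro rfl
      funext i
      simp [bar_bar]
  simp only [this]
  split_ifs <;> simp

theorem map_eval_conj {E F : Type} [AddCommGroup E] [Module ℂ E] [AddCommGroup F] [Module ℂ F]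
    {α : Type} (q : ℝ) (g : E →ₛₗ[starRingEnd ℂ] F) (f : α → E) (l : LinComb α) :
    g (eval ((q : ℂ) ^ 2) f l) = eval ((q : ℂ) ^ 2) (fun x => g (f x)) l := by
  induction l with
  | nil => simp
  | cons x l ih => simp [ih]

theorem LinComb.smul_eval {E : Type} [AddCommGroup E] [Module ℂ E] {α : Type} (t r : ℂ)
    (f : α → E) (l : LinComb α) : r • eval t f l = eval t (fun x => r • f x) l :=
  map_eval t (r • LinearMap.id) f l

/-- The conjugation of left-invariant forms in coordinates. -/
noncomputable def lamStar (q : ℝ) (k : ℕ) : Lam k →ₛₗ[starRingEnd ℂ] Lam k :=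
  ((coords q k).comp (tensStarₗ k)).comp (incl k)

theorem lamStar_apply (q : ℝ) {k : ℕ} (x : Lam k) :
    lamStar q k x = coords q k (tensStar (incl k x)) := rfl

theorem coords_tensStar_wordT (q : ℝ) {k : ℕ} {l : List (Fin 4)} (hl : l.length = k) :
    coords q k (tensStar (wordT k l)) =
      (-1 : ℂ) ^ (k * (k - 1) / 2 + k) • lam q k (normalForm (l.reverse.map bar)) := by
  obtain ⟨b, rfl⟩ := exists_ofFn hl
  rw [tensStar_wordT, map_smul, coords_wordT]
  simp

/-- The conjugation preserves the kernel of the antisymmetriser. -/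
theorem coords_tensStar {q : ℝ} (h0 : 0 < q) {k : ℕ} (hk : k ≤ 4) (t : Tens ℂ k) :
    coords q k (tensStar t) = lamStar q k (coords q k t) := by
  have ht : (q : ℂ) ^ 2 ≠ 0 := pow_ne_zero _ (by exact_mod_cast h0.ne')
  change ((coords q k).comp (tensStarₗ k)) t = _
  conv_lhs => rw [sum_smul_wordT t]
  rw [show coords q k t = ∑ b, t b • lam q k (normalForm (List.ofFn b)) from rfl, map_sum, map_sum]
  refine Finset.sum_congr rfl fun b _ => ?_
  rw [map_smulₛₗ, map_smulₛₗ]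
  congr 1
  rw [lamStar_apply, incl_lam q (normalForm_mem hk b)]
  change coords q k (tensStar (wordT k (List.ofFn b))) =
    ((coords q k).comp (tensStarₗ k)) (val q k (normalForm (List.ofFn b)))
  rw [coords_tensStar_wordT q (by simp), val, map_eval_conj, lam,
    eval_eq_of_collect_sub ht _ (normalForm_starWord hk b), eval_bind ht]
  rw [smul_eval]
  refine eval_congr _ fun x hx => ?_
  obtain ⟨i, hi⟩ := normalForm_mem hk b x hx
  exact (coords_tensStar_wordT q (hi ▸ basisWord_length i)).symm

theorem lamStar_lamStar {q : ℝ} (h0 : 0 < q) {k : ℕ} (hk : k ≤ 4) (x : Lam k) :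
    lamStar q k (lamStar q k x) = x := by
  rw [lamStar_apply q x, ← coords_tensStar h0 hk, tensStar_tensStar, coords_incl q hk]

theorem lamStar_eq_sum (q : ℝ) {k : ℕ} (x : Lam k) (j : Fin (dim k)) :
    lamStar q k x j = ∑ i, starRingEnd ℂ (x i) * ((-1) ^ (k * (k - 1) / 2 + k) *
      lam q k (normalForm ((basisWord k i).reverse.map bar)) j) := by
  have : x = ∑ i, x i • Pi.single i (1 : ℂ) := by
    funext j
    simp [Finset.sum_apply, Pi.single_apply]
  conv_lhs => rw [this]
  rw [map_sum, Finset.sum_apply]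
  refine Finset.sum_congr rfl fun i _ => ?_
  rw [map_smulₛₗ, Pi.smul_apply, smul_eq_mul, lamStar_apply, incl, 
    Fintype.linearCombination_apply_single, one_smul, coords_tensStar_wordT q (basisWord_length i)]
  rfl

/-- The antisymmetriser on left-invariant forms, in coordinates. -/
noncomputable def opM (q : ℝ) (s : Bool) (k : ℕ) : Lam k →ₗ[ℂ] Lam k :=
  (coords q k).comp ((act (antisym q s k)).comp (incl k))

theorem opM_apply (q : ℝ) (s : Bool) {k : ℕ} (x : Lam k) :
    opM q s k x = coords q k (act (antisym q s k) (incl k x)) := rfl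

theorem antisym_basisWord {q : ℝ} (h0 : 0 < q) (s : Bool) {k : ℕ} (hk : k ≤ 4) (i : Fin (dim k)) :
    act (antisym q s k) (wordT k (basisWord k i)) =
      val q k (antisymComb s k [(basisWord k i, 0, 1)]) := by
  rw [val_antisymComb h0 s hk (homog_single (basisWord_length i) _ _)]
  simp

theorem homog_antisymComb (s : Bool) {k : ℕ} (hk : k ≤ 4) {c : LinComb (List (Fin 4))}
    (hc : Homog k c) : Homog k (antisymComb s k c) := by
  interval_cases k
  · exact hc
  · exact hc
  · exact hc.altComb (by decide)
  · exact (hc.altComb (by decide)).altComb (by decide)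
  · exact ((hc.altComb (by decide)).altComb (by decide)).altComb (by decide)

theorem opM_eq_sum {q : ℝ} (h0 : 0 < q) (s : Bool) {k : ℕ} (hk : k ≤ 4) (x : Lam k)
    (j : Fin (dim k)) : opM q s k x j = ∑ i, x i *
      lam q k (((antisymComb s k [(basisWord k i, 0, 1)]).bind normalForm).collect) j := by
  rw [opM_apply, incl_apply, map_sum, map_sum, Finset.sum_apply]
  refine Finset.sum_congr rfl fun i _ => ?_
  rw [map_smul, map_smul, antisym_basisWord h0 s hk, coords_val h0
    (homog_antisymComb s hk (homog_single (basisWord_length i) _ _)), lam, lam, eval_collect]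
  rfl

/-! ### The spectrum of the antisymmetrisers -/

theorem sum_dim_zero {E : Type} [AddCommMonoid E] (f : Fin (dim 0) → E) :
    ∑ i, f i = f (0 : Fin 1) :=
  Fin.sum_univ_one f

theorem sum_dim_one {E : Type} [AddCommMonoid E] (f : Fin (dim 1) → E) :
    ∑ i, f i = f (0 : Fin 4) + f (1 : Fin 4) + f (2 : Fin 4) + f (3 : Fin 4) :=
  Fin.sum_univ_four f

theorem sum_dim_two {E : Type} [AddCommMonoid E] (f : Fin (dim 2) → E) :
    ∑ i, f i = f (0 : Fin 6) + f (1 : Fin 6) + f (2 : Fin 6) + f (3 : Fin 6) + f (4 : Fin 6) +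
      f (5 : Fin 6) :=
  Fin.sum_univ_six f

theorem sum_dim_three {E : Type} [AddCommMonoid E] (f : Fin (dim 3) → E) :
    ∑ i, f i = f (0 : Fin 4) + f (1 : Fin 4) + f (2 : Fin 4) + f (3 : Fin 4) :=
  Fin.sum_univ_four f

theorem sum_dim_four {E : Type} [AddCommMonoid E] (f : Fin (dim 4) → E) :
    ∑ i, f i = f (0 : Fin 1) :=
  Fin.sum_univ_one f

/-- The columns of the matrix of `A^{(2)}_+` for the basis of the increasing words. -/
theorem opM_two_true_table : ∀ i,
    (((antisymComb true 2 [(basisWord 2 i, 0, 1)]).bind normalForm).collect) =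
    ![[([0, 1], -1, 1), ([0, 1], 1, 1), ([2, 3], 0, -1)], [([0, 2], 0, 1), ([0, 2], 1, 1)],
      [([0, 3], 0, 1), ([0, 3], -1, 1), ([0, 2], 1, -1), ([0, 2], 0, -1)],
      [([1, 2], 0, 1), ([1, 2], -1, 1)],
      [([1, 3], 0, 1), ([1, 3], 1, 1), ([1, 2], -1, 1), ([1, 2], 0, 1)],
      [([2, 3], 0, 2), ([0, 1], -1, -1), ([0, 1], 0, 2), ([0, 1], 1, -1)]] i := by
  decide +kernel

/-- The columns of the matrix of `A^{(2)}_-` for the basis of the increasing words. -/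
theorem opM_two_false_table : ∀ i,
    (((antisymComb false 2 [(basisWord 2 i, 0, 1)]).bind normalForm).collect) =
    ![[([0, 1], 0, 2), ([2, 3], 0, 1)], [([0, 2], 0, 1), ([0, 2], -1, 1)],
      [([0, 3], 0, 1), ([0, 3], 1, 1), ([0, 2], 1, 1), ([0, 2], 0, 1)],
      [([1, 2], 0, 1), ([1, 2], 1, 1)],
      [([1, 3], 0, 1), ([1, 3], -1, 1), ([1, 2], -1, -1), ([1, 2], 0, -1)],
      [([0, 1], -1, 1), ([0, 1], 0, -2), ([0, 1], 1, 1), ([2, 3], -1, 1), ([2, 3], 1, 1)]] i := by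
  decide +kernel

theorem opM_true_two {q : ℝ} (h0 : 0 < q) (x : Lam 2) {t : ℂ} (ht : (q : ℂ) ^ 2 = t) :
    opM q true 2 x = ![(t + t⁻¹) * x 0 + (2 - t - t⁻¹) * x 5, (1 + t) * x 1 - (1 + t) * x 2,
      (1 + t⁻¹) * x 2, (1 + t⁻¹) * x 3 + (1 + t⁻¹) * x 4, (1 + t) * x 4, 2 * x 5 - x 0] := by
  funext j
  rw [opM_eq_sum h0 true (by norm_num)]
  simp only [opM_two_true_table, lam, ht]
  fin_cases j <;>
    simp [sum_dim_two, basisWord, -Int.reduceNeg] <;> ring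

theorem opM_false_two {q : ℝ} (h0 : 0 < q) (x : Lam 2) {t : ℂ} (ht : (q : ℂ) ^ 2 = t) :
    opM q false 2 x = ![2 * x 0 + (t + t⁻¹ - 2) * x 5, (1 + t⁻¹) * x 1 + (1 + t) * x 2,
      (1 + t) * x 2, (1 + t) * x 3 - (1 + t⁻¹) * x 4, (1 + t⁻¹) * x 4,
      x 0 + (t + t⁻¹) * x 5] := by
  funext j
  rw [opM_eq_sum h0 false (by norm_num)]
  simp only [opM_two_false_table, lam, ht]
  fin_cases j <;>
    simp [sum_dim_two, basisWord, -Int.reduceNeg] <;> ring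

/-- The conjugates of the increasing words of length `2`, up to the sign. -/
theorem lamStar_two_table : ∀ i, normalForm ((basisWord 2 i).reverse.map bar) =
    ![[([0, 1], 0, 1)], [([1, 2], 0, -1)], [([1, 3], 1, -1)], [([0, 2], 0, -1)],
      [([0, 3], -1, -1)], [([2, 3], 0, -1), ([0, 1], 1, 1), ([0, 1], 0, -2), ([0, 1], -1, 1)]]
      i := by
  decide +kernel

theorem lamStar_three_table : ∀ i, normalForm ((basisWord 3 i).reverse.map bar) =
    ![[([0, 1, 2], 0, 1)], [([0, 1, 3], 0, 1)], [([1, 2, 3], 1, -1)], [([0, 2, 3], -1, -1)]] i := by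
  decide +kernel

theorem lamStar_zero (q : ℝ) (x : Lam 0) : lamStar q 0 x = ![starRingEnd ℂ (x 0)] := by
  funext j
  have h : normalForm [] = [([], 0, 1)] := by decide +kernel
  fin_cases j
  simp [lamStar_eq_sum, sum_dim_zero, basisWord, lam, h]

theorem lamStar_one (q : ℝ) (x : Lam 1) : lamStar q 1 x = ![-starRingEnd ℂ (x 1),
    -starRingEnd ℂ (x 0), -starRingEnd ℂ (x 2), -starRingEnd ℂ (x 3)] := by
  have h (a : Fin 4) : normalForm [a] = [([a], 0, 1)] := by revert a; decide +kernel
  funext j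
  rw [lamStar_eq_sum]
  fin_cases j <;> simp [sum_dim_one, basisWord, lam, h, bar] <;> simp [Fin.ext_iff]

theorem lamStar_two (q : ℝ) (x : Lam 2) {t : ℂ} (ht : (q : ℂ) ^ 2 = t) :
    lamStar q 2 x = ![-starRingEnd ℂ (x 0) + (2 - t - t⁻¹) * starRingEnd ℂ (x 5),
      starRingEnd ℂ (x 3), t⁻¹ * starRingEnd ℂ (x 4), starRingEnd ℂ (x 1),
      t * starRingEnd ℂ (x 2), starRingEnd ℂ (x 5)] := by
  funext j
  rw [lamStar_eq_sum]
  simp only [lamStar_two_table, lam, ht]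
  fin_cases j <;>
    simp [sum_dim_two, basisWord, -Int.reduceNeg] <;> ring

theorem lamStar_three (q : ℝ) (x : Lam 3) {t : ℂ} (ht : (q : ℂ) ^ 2 = t) :
    lamStar q 3 x = ![starRingEnd ℂ (x 0), starRingEnd ℂ (x 1), -t⁻¹ * starRingEnd ℂ (x 3),
      -t * starRingEnd ℂ (x 2)] := by
  funext j
  rw [lamStar_eq_sum]
  simp only [lamStar_three_table, lam, ht]
  fin_cases j <;>
    simp [sum_dim_three, basisWord, -Int.reduceNeg] <;> ring

theorem lamStar_four (q : ℝ) (x : Lam 4) : lamStar q 4 x = ![-starRingEnd ℂ (x 0)] := by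
  funext j
  have h : normalForm [3, 2, 0, 1] = [([0, 1, 2, 3], 0, -1)] := by decide +kernel
  fin_cases j
  simp [lamStar_eq_sum, sum_dim_four, basisWord, lam, h, bar, Even.neg_pow (by decide : Even 10)]

/-- The eigenvalue of the antisymmetriser on the left-invariant `k`-forms, `k ≠ 2`, as a list of
exponents and coefficients of powers of `q²`. -/
def eigenPoly : ℕ → List (ℤ × ℤ)
  | 3 => [(-1, 2), (0, 2), (1, 2)]
  | 4 => [(-2, 2), (-1, 6), (0, 8), (1, 6), (2, 2)]
  | _ => [(0, 1)]

theorem opM_scalar_table (s : Bool) {k : ℕ} (hk : k ≤ 4) (hk' : k ≠ 2) : ∀ i : Fin (dim k),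
    (sub (((antisymComb s k [(basisWord k i, 0, 1)]).bind normalForm).collect)
      ((eigenPoly k).map fun z => (basisWord k i, z))).collect = [] := by
  revert s
  interval_cases k
  · decide +kernel
  · decide +kernel
  · exact absurd rfl hk'
  · decide +kernel
  · decide +kernel

/-- Away from the middle degree the antisymmetriser is a real multiple of the identity, the same
one for both signs. -/
theorem exists_opM_eq_smul {q : ℝ} (h0 : 0 < q) {k : ℕ} (hk : k ≤ 4) (hk' : k ≠ 2) :
    ∃ l : ℝ, l ≠ 0 ∧ ∀ s (x : Lam k), opM q s k x = (l : ℂ) • x := by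
  have ht : (q : ℂ) ^ 2 ≠ 0 := pow_ne_zero _ (by exact_mod_cast h0.ne')
  set P := eigenPoly k with hP
  have key (s : Bool) (x : Lam k) :
      opM q s k x = (P.map fun z => (z.2 : ℂ) * ((q : ℂ) ^ 2) ^ z.1).sum • x := by
    funext j
    rw [opM_eq_sum h0 s hk]
    have h (i : Fin (dim k)) :
        lam q k (((antisymComb s k [(basisWord k i, 0, 1)]).bind normalForm).collect) =
          (P.map fun z => (z.2 : ℂ) * ((q : ℂ) ^ 2) ^ z.1).sum • Pi.single i 1 := by
      rw [lam, eval_eq_of_collect_sub ht _ (opM_scalar_table s hk hk' i), ← hP]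
      have hs : (fun i' : Fin (dim k) => if basisWord k i = basisWord k i' then (1 : ℂ) else 0) =
          Pi.single i 1 := by
        funext i'
        simp [Pi.single_apply, (basisWord_injective k).eq_iff, eq_comm]
      generalize P = P
      induction P with
      | nil => simp
      | cons z P ih => simp [ih, add_smul, hs]
    simp [h, Pi.single_apply, mul_comm]
  refine ⟨(P.map fun z => (z.2 : ℝ) * (q ^ 2) ^ z.1).sum, ?_, fun s x => ?_⟩
  · have hq : 0 < q ^ 2 := by positivity
    interval_cases k
    · simp [hP, eigenPoly]
    · simp [hP, eigenPoly]
    · exact absurd rfl hk'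
    · simp only [hP, eigenPoly, List.map_cons, List.map_nil, List.sum_cons, List.sum_nil]
      positivity
    · simp only [hP, eigenPoly, List.map_cons, List.map_nil, List.sum_cons, List.sum_nil]
      positivity
  · rw [key]
    congr 1
    generalize P = P
    induction P with
    | nil => simp
    | cons z P ih => simp [ih]

/-! ### Left-invariant forms in coordinates -/

theorem sq_ne_zero {q : ℝ} (h0 : 0 < q) : (q : ℂ) ^ 2 ≠ 0 :=
  pow_ne_zero _ (by exact_mod_cast h0.ne')

theorem one_add_sq_ne_zero (q : ℝ) : 1 + (q : ℂ) ^ 2 ≠ 0 := by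
  have : (1 + q ^ 2 : ℝ) ≠ 0 := by positivity
  exact_mod_cast this

theorem one_add_inv_sq_ne_zero {q : ℝ} (h0 : 0 < q) : 1 + ((q : ℂ) ^ 2)⁻¹ ≠ 0 := by
  have : (1 + (q ^ 2)⁻¹ : ℝ) ≠ 0 := by positivity
  exact_mod_cast this

theorem one_add_mul_one_add_inv {t : ℂ} (ht : t ≠ 0) :
    (1 + t) * (1 + t⁻¹) = (1 + t) + (1 + t⁻¹) := by
  field_simp
  ring

/-- In degree `2` the sum and the product of `A_+` and `A_-` are the same scalar
`(1 + q²) (1 + q⁻²)`. -/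
theorem opM_two_add {q : ℝ} (h0 : 0 < q) (s : Bool) (x : Lam 2) : opM q (!s) 2 x =
    ((1 + (q : ℂ) ^ 2) * (1 + ((q : ℂ) ^ 2)⁻¹)) • x - opM q s 2 x := by
  have ht := sq_ne_zero h0
  generalize hτ : (q : ℂ) ^ 2 = t at *
  cases s <;> simp only [Bool.not_true, Bool.not_false, opM_true_two h0 x hτ,
    opM_false_two h0 x hτ] <;> funext j <;> fin_cases j <;> simp <;> field_simp <;> ring

theorem opM_two_mul {q : ℝ} (h0 : 0 < q) (s : Bool) (x : Lam 2) : opM q s 2 (opM q (!s) 2 x) =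
    ((1 + (q : ℂ) ^ 2) * (1 + ((q : ℂ) ^ 2)⁻¹)) • x := by
  have ht := sq_ne_zero h0
  generalize hτ : (q : ℂ) ^ 2 = t at *
  cases s <;> simp only [Bool.not_true, Bool.not_false, opM_true_two h0 _ hτ,
    opM_false_two h0 _ hτ] <;> funext j <;> fin_cases j <;> simp <;> field_simp <;> ring

/-- In degree `2` the conjugation exchanges the antisymmetrisers for the two signs. -/
theorem lamStar_opM_two {q : ℝ} (h0 : 0 < q) (s : Bool) (x : Lam 2) :
    lamStar q 2 (opM q s 2 x) = opM q (!s) 2 (lamStar q 2 x) := by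
  have ht := sq_ne_zero h0
  have hc : starRingEnd ℂ ((q : ℂ) ^ 2) = (q : ℂ) ^ 2 := by simp
  have h2 : starRingEnd ℂ 2 = 2 := map_ofNat _ 2
  generalize hτ : (q : ℂ) ^ 2 = t at *
  cases s <;> simp only [Bool.not_true, Bool.not_false, opM_true_two h0 _ hτ,
    opM_false_two h0 _ hτ, lamStar_two q _ hτ] <;> funext j <;> fin_cases j <;>
    simp [hc, h2] <;> field_simp <;> ring

/-- The inverse of the antisymmetriser times the one for the other sign: `M_{-s} - 1 = M_s⁻¹ M_{-s}`
in degree `2`, the identity otherwise.  It is the factor `λ_{ξ*} / λ_ξ` on an eigenform `ξ`. -/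
noncomputable def opN (q : ℝ) (s : Bool) (k : ℕ) : Lam k →ₗ[ℂ] Lam k :=
  if k = 2 then opM q (!s) k - LinearMap.id else LinearMap.id

theorem opN_two (q : ℝ) (s : Bool) (x : Lam 2) : opN q s 2 x = opM q (!s) 2 x - x := by
  simp [opN]

theorem opN_of_ne {q : ℝ} {s : Bool} {k : ℕ} (hk : k ≠ 2) (x : Lam k) : opN q s k x = x := by
  simp [opN, hk]

theorem opN_opN {q : ℝ} (h0 : 0 < q) (s : Bool) {k : ℕ} (x : Lam k) :
    opN q s k (opN q (!s) k x) = x := by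
  by_cases hk : k = 2
  · subst hk
    have h1 := opM_two_mul h0 (!s) x
    have h2 := opM_two_add h0 s x
    rw [Bool.not_not] at h1
    rw [opN_two, opN_two, Bool.not_not, map_sub, h1, h2]
    abel
  · rw [opN_of_ne hk, opN_of_ne hk]

/-- The identity `A_s = A_{-s} (A_s - 1)` in degree `2`, and `A_s = A_{-s}` in the other degrees, on
the increasing words. -/
theorem antisymComb_not (s : Bool) {k : ℕ} (hk : k ≤ 4) : ∀ i : Fin (dim k),
    (sub (antisymComb s k [(basisWord k i, 0, 1)]) (if k = 2 then
      sub (antisymComb (!s) k (antisymComb s k [(basisWord k i, 0, 1)]))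
        (antisymComb (!s) k [(basisWord k i, 0, 1)])
      else antisymComb (!s) k [(basisWord k i, 0, 1)])).collect = [] := by
  revert s
  interval_cases k <;> decide +kernel

theorem lam_ext {E : Type} [AddCommGroup E] [Module ℂ E] {k : ℕ} {f g : Lam k →ₗ[ℂ] E}
    (h : ∀ i, f (Pi.single i 1) = g (Pi.single i 1)) : f = g := by
  refine LinearMap.pi_ext' fun i => LinearMap.ext_ring ?_
  exact h i

theorem incl_single {k : ℕ} (i : Fin (dim k)) :
    incl k (Pi.single i 1) = wordT k (basisWord k i) := by
  rw [incl, Fintype.linearCombination_apply_single, one_smul]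

/-- The antisymmetrisers for the two signs differ by the automorphism `opN`, so they have the same
range. -/
theorem antisym_incl_not {q : ℝ} (h0 : 0 < q) (s : Bool) {k : ℕ} (hk : k ≤ 4) (x : Lam k) :
    act (antisym q s k) (incl k x) = act (antisym q (!s) k) (incl k (opN q (!s) k x)) := by
  suffices h : (act (antisym q s k)).comp (incl k) =
      (act (antisym q (!s) k)).comp ((incl k).comp (opN q (!s) k)) from LinearMap.congr_fun h x
  refine lam_ext fun i => ?_
  have hH := homog_single (basisWord_length i) 0 1
  have h1 := antisym_basisWord h0 s hk i
  have h2 := antisym_basisWord h0 (!s) hk i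
  have h3 := eval_eq_of_collect_sub (sq_ne_zero h0) (wordT k) (antisymComb_not s hk i)
  simp only [LinearMap.comp_apply, incl_single]
  by_cases hk' : k = 2
  · subst hk'
    rw [if_pos rfl, eval_sub (sq_ne_zero h0)] at h3
    have h4 := val_antisymComb h0 (!s) hk (homog_antisymComb s hk hH)
    rw [opN_two, Bool.not_not, map_sub, map_sub, incl_single, opM_apply, incl_single,
      antisym_incl_coords h0 _ hk, h1, h2, ← h4]
    exact h3
  · rw [if_neg hk'] at h3
    rw [opN_of_ne hk', incl_single, h1, h2]
    exact h3

/-- On a form `x` such that `x` and `x*` are eigenforms, with eigenvalues `l` and `l'`, the operator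
`opN` is multiplication by the real number `l' / l`. -/
theorem opN_eigen {q : ℝ} (h0 : 0 < q) {s : Bool} {k : ℕ} (hk : k ≤ 4) {x : Lam k} (hx : x ≠ 0)
    {l l' : ℂ} (h : opM q s k x = l • x)
    (h' : opM q s k (lamStar q k x) = l' • lamStar q k x) :
    l ≠ 0 ∧ l' ≠ 0 ∧ opN q s k x = (l' / l) • x ∧ starRingEnd ℂ (l' / l) = l' / l := by
  have hx' : lamStar q k x ≠ 0 := fun e => hx (by rw [← lamStar_lamStar h0 hk x, e, map_zero])
  by_cases hk' : k = 2
  · subst hk'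
    set κ := (1 + (q : ℂ) ^ 2) * (1 + ((q : ℂ) ^ 2)⁻¹) with hκ
    have hκ0 : κ ≠ 0 := mul_ne_zero (one_add_sq_ne_zero q) (one_add_inv_sq_ne_zero h0)
    have h1 : opM q (!s) 2 x = (κ - l) • x := by rw [opM_two_add h0, h, sub_smul]
    have h2 : (l * (κ - l)) • x = κ • x := by
      have := opM_two_mul h0 s x
      rw [h1, map_smul, h, smul_smul, mul_comm] at this
      exact this
    have h3 : l * (κ - l) = κ := smul_left_injective ℂ hx h2
    have hκc : starRingEnd ℂ κ = κ := by simp [hκ]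
    have h4 : (starRingEnd ℂ (κ - l)) = l' := by
      have := lamStar_opM_two h0 (!s) x
      rw [h1, Bool.not_not, h', map_smulₛₗ] at this
      exact smul_left_injective ℂ hx' this
    -- the same relation for `l'`, which is conjugate to `κ - l`
    obtain ⟨h5, hl⟩ : l' = κ - l ∧ starRingEnd ℂ l = l := by
      have h6 : opM q s 2 (opM q s 2 x) = κ • opM q s 2 x - κ • x := by
        have := opM_two_mul h0 s x
        rw [opM_two_add h0, map_sub, map_smul] at this
        rw [← this]
        abel
      have h7 : (l - (1 + (q : ℂ) ^ 2)) * (l - (1 + ((q : ℂ) ^ 2)⁻¹)) = 0 := by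
        have e : κ = (1 + (q : ℂ) ^ 2) + (1 + ((q : ℂ) ^ 2)⁻¹) := by
          exact one_add_mul_one_add_inv (sq_ne_zero h0)
        linear_combination (-1 : ℂ) * h3 + l * e - hκ
      have hl : starRingEnd ℂ l = l := by
        rcases mul_eq_zero.1 h7 with h8 | h8
        · rw [sub_eq_zero.1 h8]
          simp
        · rw [sub_eq_zero.1 h8]
          simp
      exact ⟨by rw [← h4, map_sub, hκc, hl], hl⟩
    have hl0 : l ≠ 0 := by
      rintro rfl
      exact hκ0 (by rw [← h3, zero_mul])
    refine ⟨hl0, ?_, ?_, by rw [h5, map_div₀, map_sub, hκc, hl]⟩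
    · rw [h5]
      intro e
      exact hκ0 (by rw [← h3, e, mul_zero])
    · rw [opN_two, h1, ← one_smul ℂ x, smul_smul, smul_smul, ← sub_smul, h5]
      congr 1
      field_simp
      linear_combination h3
  · obtain ⟨r, hr, h1⟩ := exists_opM_eq_smul h0 hk hk'
    have e1 : (r : ℂ) = l := smul_left_injective ℂ hx ((h1 s x).symm.trans h)
    have e2 : (r : ℂ) = l' := smul_left_injective ℂ hx' ((h1 s _).symm.trans h')
    have hr' : (r : ℂ) ≠ 0 := by exact_mod_cast hr
    rw [← e1, ← e2, opN_of_ne hk', div_self hr', one_smul]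
    exact ⟨hr', hr', rfl, map_one _⟩

/-- The eigenforms whose conjugates are eigenforms span the left-invariant forms. -/
theorem exists_eigen_add {q : ℝ} (h0 : 0 < q) (h1 : q < 1) (s : Bool) {k : ℕ} (hk : k ≤ 4)
    (x : Lam k) : ∃ y z : Lam k, x = y + z ∧ ∀ w ∈ ({y, z} : Set (Lam k)), ∃ l l' : ℂ,
      opM q s k w = l • w ∧ opM q s k (lamStar q k w) = l' • lamStar q k w := by
  by_cases hk' : k = 2
  · subst hk'
    have ht0 := sq_ne_zero h0
    set a := 1 + (q : ℂ) ^ 2 with ha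
    set b := 1 + ((q : ℂ) ^ 2)⁻¹ with hb
    have hab' : a * b = a + b := by
      exact one_add_mul_one_add_inv ht0
    have hab : a - b ≠ 0 := by
      have hr : q ^ 2 - (q ^ 2)⁻¹ ≠ 0 := by
        have h2 : q ^ 2 < 1 := by nlinarith
        have h3 := (one_lt_inv₀ (by positivity : 0 < q ^ 2)).2 h2
        linarith
      have : a - b = ((q ^ 2 - (q ^ 2)⁻¹ : ℝ) : ℂ) := by
        rw [ha, hb]
        push_cast
        ring
      rw [this]
      exact_mod_cast hr
    have hM : opM q s 2 (opM q s 2 x) = (a + b) • opM q s 2 x - (a * b) • x := by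
      have := opM_two_mul h0 s x
      rw [opM_two_add h0, map_sub, map_smul, ← ha, ← hb] at this
      rw [← hab', ← this]
      abel
    -- `w` is an eigenvector for `c` as soon as `M x - d x` is proportional to it
    have key (c d : ℂ) (hc : starRingEnd ℂ (a * b - c) = a * b - c)
        (hcd : a + b = c + d) (hcd' : a * b = c * d) (r : ℂ) :
        opM q s 2 (r • (opM q s 2 x - d • x)) = c • r • (opM q s 2 x - d • x) ∧
        opM q s 2 (lamStar q 2 (r • (opM q s 2 x - d • x))) =
          (a * b - c) • lamStar q 2 (r • (opM q s 2 x - d • x)) := by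
      have e : opM q s 2 (r • (opM q s 2 x - d • x)) = c • r • (opM q s 2 x - d • x) := by
        rw [map_smul, map_sub, map_smul, hM, hcd, hcd']
        module
      refine ⟨e, ?_⟩
      have h := lamStar_opM_two h0 (!s) (r • (opM q s 2 x - d • x))
      rw [Bool.not_not] at h
      rw [← h, opM_two_add h0, e, ← ha, ← hb, ← sub_smul, map_smulₛₗ, hc]
    refine ⟨(a - b)⁻¹ • (opM q s 2 x - b • x), (b - a)⁻¹ • (opM q s 2 x - a • x), ?_, ?_⟩
    · have : (b - a)⁻¹ = -(a - b)⁻¹ := by rw [← neg_sub, inv_neg]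
      rw [this]
      calc x = ((a - b)⁻¹ * (a - b)) • x := by rw [inv_mul_cancel₀ hab, one_smul]
        _ = _ := by module
    · have hac : starRingEnd ℂ a = a := by simp [ha]
      have hbc : starRingEnd ℂ b = b := by simp [hb]
      rintro w (rfl | rfl)
      · exact ⟨a, _, key a b (by rw [map_sub, map_mul, hac, hbc]) rfl rfl _⟩
      · exact ⟨b, _, key b a (by rw [map_sub, map_mul, hac, hbc]) (add_comm _ _) (mul_comm _ _) _⟩
  · obtain ⟨r, -, h1⟩ := exists_opM_eq_smul h0 hk hk'
    refine ⟨x, 0, (add_zero x).symm, ?_⟩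
    intro w _
    exact ⟨r, r, h1 s w, h1 s _⟩

theorem opM_injective {q : ℝ} (h0 : 0 < q) (s : Bool) {k : ℕ} (hk : k ≤ 4) {x : Lam k}
    (h : opM q s k x = 0) : x = 0 := by
  by_cases hk' : k = 2
  · subst hk'
    have h1 := opM_two_mul h0 (!s) x
    rw [Bool.not_not, h, map_zero] at h1
    exact (smul_eq_zero.1 h1.symm).resolve_left
      (mul_ne_zero (one_add_sq_ne_zero q) (one_add_inv_sq_ne_zero h0))
  · obtain ⟨r, hr, h1⟩ := exists_opM_eq_smul h0 hk hk'
    rw [h1] at h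
    exact (smul_eq_zero.1 h).resolve_left (by exact_mod_cast hr)

/-- The left-invariant form with the given coordinates. -/
noncomputable def phi (q : ℝ) (s : Bool) (k : ℕ) : Lam k →ₗ[ℂ] InvForms q s k :=
  (wedge q s).comp (incl k)

theorem phi_coe (q : ℝ) (s : Bool) {k : ℕ} (x : Lam k) :
    (phi q s k x).1 = act (antisym q s k) (incl k x) := rfl

theorem wedge_eq_phi {q : ℝ} (h0 : 0 < q) (s : Bool) {k : ℕ} (hk : k ≤ 4) (t : Tens ℂ k) :
    wedge q s t = phi q s k (coords q k t) :=
  Subtype.ext (antisym_incl_coords h0 s hk t).symm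

theorem phi_injective {q : ℝ} (h0 : 0 < q) (s : Bool) {k : ℕ} (hk : k ≤ 4) :
    Function.Injective (phi q s k) := by
  rw [injective_iff_map_eq_zero]
  intro x hx
  refine opM_injective h0 s hk ?_
  rw [opM_apply, ← phi_coe, hx]
  exact map_zero _

theorem phi_surjective {q : ℝ} (h0 : 0 < q) (s : Bool) {k : ℕ} (hk : k ≤ 4) :
    Function.Surjective (phi q s k) := by
  rintro ⟨_, t, rfl⟩
  exact ⟨coords q k t, (wedge_eq_phi h0 s hk t).symm⟩

theorem antisymForm_phi {q : ℝ} (h0 : 0 < q) (s : Bool) {k : ℕ} (hk : k ≤ 4) (x : Lam k) :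
    antisymForm q s (phi q s k x) = phi q s k (opM q s k x) :=
  wedge_eq_phi h0 s hk _

theorem formStar_phi {q : ℝ} (h0 : 0 < q) (s : Bool) {k : ℕ} (hk : k ≤ 4) (x : Lam k) :
    formStar q s (phi q s k x) = phi q s k (lamStar q k x) := by
  have h := Classical.choose_spec (phi q s k x).2
  have h' : coords q k (Classical.choose (phi q s k x).2) = x := by
    refine phi_injective h0 s hk ?_
    rw [← wedge_eq_phi h0 s hk]
    exact Subtype.ext h
  rw [formStar, wedge_eq_phi h0 s hk, coords_tensStar h0 hk, h']

/-- The two systems of coordinates of a form, for the two signs, differ by `opN`. -/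
theorem phi_not {q : ℝ} (h0 : 0 < q) (s : Bool) {k : ℕ} (hk : k ≤ 4) (x : Lam k) :
    (phi q s k x).1 = (phi q (!s) k (opN q (!s) k x)).1 :=
  antisym_incl_not h0 s hk x

/-! ### Hodge operators in coordinates -/

theorem contract_add_left (Γ : Matrix (Fin 4) (Fin 4) ℂ) {k j n : ℕ} (h : k + j = n)
    (ξ η : Tens ℂ k) (t : Tens ℂ n) :
    contract Γ h (ξ + η) t = contract Γ h ξ t + contract Γ h η t := by
  funext c
  simp only [contract, Pi.add_apply, map_add, add_mul, Finset.sum_add_distrib]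

theorem contract_smul_left (Γ : Matrix (Fin 4) (Fin 4) ℂ) {k j n : ℕ} (h : k + j = n)
    (r : ℂ) (ξ : Tens ℂ k) (t : Tens ℂ n) :
    contract Γ h (r • ξ) t = starRingEnd ℂ r • contract Γ h ξ t := by
  funext c
  simp only [contract, Pi.smul_apply, smul_eq_mul, map_mul, Finset.mul_sum, mul_assoc]

theorem contract_add_right (Γ : Matrix (Fin 4) (Fin 4) ℂ) {k j n : ℕ} (h : k + j = n)
    (ξ : Tens ℂ k) (t u : Tens ℂ n) :
    contract Γ h ξ (t + u) = contract Γ h ξ t + contract Γ h ξ u := by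
  funext c
  simp only [contract, Pi.add_apply, mul_add, Finset.sum_add_distrib]

theorem contract_smul_right (Γ : Matrix (Fin 4) (Fin 4) ℂ) {k j n : ℕ} (h : k + j = n)
    (r : ℂ) (ξ : Tens ℂ k) (t : Tens ℂ n) :
    contract Γ h ξ (r • t) = r • contract Γ h ξ t := by
  funext c
  simp only [contract, Pi.smul_apply, smul_eq_mul, Finset.mul_sum]
  exact Finset.sum_congr rfl fun a _ => Finset.sum_congr rfl fun b _ => by ring

/-- The map `t ↦ (Γ(t, B_{k,j} ϑ))*` followed by the antisymmetriser, in coordinates.  The Hodge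
operator is `hod ∘ opN`, since `opN` is the factor `λ_{ξ*} / λ_ξ`. -/
noncomputable def hod (q : ℝ) (s : Bool) (m : ℝ) (Γ : Matrix (Fin 4) (Fin 4) ℂ) {k j : ℕ}
    (h : k + j = 4) : Lam k →ₗ[ℂ] Lam j where
  toFun x := lamStar q j (coords q j
    (contract Γ h (phi q s k x).1 (act (shuffleOp q s k 4) (volTens m))))
  map_add' x y := by
    rw [map_add, Submodule.coe_add, contract_add_left, map_add, map_add]
  map_smul' r x := by
    rw [map_smul, Submodule.coe_smul, contract_smul_left, map_smul, map_smulₛₗ, RingHom.id_apply,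
      Complex.conj_conj]

theorem hod_apply (q : ℝ) (s : Bool) (m : ℝ) (Γ : Matrix (Fin 4) (Fin 4) ℂ) {k j : ℕ}
    (h : k + j = 4) (x : Lam k) : hod q s m Γ h x = lamStar q j (coords q j
      (contract Γ h (phi q s k x).1 (act (shuffleOp q s k 4) (volTens m)))) := rfl

theorem phi_hod {q : ℝ} (h0 : 0 < q) (s : Bool) (m : ℝ) (Γ : Matrix (Fin 4) (Fin 4) ℂ) {k j : ℕ}
    (h : k + j = 4) (x : Lam k) : phi q s j (hod q s m Γ h x) = formStar q s (wedge q s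
      (contract Γ h (phi q s k x).1 (act (shuffleOp q s k 4) (volTens m)))) := by
  have hj : j ≤ 4 := by omega
  rw [wedge_eq_phi h0 s hj, formStar_phi h0 s hj, hod_apply]

theorem isEigenform_phi {q : ℝ} (h0 : 0 < q) (s : Bool) {k : ℕ} (hk : k ≤ 4) (x : Lam k) (l : ℂ) :
    IsEigenform q s (phi q s k x) l ↔ x ≠ 0 ∧ opM q s k x = l • x := by
  rw [IsEigenform, antisymForm_phi h0 s hk, ← map_smul, (phi_injective h0 s hk).eq_iff, Ne,
    (map_eq_zero_iff _ (phi_injective h0 s hk))]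

/-- The Hodge operator in coordinates. -/
noncomputable def hodgeLam (q : ℝ) (s : Bool) (m : ℝ) (Γ : Matrix (Fin 4) (Fin 4) ℂ) {k j : ℕ}
    (h : k + j = 4) : Lam k →ₗ[ℂ] Lam j := (hod q s m Γ h).comp (opN q s k)

theorem hodgeLam_apply (q : ℝ) (s : Bool) (m : ℝ) (Γ : Matrix (Fin 4) (Fin 4) ℂ) {k j : ℕ}
    (h : k + j = 4) (x : Lam k) : hodgeLam q s m Γ h x = hod q s m Γ h (opN q s k x) := rfl

theorem hodgeLam_of_ne (q : ℝ) (s : Bool) (m : ℝ) (Γ : Matrix (Fin 4) (Fin 4) ℂ) {k j : ℕ}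
    (h : k + j = 4) (hk : k ≠ 2) (x : Lam k) : hodgeLam q s m Γ h x = hod q s m Γ h x := by
  rw [hodgeLam_apply, opN_of_ne hk]

/-- The eigenforms with which the Hodge operator is defined span the left-invariant forms, so the
definition determines the operator, and in coordinates it is `hodgeLam`. -/
theorem isHodge_iff {q : ℝ} (hq : q ∈ Set.Ioo (0 : ℝ) 1) (s : Bool) (m : ℝ)
    (Γ : Matrix (Fin 4) (Fin 4) ℂ) (T : InvOp q s) : IsHodge q s m Γ T ↔
      ∀ (k j : ℕ) (h : k + j = 4) (x : Lam k),
        T k j h (phi q s k x) = phi q s j (hodgeLam q s m Γ h x) := by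
  have h0 := hq.1
  simp only [hodgeLam_apply]
  constructor
  · intro hT k j h x
    have hk : k ≤ 4 := by omega
    obtain ⟨y, z, rfl, hyz⟩ := exists_eigen_add h0 hq.2 s hk x
    have key (w : Lam k) (hw : w ∈ ({y, z} : Set (Lam k))) :
        T k j h (phi q s k w) = phi q s j (hod q s m Γ h (opN q s k w)) := by
      by_cases hw0 : w = 0
      · rw [hw0]
        simp only [map_zero]
      · obtain ⟨l, l', hl, hl'⟩ := hyz w hw
        have hw' : lamStar q k w ≠ 0 := fun e => hw0 (by
          rw [← lamStar_lamStar h0 hk w, e, map_zero])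
        rw [hT k j h _ l l' ((isEigenform_phi h0 s hk w l).2 ⟨hw0, hl⟩)
          (by rw [formStar_phi h0 s hk]; exact (isEigenform_phi h0 s hk _ l').2 ⟨hw', hl'⟩),
          (opN_eigen h0 hk hw0 hl hl').2.2.1, map_smul, map_smul, phi_hod h0]
    simp only [map_add]
    rw [key y (by simp), key z (by simp)]
  · intro hT k j h ξ l l' hl hl'
    have hk : k ≤ 4 := by omega
    obtain ⟨x, rfl⟩ := phi_surjective h0 s hk ξ
    rw [formStar_phi h0 s hk, isEigenform_phi h0 s hk] at hl'
    rw [isEigenform_phi h0 s hk] at hl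
    rw [hT, (opN_eigen h0 hk hl.1 hl.2 hl'.2).2.2.1, map_smul, map_smul, phi_hod h0]

/-- The Hodge operator exists and is unique. -/
theorem existsUnique_hodge {q : ℝ} (hq : q ∈ Set.Ioo (0 : ℝ) 1) (s : Bool) (m : ℝ)
    (Γ : Matrix (Fin 4) (Fin 4) ℂ) : ∃! T : InvOp q s, IsHodge q s m Γ T := by
  simp only [isHodge_iff hq]
  have hg (k : ℕ) : ∃ g : InvForms q s k →ₗ[ℂ] Lam k, k ≤ 4 → g.comp (phi q s k) = .id := by
    by_cases hk : k ≤ 4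
    · obtain ⟨g, hg⟩ := (phi q s k).exists_leftInverse_of_injective
        (LinearMap.ker_eq_bot.2 (phi_injective hq.1 s hk))
      exact ⟨g, fun _ => hg⟩
    · exact ⟨0, fun h => absurd h hk⟩
  choose g hg using hg
  refine ⟨fun k j h => (phi q s j).comp ((hodgeLam q s m Γ h).comp (g k)), ?_, ?_⟩
  · intro k j h x
    have := LinearMap.congr_fun (hg k (by omega)) x
    simp only [LinearMap.comp_apply, LinearMap.id_apply] at this ⊢
    rw [this]
  · intro T hT
    funext k j h
    refine LinearMap.ext fun ξ => ?_
    obtain ⟨x, rfl⟩ := phi_surjective hq.1 s (by omega) ξ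
    have := LinearMap.congr_fun (hg k (by omega)) x
    simp only [LinearMap.comp_apply, LinearMap.id_apply] at this ⊢
    rw [hT, this]

theorem vol_eq_phi (q : ℝ) (s : Bool) (m : ℝ) : vol q s m = phi q s 4 fun _ => Complex.I * m := by
  have : volTens m = incl 4 fun _ => Complex.I * m := by
    have h : wordT 4 (basisWord 4 (0 : Fin 1)) = Pi.single ![0, 1, 2, 3] 1 :=
      wordT_ofFn ![0, 1, 2, 3]
    funext b
    rw [incl_apply, sum_dim_four, h]
    simp [volTens, Pi.single_apply]
  rw [vol, this]
  rfl

theorem oneForm_eq_phi (q : ℝ) (s : Bool) : oneForm q s = phi q s 0 fun _ => 1 := by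
  have : (fun _ => 1 : Tens ℂ 0) = incl 0 fun _ => 1 := by
    funext b
    rw [incl_apply, sum_dim_zero]
    simp [wordT, Subsingleton.elim _ b]
  rw [oneForm, this]
  rfl

theorem scalar_phi (q : ℝ) (s : Bool) (x : Lam 0) : scalar (phi q s 0 x) = x (0 : Fin 1) := by
  rw [scalar, phi_coe, antisym_zero, act_one, incl_apply, sum_dim_zero]
  simp [wordT, Pi.single_apply, eq_iff_true_of_subsingleton]

/-- The conditions for a real and maximally hermitian contraction, in coordinates. -/
theorem isRealMaxHerm_iff {q : ℝ} (hq : q ∈ Set.Ioo (0 : ℝ) 1) (s : Bool) (m : ℝ)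
    (Γ : Matrix (Fin 4) (Fin 4) ℂ) {T : InvOp q s} (hT : IsHodge q s m Γ T) :
    IsRealMaxHerm q s m T ↔
      hodgeLam q s m Γ (rfl : 4 + 0 = 4) (fun _ => Complex.I * m) ≠ 0 ∧
      (∀ x, hodgeLam q s m Γ (rfl : 1 + 3 = 4) (lamStar q 1 x) =
        lamStar q 3 (hodgeLam q s m Γ rfl x)) ∧
      (∀ x, hodgeLam q s m Γ (rfl : 3 + 1 = 4) (hodgeLam q s m Γ (rfl : 1 + 3 = 4) x) =
        -(hodgeLam q s m Γ (rfl : 4 + 0 = 4) (hodgeLam q s m Γ (rfl : 0 + 4 = 4) fun _ => 1)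
          (0 : Fin 1)) • x) ∧
      ∀ (k j : ℕ) (h : k + j = 4) (h' : j + k = 4) (l : ℂ), ∃ c : ℂ, ∀ x : Lam k,
        opM q s k x = l • x → hodgeLam q s m Γ h' (hodgeLam q s m Γ h x) = c • x := by
  have h0 := hq.1
  rw [isHodge_iff hq] at hT
  have hsq {k j : ℕ} (h : k + j = 4) (x : Lam k) : sq T k j h (phi q s k x) =
      phi q s k (hodgeLam q s m Γ ((Nat.add_comm j k).trans h) (hodgeLam q s m Γ h x)) := by
    rw [sq, LinearMap.comp_apply, hT, hT]
  have hone : scalar (sq T 0 4 rfl (oneForm q s)) = hodgeLam q s m Γ (rfl : 4 + 0 = 4)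
      (hodgeLam q s m Γ (rfl : 0 + 4 = 4) fun _ => 1) (0 : Fin 1) := by
    rw [oneForm_eq_phi, hsq, scalar_phi]
  constructor
  · rintro ⟨h1, h2, h3, h4⟩
    refine ⟨?_, fun x => ?_, fun x => ?_, fun k j h h' l => ?_⟩
    · rw [vol_eq_phi, hT] at h1
      exact fun e => h1 (by rw [e, map_zero])
    · have := h2 (phi q s 1 x)
      rw [formStar_phi h0 s (by norm_num), hT, hT, formStar_phi h0 s (by norm_num)] at this
      exact phi_injective h0 s (by norm_num) this
    · have := h3 (phi q s 1 x)
      rw [hsq, hone, ← map_smul, ← map_neg, ← neg_smul] at this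
      exact phi_injective h0 s (by norm_num) this
    · obtain ⟨c, hc⟩ := h4 k j h l
      have hk : k ≤ 4 := by omega
      refine ⟨c, fun x hx => phi_injective h0 s hk ?_⟩
      have := hc (phi q s k x) (by rw [antisymForm_phi h0 s hk, hx, map_smul])
      rwa [hsq, ← map_smul] at this
  · rintro ⟨h1, h2, h3, h4⟩
    refine ⟨?_, fun φ => ?_, fun φ => ?_, fun k j h l => ?_⟩
    · rw [vol_eq_phi, hT]
      exact fun e => h1 (phi_injective h0 s (by norm_num) (e.trans (map_zero _).symm))
    · obtain ⟨x, rfl⟩ := phi_surjective h0 s (by norm_num) φ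
      rw [formStar_phi h0 s (by norm_num), hT, hT, formStar_phi h0 s (by norm_num), h2]
    · obtain ⟨x, rfl⟩ := phi_surjective h0 s (by norm_num) φ
      rw [hsq, hone, h3, map_smul]
      exact neg_smul (_ : ℂ) (phi q s 1 x)
    · have hk : k ≤ 4 := by omega
      obtain ⟨c, hc⟩ := h4 k j h ((Nat.add_comm j k).trans h) l
      refine ⟨c, fun ξ hξ => ?_⟩
      obtain ⟨x, rfl⟩ := phi_surjective h0 s hk ξ
      rw [antisymForm_phi h0 s hk, ← map_smul] at hξ
      rw [hsq, hc x (phi_injective h0 s hk hξ), map_smul]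

/-! ### The coefficients of the Hodge operators -/

theorem contract_wordT_append (Γ : Matrix (Fin 4) (Fin 4) ℂ) {k j n : ℕ} (h : k + j = n)
    {u v w : List (Fin 4)} (hu : u.length = k) (hv : v.length = k) (hw : w.length = j) :
    contract Γ h (wordT k u) (wordT n (v ++ w)) =
      ((List.zip u v).map fun x => Γ x.1 x.2).prod • wordT j w := by
  subst h
  obtain ⟨a, rfl⟩ := exists_ofFn hu
  obtain ⟨b, rfl⟩ := exists_ofFn hv
  obtain ⟨d, rfl⟩ := exists_ofFn hw
  have hz : ((List.zip (List.ofFn a) (List.ofFn b)).map fun x => Γ x.1 x.2).prod =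
      ∏ i, Γ (a i) (b i) := by
    rw [← List.prod_ofFn]
    congr 1
    apply List.ext_getElem <;> simp
  funext c
  rw [← List.ofFn_fin_append, wordT_ofFn, wordT_ofFn, wordT_ofFn, hz, contract,
    Finset.sum_eq_single a, Finset.sum_eq_single b]
  · by_cases hc : c = d
    · subst hc
      simp
    · have : Fin.append b c ≠ Fin.append b d := fun h => hc (by
        funext i
        have := congrFun h (Fin.natAdd k i)
        simpa using this)
      simp [hc, this]
  · intro b' _ hb
    have : Fin.append b' c ≠ Fin.append b d := fun h => hb (by
      funext i
      have := congrFun h (Fin.castAdd j i)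
      simpa using this)
    simp [this]
  · simp
  · intro a' _ ha
    simp [ha]
  · simp

/-- The pairs of indices with equal weights. -/
def sameWeight (x : Fin 4 × Fin 4) : Bool := weight x.1 = weight x.2

/-- The lexicographic order on pairs of indices, used to normalise monomials in the `Γ_{ab}`. -/
def pairLe (x y : Fin 4 × Fin 4) : Prop := 4 * x.1.val + x.2.val ≤ 4 * y.1.val + y.2.val

instance : DecidableRel pairLe := fun _ _ => inferInstanceAs (Decidable (_ ≤ _))

/-- The contraction of two words as a formal sum of pairs of a monomial in the coefficients
`Γ_{ab}` and a word. -/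
def contractWord (k : ℕ) (u v : List (Fin 4)) :
    LinComb (List (Fin 4 × Fin 4) × List (Fin 4)) :=
  if (List.zip u (v.take k)).all sameWeight then
    [(((List.zip u (v.take k)).insertionSort pairLe, v.drop k), 0, 1)] else []

theorem contract_wordT {Γ : Matrix (Fin 4) (Fin 4) ℂ} (hΓ : IsCoinvariant Γ) {k j n : ℕ}
    (h : k + j = n) (t : ℂ) {u v : List (Fin 4)} (hu : u.length = k) (hv : v.length = n) :
    contract Γ h (wordT k u) (wordT n v) =
      eval t (fun x => (x.1.map fun y => Γ y.1 y.2).prod • wordT j x.2) (contractWord k u v) := by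
  have h1 := contract_wordT_append Γ h (u := u) (v := v.take k) (w := v.drop k) hu
    (by rw [List.length_take]; omega) (by rw [List.length_drop]; omega)
  rw [List.take_append_drop] at h1
  rw [h1, contractWord]
  split_ifs with h2
  · have := ((List.perm_insertionSort pairLe (List.zip u (v.take k))).map
      fun y => Γ y.1 y.2).prod_eq
    simp [this]
  · rw [List.all_eq_true] at h2
    push Not at h2
    obtain ⟨x, hx, hx'⟩ := h2
    rw [List.prod_eq_zero, zero_smul, eval_nil]
    exact List.mem_map.2 ⟨x, hx, hΓ _ _ (by simpa [sameWeight] using hx')⟩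

instance {n : ℕ} (k : ℕ) (p : Equiv.Perm (Fin n)) : Decidable (IsShuffle k p) :=
  inferInstanceAs (Decidable (∀ i j : Fin n, i < j → ((j : ℕ) < k ∨ k ≤ (i : ℕ)) → p i < p j))

/-- The signs and reduced words of the inverses of the shuffles of four letters. -/
def shuffleWords : ℕ → List (ℤ × List ℕ)
  | 1 => [(1, []), (-1, [0]), (1, [0, 1]), (-1, [0, 1, 2])]
  | 2 => [(1, []), (-1, [1]), (1, [1, 2]), (1, [1, 0]), (-1, [1, 2, 0]), (1, [1, 2, 0, 1])]
  | 3 => [(1, []), (-1, [2]), (1, [2, 1]), (-1, [2, 1, 0])]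
  | _ => [(1, [])]

/-- The table `shuffleWords` lists all shuffles. -/
theorem shuffle_data {k : ℕ} (hk : k ≤ 4) :
    ((Finset.univ : Finset (Equiv.Perm (Fin 4))).filter (IsShuffle k)).val.map (fun p =>
      (((Equiv.Perm.sign p : ℤ), reducedWord 16 p⁻¹) : ℤ × List ℕ)) = shuffleWords k := by
  interval_cases k <;> decide +kernel

theorem shuffleOp_eq (q : ℝ) (s : Bool) {k : ℕ} (hk : k ≤ 4) : shuffleOp q s k 4 =
    ((shuffleWords k).map fun x => (x.1 : ℂ) • (x.2.map (sigmaAt q s 4)).prod).sum := by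
  have h := congrArg (fun m : Multiset (ℤ × List ℕ) =>
    (m.map fun x => (x.1 : ℂ) • (x.2.map (sigmaAt q s 4)).prod).sum) (shuffle_data hk)
  simp only [Multiset.map_map, Multiset.map_coe, Multiset.sum_coe] at h
  rw [← h, shuffleOp, Finset.sum_eq_multiset_sum]
  congr! 2
  exact congrArg Finset.val (by ext; simp)

/-- The product `σ_{j_1} ⋯ σ_{j_n}` on formal sums of words. -/
def wordComb (s : Bool) (l : List ℕ) (c : LinComb (List (Fin 4))) : LinComb (List (Fin 4)) :=
  l.foldr (sigmaComb s) c

theorem homog_wordComb (s : Bool) {k : ℕ} {l : List ℕ} (hl : ∀ j ∈ l, j + 1 < k)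
    {c : LinComb (List (Fin 4))} (hc : Homog k c) : Homog k (wordComb s l c) := by
  induction l with
  | nil => exact hc
  | cons j l ih => exact (ih fun i hi => hl i (by simp [hi])).sigmaComb (hl j (by simp))

theorem val_wordComb {q : ℝ} (h0 : 0 < q) (s : Bool) {k : ℕ} {l : List ℕ}
    (hl : ∀ j ∈ l, j + 1 < k) {c : LinComb (List (Fin 4))} (hc : Homog k c) :
    val q k (wordComb s l c) = act (l.map (sigmaAt q s k)).prod (val q k c) := by
  induction l with
  | nil => simp [wordComb, act_one]
  | cons j l ih =>
    have hl' : ∀ i ∈ l, i + 1 < k := fun i hi => hl i (by simp [hi])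
    rw [List.map_cons, List.prod_cons, act_mul, ← ih hl',
      ← val_sigmaComb h0 (hl j (by simp)) s (homog_wordComb s hl' hc)]
    rfl

/-- The tensor `B_{k,4-k}(ω_- ⊗ ω_+ ⊗ ω_0 ⊗ ω_z)` as a formal sum of words. -/
def shuffleComb (s : Bool) (k : ℕ) : LinComb (List (Fin 4)) :=
  collect ((shuffleWords k).flatMap fun x =>
    scale 0 x.1 (wordComb s x.2 [([0, 1, 2, 3], 0, 1)]))

theorem shuffleWords_lt {k : ℕ} (hk : k ≤ 4) : ∀ x ∈ shuffleWords k, ∀ j ∈ x.2, j + 1 < 4 := by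
  interval_cases k <;> decide

theorem homog_shuffleComb (s : Bool) {k : ℕ} (hk : k ≤ 4) : Homog 4 (shuffleComb s k) := by
  refine Homog.collect fun y hy => ?_
  obtain ⟨x, hx, hy⟩ := List.mem_flatMap.1 hy
  exact (homog_wordComb s (shuffleWords_lt hk x hx) (homog_single (k := 4) rfl 0 1)).scale _ _ y hy

theorem act_shuffleOp {q : ℝ} (h0 : 0 < q) (s : Bool) {k : ℕ} (hk : k ≤ 4) (m : ℝ) :
    act (shuffleOp q s k 4) (volTens m) = (Complex.I * m) • val q 4 (shuffleComb s k) := by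
  have h1 : volTens m = (Complex.I * m) • val q 4 [([0, 1, 2, 3], 0, 1)] := by
    funext b
    have : wordT 4 [0, 1, 2, 3] = Pi.single ![0, 1, 2, 3] 1 := wordT_ofFn ![0, 1, 2, 3]
    simp [volTens, this, Pi.single_apply]
  rw [h1, map_smul, shuffleOp_eq q s hk, val, val, shuffleComb, eval_collect]
  congr 1
  have := shuffleWords_lt hk
  generalize shuffleWords k = l at this ⊢
  induction l with
  | nil => funext b; simp [act]
  | cons x l ih =>
    rw [List.map_cons, List.sum_cons, act_add, ih fun y hy => this y (by simp [hy]), act_smul,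
      ← val_wordComb h0 s (this x (by simp)) (homog_single (k := 4) rfl 0 1), List.flatMap_cons,
      eval_append, eval_scale (sq_ne_zero h0)]
    simp

/-- The image of a basis form under `hod`, up to the factor `(i m)*`, as a formal sum of pairs of a
monomial in the conjugates of the `Γ_{ab}` and an increasing word. -/
def hodComb (s : Bool) (k : ℕ) (i : Fin (dim k)) :
    LinComb (List (Fin 4 × Fin 4) × List (Fin 4)) :=
  ((antisymComb s k [(basisWord k i, 0, 1)]).bind fun u => (shuffleComb s k).bind fun v =>
    (contractWord k u v).bind fun x =>
      (normalForm (x.2.reverse.map bar)).map fun z => ((x.1, z.1), z.2)).collect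

/-- The coordinates of a formal sum of pairs of a monomial in the `Γ_{ab}*` and a word. -/
noncomputable def gamLam (q : ℝ) (Γ : Matrix (Fin 4) (Fin 4) ℂ) (j : ℕ)
    (c : LinComb (List (Fin 4 × Fin 4) × List (Fin 4))) : Lam j :=
  eval ((q : ℂ) ^ 2) (fun x => (x.1.map fun y => starRingEnd ℂ (Γ y.1 y.2)).prod •
    fun i => if x.2 = basisWord j i then (1 : ℂ) else 0) c

theorem hod_single {q : ℝ} (h0 : 0 < q) (s : Bool) (m : ℝ) {Γ : Matrix (Fin 4) (Fin 4) ℂ}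
    (hΓ : IsCoinvariant Γ) {k j : ℕ} (h : k + j = 4) (i : Fin (dim k)) :
    hod q s m Γ h (Pi.single i 1) =
      (-(Complex.I * m) * (-1) ^ (j * (j - 1) / 2 + j)) • gamLam q Γ j (hodComb s k i) := by
  have hk : k ≤ 4 := by omega
  have hj : j ≤ 4 := by omega
  have ht := sq_ne_zero h0
  have hc := homog_antisymComb s hk (homog_single (basisWord_length i) 0 1)
  have hd := homog_shuffleComb s hk
  let F : Tens ℂ 4 →ₗ[ℂ] Tens ℂ k →ₗ⋆[ℂ] Tens ℂ j := LinearMap.mk₂'ₛₗ (RingHom.id ℂ)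
    (starRingEnd ℂ) (fun t ξ => contract Γ h ξ t) (fun t u ξ => contract_add_right Γ h ξ t u)
    (fun r t ξ => contract_smul_right Γ h r ξ t) (fun t ξ η => contract_add_left Γ h ξ η t)
    (fun r t ξ => contract_smul_left Γ h r ξ t)
  rw [hod_apply, phi_coe, incl_single, antisym_basisWord h0 s hk, act_shuffleOp h0 s hk,
    contract_smul_right, map_smul, map_smulₛₗ, ← coords_tensStar h0 hj]
  rw [mul_smul]
  congr 1
  · simp
  rw [gamLam, hodComb, eval_collect, eval_bind ht]
  change ((coords q j).comp (tensStarₗ j)) (F (val q 4 (shuffleComb s k)) (val q k _)) = _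
  rw [val, val, map_eval_conj, map_eval_conj, smul_eval]
  refine eval_congr _ fun u hu => ?_
  change ((coords q j).comp (tensStarₗ j)) ((F.flip (wordT k u.1)) (eval _ _ _)) = _
  rw [map_eval, map_eval_conj, eval_bind ht, smul_eval]
  refine eval_congr _ fun v hv => ?_
  change ((coords q j).comp (tensStarₗ j)) (contract Γ h (wordT k u.1) (wordT 4 v.1)) = _
  rw [contract_wordT hΓ h ((q : ℂ) ^ 2) (hc u hu) (hd v hv), map_eval_conj, eval_bind ht,
    smul_eval]
  refine eval_congr _ fun x hx => ?_
  have hx' : x.1.2.length = j := by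
    rw [contractWord] at hx
    split_ifs at hx
    · rw [List.mem_singleton.1 hx]
      change (v.1.drop k).length = j
      rw [List.length_drop, hd v hv]
      omega
    · simp at hx
  rw [map_smulₛₗ]
  change _ • coords q j (tensStar (wordT j x.1.2)) = _
  rw [coords_tensStar_wordT q hx', map_list_prod, List.map_map, smul_comm, lam,
    eval_map _ _ (fun z => (x.1.1, z)), smul_eval]
  rfl

/-! ### Tables of the Hodge operators -/

theorem hodComb_zero (s : Bool) : ∀ i, hodComb s 0 i = (![
      [(([], [0, 1, 2, 3]), 0, -1)]
    ] : Fin 1 → _) i := by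
  revert s
  decide +kernel

theorem hodComb_one (s : Bool) : ∀ i, hodComb s 1 i = (![
      [(([(0, 0)], [0, 2, 3]), 0, -1)],
      [(([(1, 1)], [1, 2, 3]), 0, 1)],
      [(([(2, 2)], [0, 1, 3]), 0, 1), (([(2, 3)], [0, 1, 2]), 0, -1)],
      [(([(3, 2)], [0, 1, 3]), 0, 1), (([(3, 3)], [0, 1, 2]), 0, -1)]
    ] : Fin 4 → _) i := by
  revert s
  decide +kernel

theorem hodComb_two_true : ∀ i, hodComb true 2 i = (![
      [(([(0, 0), (1, 1)], [0, 1]), -2, 1), (([(0, 0), (1, 1)], [0, 1]), -1, -3), (([(0, 0), (1,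
      1)], [0, 1]), 0, 4), (([(0, 0), (1, 1)], [2, 3]), -1, -1), (([(0, 0), (1, 1)], [0, 1]), 1,
      -3), (([(0, 0), (1, 1)], [0, 1]), 2, 1), (([(0, 0), (1, 1)], [2, 3]), 1, -1), (([(0, 0),
      (1, 1)], [2, 3]), 0, 1), (([(2, 2), (3, 3)], [0, 1]), -1, -1), (([(2, 2), (3, 3)], [0, 1]),
      0, 2), (([(2, 2), (3, 3)], [0, 1]), 1, -1), (([(2, 2), (3, 3)], [2, 3]), 0, 1), (([(2, 3),
      (3, 2)], [0, 1]), 0, 1)],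
      [(([(0, 0), (2, 2)], [0, 2]), 1, -1), (([(0, 0), (2, 2)], [0, 2]), 0, -1), (([(0, 0), (2,
      2)], [0, 3]), 0, 1), (([(0, 0), (2, 3)], [0, 2]), 2, -1)],
      [(([(0, 0), (3, 2)], [0, 3]), -1, 1), (([(0, 0), (3, 3)], [0, 2]), 1, -1), (([(0, 0), (3,
      2)], [0, 2]), 1, -1), (([(0, 0), (3, 2)], [0, 2]), 0, -1), (([(0, 0), (2, 2)], [0, 3]), 0,
      -1), (([(0, 0), (2, 3)], [0, 2]), 1, 1), (([(0, 0), (2, 3)], [0, 2]), 2, 1), (([(0, 0), (2,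
      2)], [0, 3]), -1, -1)],
      [(([(1, 1), (2, 2)], [1, 2]), 0, -1), (([(1, 1), (2, 2)], [1, 2]), -1, -1), (([(1, 1), (2,
      2)], [1, 3]), 0, -1), (([(1, 1), (2, 3)], [1, 2]), -2, 1)],
      [(([(1, 1), (3, 2)], [1, 3]), 1, -1), (([(1, 1), (3, 3)], [1, 2]), -1, 1), (([(1, 1), (3,
      2)], [1, 2]), 0, -1), (([(1, 1), (3, 2)], [1, 2]), -1, -1), (([(1, 1), (2, 2)], [1, 3]), 0,
      -1), (([(1, 1), (2, 3)], [1, 2]), -2, 1), (([(1, 1), (2, 2)], [1, 3]), 1, -1), (([(1, 1),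
      (2, 3)], [1, 2]), -1, 1)],
      [(([(2, 3), (3, 2)], [0, 1]), -1, -1), (([(2, 3), (3, 2)], [0, 1]), 0, 1), (([(2, 3), (3,
      2)], [0, 1]), 1, -1), (([(2, 3), (3, 2)], [2, 3]), 0, 1), (([(2, 2), (3, 3)], [0, 1]), 0,
      -1), (([(2, 2), (3, 3)], [0, 1]), -1, 1), (([(2, 2), (3, 3)], [0, 1]), 1, 1), (([(2, 2),
      (3, 3)], [2, 3]), 0, -1)]
    ] : Fin 6 → _) i := by
  decide +kernel

theorem hodComb_two_false : ∀ i, hodComb false 2 i = (![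
      [(([(0, 0), (1, 1)], [0, 1]), -1, -1), (([(0, 0), (1, 1)], [0, 1]), 0, 2), (([(0, 0), (1,
      1)], [0, 1]), 1, -1), (([(0, 0), (1, 1)], [2, 3]), 0, 1), (([(0, 0), (1, 1)], [2, 3]), -1,
      -1), (([(0, 0), (1, 1)], [2, 3]), 1, -1), (([(2, 2), (3, 3)], [2, 3]), 0, 1), (([(2, 2),
      (3, 2)], [2, 3]), -1, -1), (([(2, 2), (3, 2)], [2, 3]), 1, 1), (([(2, 2), (3, 2)], [0, 1]),
      1, 2), (([(2, 2), (3, 2)], [0, 1]), -1, -2), (([(2, 2), (3, 3)], [0, 1]), 0, 1)],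
      [(([(0, 0), (2, 3)], [0, 2]), -1, -1), (([(0, 0), (2, 2)], [0, 2]), -1, 1), (([(0, 0), (2,
      2)], [0, 2]), 0, 2), (([(0, 0), (2, 2)], [0, 3]), 0, 2), (([(0, 0), (2, 2)], [0, 3]), -1,
      -1), (([(0, 0), (2, 2)], [0, 2]), -2, -1)],
      [(([(0, 0), (3, 2)], [0, 2]), 2, 1), (([(0, 0), (3, 2)], [0, 3]), 2, 1), (([(0, 0), (3,
      3)], [0, 2]), 0, -1), (([(0, 0), (3, 2)], [0, 2]), 1, 1), (([(0, 0), (2, 2)], [0, 2]), 0,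
      -1), (([(0, 0), (2, 2)], [0, 2]), 2, 1), (([(0, 0), (2, 2)], [0, 3]), 2, 1), (([(0, 0), (2,
      2)], [0, 2]), -1, -1), (([(0, 0), (2, 2)], [0, 2]), 1, 1), (([(0, 0), (2, 2)], [0, 3]), 0,
      -1)],
      [(([(1, 1), (2, 3)], [1, 2]), 1, 1), (([(1, 1), (2, 2)], [1, 2]), 1, 1), (([(1, 1), (2,
      2)], [1, 2]), 0, 2), (([(1, 1), (2, 2)], [1, 3]), 1, 1), (([(1, 1), (2, 2)], [1, 3]), 0,
      -2), (([(1, 1), (2, 2)], [1, 2]), 2, -1)],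
      [(([(1, 1), (3, 2)], [1, 2]), -2, 1), (([(1, 1), (3, 2)], [1, 3]), -2, -1), (([(1, 1), (3,
      3)], [1, 2]), 0, 1), (([(1, 1), (3, 2)], [1, 2]), -1, 1), (([(1, 1), (2, 2)], [1, 2]), -2,
      -1), (([(1, 1), (2, 2)], [1, 2]), 0, 1), (([(1, 1), (2, 2)], [1, 3]), 0, -1), (([(1, 1),
      (2, 2)], [1, 3]), -2, 1), (([(1, 1), (2, 2)], [1, 2]), -1, -1), (([(1, 1), (2, 2)], [1,
      2]), 1, 1)],
      [(([(0, 0), (1, 1)], [2, 3]), 0, -4), (([(0, 0), (1, 1)], [2, 3]), -1, 3), (([(0, 0), (1,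
      1)], [0, 1]), 0, -6), (([(0, 0), (1, 1)], [0, 1]), -1, 4), (([(0, 0), (1, 1)], [0, 1]), -2,
      -1), (([(0, 0), (1, 1)], [2, 3]), 1, 3), (([(0, 0), (1, 1)], [0, 1]), 1, 4), (([(0, 0), (1,
      1)], [2, 3]), 2, -1), (([(0, 0), (1, 1)], [0, 1]), 2, -1), (([(0, 0), (1, 1)], [2, 3]), -2,
      -1), (([(2, 2), (3, 3)], [2, 3]), -1, 1), (([(2, 2), (3, 2)], [2, 3]), -2, -1), (([(2, 2),
      (3, 2)], [0, 1]), -1, 4), (([(2, 2), (3, 2)], [0, 1]), 1, -4), (([(2, 2), (3, 2)], [0, 1]),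
      -2, -2), (([(2, 2), (3, 3)], [0, 1]), -1, 1), (([(2, 2), (3, 3)], [2, 3]), 0, -1), (([(2,
      2), (3, 2)], [2, 3]), -1, 2), (([(2, 2), (3, 2)], [2, 3]), 1, -2), (([(2, 2), (3, 2)], [0,
      1]), 2, 2), (([(2, 2), (3, 3)], [0, 1]), 0, -1), (([(2, 2), (3, 3)], [2, 3]), 1, 1), (([(2,
      2), (3, 2)], [2, 3]), 2, 1), (([(2, 2), (3, 3)], [0, 1]), 1, 1), (([(2, 3), (3, 2)], [2,
      3]), 0, -1), (([(2, 3), (3, 2)], [0, 1]), 0, -1)]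
    ] : Fin 6 → _) i := by
  decide +kernel

theorem hodComb_three_true : ∀ i, hodComb true 3 i = (![
      [(([(0, 0), (1, 1), (2, 3)], [2]), 0, 1), (([(0, 0), (1, 1), (2, 3)], [2]), 1, -1), (([(0,
      0), (1, 1), (2, 2)], [3]), 0, 1), (([(0, 0), (1, 1), (2, 3)], [2]), -1, -1), (([(0, 0), (1,
      1), (2, 2)], [2]), 1, 1), (([(0, 0), (1, 1), (2, 2)], [2]), -1, -1), (([(2, 3), (2, 3), (3,
      2)], [2]), 0, 1)],
      [(([(2, 2), (3, 3), (3, 3)], [2]), 0, 1), (([(0, 0), (1, 1), (3, 3)], [2]), 0, 1), (([(0,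
      0), (1, 1), (3, 3)], [2]), 1, -1), (([(0, 0), (1, 1), (3, 2)], [3]), 0, 1), (([(0, 0), (1,
      1), (3, 3)], [2]), -1, -1), (([(0, 0), (1, 1), (2, 2)], [2]), -1, -2), (([(0, 0), (1, 1),
      (2, 2)], [2]), 0, -4), (([(0, 0), (1, 1), (2, 2)], [2]), 1, -2), (([(0, 0), (1, 1), (3,
      2)], [2]), 1, -1), (([(0, 0), (1, 1), (3, 2)], [2]), -1, 1)],
      [(([(0, 0), (2, 2), (3, 3)], [0]), 1, 1), (([(0, 0), (2, 3), (3, 2)], [0]), 1, -1)],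
      [(([(1, 1), (2, 2), (3, 3)], [1]), -1, -1), (([(1, 1), (2, 3), (3, 2)], [1]), -1, 1)]
    ] : Fin 4 → _) i := by
  decide +kernel

theorem hodComb_three_false : ∀ i, hodComb false 3 i = (![
      [(([(2, 2), (2, 3), (3, 2)], [3]), 0, 1), (([(2, 2), (2, 2), (3, 2)], [3]), -1, -1), (([(2,
      2), (2, 2), (3, 2)], [3]), 1, 1), (([(0, 0), (1, 1), (2, 2)], [3]), -1, 2), (([(0, 0), (1,
      1), (2, 2)], [3]), 0, -1), (([(0, 0), (1, 1), (2, 2)], [3]), 1, 2), (([(0, 0), (1, 1), (2,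
      3)], [2]), 0, -1), (([(0, 0), (1, 1), (2, 2)], [3]), -2, -1), (([(0, 0), (1, 1), (2, 2)],
      [3]), 2, -1)],
      [(([(0, 0), (1, 1), (3, 2)], [3]), 0, 1), (([(0, 0), (1, 1), (3, 3)], [2]), 0, -1), (([(0,
      0), (1, 1), (2, 2)], [3]), -2, -1), (([(0, 0), (1, 1), (2, 2)], [3]), 2, 1), (([(2, 2), (3,
      2), (3, 3)], [3]), 0, 1), (([(2, 2), (3, 2), (3, 2)], [3]), -1, -1), (([(2, 2), (3, 2), (3,
      2)], [3]), 1, 1)],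
      [(([(0, 0), (2, 3), (3, 2)], [0]), 1, -1), (([(0, 0), (2, 2), (3, 3)], [0]), 1, 1)],
      [(([(1, 1), (2, 3), (3, 2)], [1]), -1, 1), (([(1, 1), (2, 2), (3, 3)], [1]), -1, -1)]
    ] : Fin 4 → _) i := by
  decide +kernel

theorem hodComb_four (s : Bool) : ∀ i, hodComb s 4 i = (![
      [(([(0, 0), (1, 1), (2, 2), (3, 3)], []), 0, 1), (([(0, 0), (1, 1), (2, 3), (3, 2)], []),
      0, -1)]
    ] : Fin 1 → _) i := by
  revert s
  decide +kernel

/-- `Γ` is the `U(1)`-coinvariant contraction for which the conjugates of `Γ_{--}`, `Γ_{++}`,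
`Γ_{00}`, `Γ_{0z}`, `Γ_{z0}`, `Γ_{zz}` are `p, r, a, b, c, d`. The Hodge operator is a polynomial in
the conjugates, because of the conjugation at its end. -/
structure IsCoeff (Γ : Matrix (Fin 4) (Fin 4) ℂ) (p r a b c d : ℂ) : Prop where
  coinvariant : IsCoinvariant Γ
  hp : starRingEnd ℂ (Γ 0 0) = p
  hr : starRingEnd ℂ (Γ 1 1) = r
  ha : starRingEnd ℂ (Γ 2 2) = a
  hb : starRingEnd ℂ (Γ 2 3) = b
  hc : starRingEnd ℂ (Γ 3 2) = c
  hd : starRingEnd ℂ (Γ 3 3) = d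

/-- The matrix of `hod` is read off from the tables `hodComb`. -/
theorem hod_eq_sum {q : ℝ} (h0 : 0 < q) (s : Bool) (m : ℝ) {Γ : Matrix (Fin 4) (Fin 4) ℂ}
    (hΓ : IsCoinvariant Γ) {k j : ℕ} (h : k + j = 4) (x : Lam k) (l : Fin (dim j)) :
    hod q s m Γ h x l = ∑ i, x i * ((-(Complex.I * m) * (-1) ^ (j * (j - 1) / 2 + j)) *
      gamLam q Γ j (hodComb s k i) l) := by
  have : x = ∑ i, x i • Pi.single i (1 : ℂ) := by
    funext j
    simp [Finset.sum_apply, Pi.single_apply]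
  conv_lhs => rw [this]
  rw [map_sum, Finset.sum_apply]
  refine Finset.sum_congr rfl fun i _ => ?_
  rw [map_smul, hod_single h0 s m hΓ h]
  rfl

theorem hod_zero {q : ℝ} (h0 : 0 < q) (s : Bool) (m : ℝ) {Γ : Matrix (Fin 4) (Fin 4) ℂ}
    {p r a b c d : ℂ} (hΓ : IsCoeff Γ p r a b c d) (h : 0 + 4 = 4)
    (x : Lam 0) : hod q s m Γ h x = (-(Complex.I * m)) •
    (![-x 0] : Fin 1 → ℂ) := by
  have hg : ∀ l, _ := hod_eq_sum h0 s m hΓ.coinvariant h x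
  funext l
  rw [hg, sum_dim_zero]
  simp only [hodComb_zero, gamLam]
  fin_cases l
  simp [basisWord, -Int.reduceNeg]
  ring

theorem hod_one {q : ℝ} (h0 : 0 < q) (s : Bool) (m : ℝ) {Γ : Matrix (Fin 4) (Fin 4) ℂ}
    {p r a b c d : ℂ} (hΓ : IsCoeff Γ p r a b c d) (h : 1 + 3 = 4)
    (x : Lam 1) : hod q s m Γ h x = (-(Complex.I * m)) •
    (![-b * x 2 - d * x 3, a * x 2 + c * x 3, -p * x 0, r * x 1] : Fin 4 → ℂ) := by
  have hg : ∀ l, _ := hod_eq_sum h0 s m hΓ.coinvariant h x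
  funext l
  rw [hg, sum_dim_one]
  simp only [hodComb_one, gamLam]
  fin_cases l <;>
    simp [basisWord, hΓ.hp, hΓ.hr, hΓ.ha, hΓ.hb, hΓ.hc, hΓ.hd, -Int.reduceNeg] <;>
    ring

theorem hod_two_true {q : ℝ} (h0 : 0 < q) (m : ℝ) {Γ : Matrix (Fin 4) (Fin 4) ℂ}
    {p r a b c d t : ℂ} (hΓ : IsCoeff Γ p r a b c d) (ht : (q : ℂ) ^ 2 = t) (h : 2 + 2 = 4)
    (x : Lam 2) : hod q true m Γ h x = (-(Complex.I * m)) •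
    (![((t⁻¹ - 2 + t) * a * d - b * c + (-t⁻¹ ^ 2 + 3 * t⁻¹ - 4 + 3 * t - t ^ 2) * p * r) * x 0
      + ((-t⁻¹ + 1 - t) * a * d + (t⁻¹ - 1 + t) * b * c) * x 5, ((1 + t) * p * a + t ^ 2 * p * b)
      * x 1 + ((-t - t ^ 2) * p * b + (1 + t) * p * c + t * p * d) * x 2, -p * a * x 1 + ((t⁻¹ +
      1) * p * a - t⁻¹ * p * c) * x 2, ((t⁻¹ + 1) * r * a - t⁻¹ ^ 2 * r * b) * x 3 + ((-t⁻¹ ^ 2 -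
      t⁻¹) * r * b + (t⁻¹ + 1) * r * c - t⁻¹ * r * d) * x 4, r * a * x 3 + ((1 + t) * r * a + t *
      r * c) * x 4, (-a * d + (t⁻¹ - 1 + t) * p * r) * x 0 + (a * d - b * c) * x 5] :
      Fin 6 → ℂ) := by
  have hg : ∀ l, _ := hod_eq_sum h0 true m hΓ.coinvariant h x
  funext l
  rw [hg, sum_dim_two]
  simp only [hodComb_two_true, gamLam, ht]
  fin_cases l <;>
    simp [basisWord, hΓ.hp, hΓ.hr, hΓ.ha, hΓ.hb, hΓ.hc, hΓ.hd, -Int.reduceNeg] <;>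
    ring

theorem hod_two_false {q : ℝ} (h0 : 0 < q) (m : ℝ) {Γ : Matrix (Fin 4) (Fin 4) ℂ}
    {p r a b c d t : ℂ} (hΓ : IsCoeff Γ p r a b c d) (ht : (q : ℂ) ^ 2 = t) (h : 2 + 2 = 4)
    (x : Lam 2) : hod q false m Γ h x = (-(Complex.I * m)) •
    (![((2 * t⁻¹ - 2 * t) * a * c - a * d + (t⁻¹ - 2 + t) * p * r) * x 0 + ((2 * t⁻¹ ^ 2 - 4 *
      t⁻¹ + 4 * t - 2 * t ^ 2) * a * c + (-t⁻¹ + 1 - t) * a * d + b * c + (t⁻¹ ^ 2 - 4 * t⁻¹ + 6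
      - 4 * t + t ^ 2) * p * r) * x 5, ((t⁻¹ ^ 2 - t⁻¹ - 2) * p * a + t⁻¹ * p * b) * x 1 + ((t⁻¹
      + 1 - t - t ^ 2) * p * a + (-t - t ^ 2) * p * c + p * d) * x 2, (t⁻¹ - 2) * p * a * x 1 +
      ((1 - t ^ 2) * p * a - t ^ 2 * p * c) * x 2, ((-2 - t + t ^ 2) * r * a - t * r * b) * x 3 +
      ((t⁻¹ ^ 2 + t⁻¹ - 1 - t) * r * a + (-t⁻¹ ^ 2 - t⁻¹) * r * c - r * d) * x 4, (2 - t) * r * a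
      * x 3 + ((-t⁻¹ ^ 2 + 1) * r * a + t⁻¹ ^ 2 * r * c) * x 4, ((t⁻¹ - t) * a * c - a * d + (t⁻¹
      - 1 + t) * p * r) * x 0 + ((t⁻¹ ^ 2 - 2 * t⁻¹ + 2 * t - t ^ 2) * a * c + (-t⁻¹ + 1 - t) * a
      * d + b * c + (t⁻¹ ^ 2 - 3 * t⁻¹ + 4 - 3 * t + t ^ 2) * p * r) * x 5] : Fin 6 → ℂ) := by
  have hg : ∀ l, _ := hod_eq_sum h0 false m hΓ.coinvariant h x
  funext l
  rw [hg, sum_dim_two]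
  simp only [hodComb_two_false, gamLam, ht]
  fin_cases l <;>
    simp [basisWord, hΓ.hp, hΓ.hr, hΓ.ha, hΓ.hb, hΓ.hc, hΓ.hd, -Int.reduceNeg] <;>
    ring

theorem hod_three_true {q : ℝ} (h0 : 0 < q) (m : ℝ) {Γ : Matrix (Fin 4) (Fin 4) ℂ}
    {p r a b c d t : ℂ} (hΓ : IsCoeff Γ p r a b c d) (ht : (q : ℂ) ^ 2 = t) (h : 3 + 1 = 4)
    (x : Lam 3) : hod q true m Γ h x = (-(Complex.I * m)) •
    (![(-t * p * a * d + t * p * b * c) * x 2, (t⁻¹ * r * a * d - t⁻¹ * r * b * c) * x 3, (-b *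
      b * c + (t⁻¹ - t) * p * r * a + (t⁻¹ - 1 + t) * p * r * b) * x 0 + (-a * d * d + (2 * t⁻¹ +
      4 + 2 * t) * p * r * a + (-t⁻¹ + t) * p * r * c + (t⁻¹ - 1 + t) * p * r * d) * x 1, -p * r
      * a * x 0 - p * r * c * x 1] : Fin 4 → ℂ) := by
  have hg : ∀ l, _ := hod_eq_sum h0 true m hΓ.coinvariant h x
  funext l
  rw [hg, sum_dim_three]
  simp only [hodComb_three_true, gamLam, ht]
  fin_cases l <;>
    simp [basisWord, hΓ.hp, hΓ.hr, hΓ.ha, hΓ.hb, hΓ.hc, hΓ.hd, Fin.ext_iff,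
      -Int.reduceNeg] <;>
    ring

theorem hod_three_false {q : ℝ} (h0 : 0 < q) (m : ℝ) {Γ : Matrix (Fin 4) (Fin 4) ℂ}
    {p r a b c d t : ℂ} (hΓ : IsCoeff Γ p r a b c d) (ht : (q : ℂ) ^ 2 = t) (h : 3 + 1 = 4)
    (x : Lam 3) : hod q false m Γ h x = (-(Complex.I * m)) •
    (![(-t * p * a * d + t * p * b * c) * x 2, (t⁻¹ * r * a * d - t⁻¹ * r * b * c) * x 3, p * r
      * b * x 0 + p * r * d * x 1, ((t⁻¹ - t) * a * a * c - a * b * c + (t⁻¹ ^ 2 - 2 * t⁻¹ + 1 -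
      2 * t + t ^ 2) * p * r * a) * x 0 + ((t⁻¹ - t) * a * c * c - a * c * d + (t⁻¹ ^ 2 - t ^ 2)
      * p * r * a - p * r * c) * x 1] : Fin 4 → ℂ) := by
  have hg : ∀ l, _ := hod_eq_sum h0 false m hΓ.coinvariant h x
  funext l
  rw [hg, sum_dim_three]
  simp only [hodComb_three_false, gamLam, ht]
  fin_cases l <;>
    simp [basisWord, hΓ.hp, hΓ.hr, hΓ.ha, hΓ.hb, hΓ.hc, hΓ.hd, Fin.ext_iff,
      -Int.reduceNeg] <;>
    ring

theorem hod_four {q : ℝ} (h0 : 0 < q) (s : Bool) (m : ℝ) {Γ : Matrix (Fin 4) (Fin 4) ℂ}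
    {p r a b c d : ℂ} (hΓ : IsCoeff Γ p r a b c d) (h : 4 + 0 = 4)
    (x : Lam 4) : hod q s m Γ h x = (-(Complex.I * m)) •
    (![(p * r * a * d - p * r * b * c) * x 0] : Fin 1 → ℂ) := by
  have hg : ∀ l, _ := hod_eq_sum h0 s m hΓ.coinvariant h x
  funext l
  rw [hg, sum_dim_four]
  simp only [hodComb_four, gamLam]
  fin_cases l
  simp [basisWord, hΓ.hp, hΓ.hr, hΓ.ha, hΓ.hb, hΓ.hc, hΓ.hd, -Int.reduceNeg]
  ring

theorem hodgeLam_two_true {q : ℝ} (h0 : 0 < q) (m : ℝ) {Γ : Matrix (Fin 4) (Fin 4) ℂ}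
    {p r a b c d t : ℂ} (hΓ : IsCoeff Γ p r a b c d) (ht : (q : ℂ) ^ 2 = t) (h : 2 + 2 = 4)
    (x : Lam 2) : hodgeLam q true m Γ h x = (-(Complex.I * m)) •
    (![((-t⁻¹ ^ 2 + 3 * t⁻¹ - 4 + 3 * t - t ^ 2) * p * r - a * d + (t⁻¹ - 2 + t) * b * c) * x 0 +
      ((-t⁻¹ ^ 3 + 5 * t⁻¹ ^ 2 - 11 * t⁻¹ + 14 - 11 * t + 5 * t ^ 2 - t ^ 3) * p * r + (-2 * t⁻¹
      + 3 - 2 * t) * a * d + (t⁻¹ ^ 2 - 3 * t⁻¹ + 5 - 3 * t + t ^ 2) * b * c) * x 5, ((t⁻¹ + 1) *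
      p * a + t * p * b) * x 1 + ((1 + 2 * t + t ^ 2) * p * a + (t + t ^ 2) * p * c + t ^ 2 * p *
      d) * x 2, (-t⁻¹ * p * a) * x 1 + (-p * c) * x 2, ((1 + t) * r * a - t⁻¹ * r * b) * x 3 +
      ((-t⁻¹ ^ 2 - 2 * t⁻¹ - 1) * r * a + (t⁻¹ ^ 2 + t⁻¹) * r * c - t⁻¹ ^ 2 * r * d) * x 4, (t *
      r * a) * x 3 + (r * c) * x 4, ((t⁻¹ - 1 + t) * p * r - b * c) * x 0 + ((t⁻¹ ^ 2 - 3 * t⁻¹ +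
      4 - 3 * t + t ^ 2) * p * r + a * d + (-t⁻¹ + 1 - t) * b * c) * x 5] : Fin 6 → ℂ) := by
  have ht0 : t ≠ 0 := ht ▸ sq_ne_zero h0
  rw [hodgeLam_apply, opN_two, hod_two_true h0 m hΓ ht, Bool.not_true, opM_false_two h0 _ ht]
  congr 1
  funext l
  fin_cases l <;> simp <;> field_simp <;> ring

theorem hodgeLam_two_false {q : ℝ} (h0 : 0 < q) (m : ℝ) {Γ : Matrix (Fin 4) (Fin 4) ℂ}
    {p r a b c d t : ℂ} (hΓ : IsCoeff Γ p r a b c d) (ht : (q : ℂ) ^ 2 = t) (h : 2 + 2 = 4)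
    (x : Lam 2) : hodgeLam q false m Γ h x = (-(Complex.I * m)) •
    (![((t⁻¹ - 2 + t) * p * r + (2 * t⁻¹ - 2 * t) * a * c - b * c) * x 0 + (-a * d + b * c) * x 5,
      ((t⁻¹ - 1 - 2 * t) * p * a + p * b) * x 1 + ((t⁻¹ + 2 + t) * p * a + (-t⁻¹ - 1) * p * b +
      (-1 - t) * p * c + t⁻¹ * p * d) * x 2, ((1 - 2 * t) * p * a) * x 1 + ((1 + t) * p * a - t *
      p * c) * x 2, ((-2 * t⁻¹ - 1 + t) * r * a - r * b) * x 3 + ((-t⁻¹ - 2 - t) * r * a + (-1 -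
      t) * r * b + (-t⁻¹ - 1) * r * c - t * r * d) * x 4, ((2 * t⁻¹ - 1) * r * a) * x 3 + ((t⁻¹ +
      1) * r * a + t⁻¹ * r * c) * x 4, ((t⁻¹ - 1 + t) * p * r + (t⁻¹ - t) * a * c - b * c) * x 0
      + (-a * d + b * c) * x 5] : Fin 6 → ℂ) := by
  have ht0 : t ≠ 0 := ht ▸ sq_ne_zero h0
  rw [hodgeLam_apply, opN_two, hod_two_false h0 m hΓ ht, Bool.not_false, opM_true_two h0 _ ht]
  congr 1
  funext l
  fin_cases l <;> simp <;> field_simp <;> ring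

/-! ### Real and maximally hermitian contractions -/

theorem one_sub_sq_ne_zero {q : ℝ} (h0 : 0 < q) (h1 : q < 1) : 1 - (q : ℂ) ^ 2 ≠ 0 := by
  have : (1 - q ^ 2 : ℝ) ≠ 0 := by nlinarith
  exact_mod_cast this

/-- The value of the Hodge operator at the volume form is a multiple of the determinant of `Γ`. -/
theorem det_ne_zero {q : ℝ} (h0 : 0 < q) (s : Bool) {m : ℝ} {Γ : Matrix (Fin 4) (Fin 4) ℂ}
    {p r a b c d : ℂ} (hΓ : IsCoeff Γ p r a b c d)
    (H : hodgeLam q s m Γ (rfl : 4 + 0 = 4) (fun _ => Complex.I * m) ≠ 0) :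
    p * r * (a * d - b * c) ≠ 0 := by
  intro e
  refine H ?_
  have e' : p * r * a * d - p * r * b * c = 0 := by linear_combination e
  rw [hodgeLam_of_ne _ _ _ _ _ (by norm_num), hod_four h0 s m hΓ, e']
  simp

/-- The reality of the Hodge operator on the forms `ω_-` and `ω_0`. -/
theorem coeff_of_real {q : ℝ} (h0 : 0 < q) (s : Bool) {m : ℝ} (hm : m ≠ 0)
    {Γ : Matrix (Fin 4) (Fin 4) ℂ} {p r a b c d : ℂ} (hΓ : IsCoeff Γ p r a b c d)
    {t : ℂ} (ht : (q : ℂ) ^ 2 = t)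
    (H : ∀ x, hodgeLam q s m Γ (rfl : 1 + 3 = 4) (lamStar q 1 x) =
        lamStar q 3 (hodgeLam q s m Γ rfl x)) :
    r = t * starRingEnd ℂ p ∧ starRingEnd ℂ b = b := by
  have hμ : Complex.I * (m : ℂ) ≠ 0 := by simp [hm]
  have hc : starRingEnd ℂ (Complex.I * (m : ℂ)) = -(Complex.I * (m : ℂ)) := by simp
  simp only [hodgeLam_of_ne _ _ _ _ _ (by norm_num : 1 ≠ 2), hod_one h0 s m hΓ, lamStar_one,
    lamStar_three _ _ ht] at H
  generalize Complex.I * (m : ℂ) = μ at *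
  refine ⟨mul_left_cancel₀ hμ ?_, mul_left_cancel₀ hμ ?_⟩
  · have := congrFun (H ![1, 0, 0, 0]) (3 : Fin 4)
    simp [hc, -mul_eq_mul_left_iff] at this
    linear_combination this
  · have := congrFun (H ![0, 0, 1, 0]) (0 : Fin 4)
    simp [hc, -mul_eq_mul_left_iff, -neg_inj] at this
    linear_combination this

/-- Hermiticity for the sign `+`: the entries of `T² = -T²(1)` on one-forms. -/
theorem coeff_of_hermitian_true {q : ℝ} (h0 : 0 < q) {m : ℝ} (hm : m ≠ 0)
    {Γ : Matrix (Fin 4) (Fin 4) ℂ} {p r a b c d t : ℂ} (hΓ : IsCoeff Γ p r a b c d)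
    (ht : (q : ℂ) ^ 2 = t) (hD : p * r * (a * d - b * c) ≠ 0)
    (H : (∀ x, hodgeLam q true m Γ (rfl : 3 + 1 = 4) (hodgeLam q true m Γ (rfl : 1 + 3 = 4) x) =
      -(hodgeLam q true m Γ (rfl : 4 + 0 = 4) (hodgeLam q true m Γ (rfl : 0 + 4 = 4) fun _ => 1)
        (0 : Fin 1)) • x)) :
    r = t * p ∧ c = b ∧ ((2 * t⁻¹ + 4 + 2 * t) * p * r * a ^ 2 - (t⁻¹ - t) * p * r * a * (b + c) +
      (t⁻¹ - 1 + t) * p * r * (a * d - b * b) - a ^ 2 * d ^ 2 + b ^ 3 * c =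
        p * r * (a * d - b * c)) ∧
    (2 * t⁻¹ + 4 + 2 * t) * p * r * a * c - (t⁻¹ - t) * p * r * (a * d + c * c) +
      (t⁻¹ - 1 + t) * p * r * (c * d - b * d) - a * c * d ^ 2 + b ^ 2 * c * d = 0 := by
  have hμ : Complex.I * (m : ℂ) ≠ 0 := by simp [hm]
  have hμ2 : (Complex.I * (m : ℂ)) ^ 2 ≠ 0 := pow_ne_zero 2 hμ
  simp only [hodgeLam_of_ne _ _ _ _ _ (by norm_num : 1 ≠ 2),
    hodgeLam_of_ne _ _ _ _ _ (by norm_num : 3 ≠ 2), hodgeLam_of_ne _ _ _ _ _ (by norm_num : 4 ≠ 2),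
    hodgeLam_of_ne _ _ _ _ _ (by norm_num : 0 ≠ 2), hod_one h0 _ m hΓ, hod_zero h0 _ m hΓ,
    hod_four h0 _ m hΓ, hod_three_true h0 m hΓ ht] at H
  generalize Complex.I * (m : ℂ) = μ at *
  have e1 : t * p * p * (a * d - b * c) = p * r * (a * d - b * c) := by
    have := congrFun (H ![1, 0, 0, 0]) (0 : Fin 4)
    simp [-mul_eq_mul_left_iff, -mul_eq_zero, -neg_inj] at this
    refine mul_left_cancel₀ hμ2 ?_
    linear_combination this
  have e2 : p * r * a * (b - c) = 0 := by
    have := congrFun (H ![0, 0, 1, 0]) (3 : Fin 4)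
    simp [-mul_eq_mul_left_iff, -mul_eq_zero, -neg_inj] at this
    refine mul_left_cancel₀ hμ2 ?_
    linear_combination -this
  have e3 : p * r * (a * d - c * c) = p * r * (a * d - b * c) := by
    have := congrFun (H ![0, 0, 0, 1]) (3 : Fin 4)
    simp [-mul_eq_mul_left_iff, -mul_eq_zero, -neg_inj] at this
    refine mul_left_cancel₀ hμ2 ?_
    linear_combination this
  have e4 : (2 * t⁻¹ + 4 + 2 * t) * p * r * a ^ 2 - (t⁻¹ - t) * p * r * a * (b + c) +
      (t⁻¹ - 1 + t) * p * r * (a * d - b * b) - a ^ 2 * d ^ 2 + b ^ 3 * c =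
        p * r * (a * d - b * c) := by
    have := congrFun (H ![0, 0, 1, 0]) (2 : Fin 4)
    simp [-mul_eq_mul_left_iff, -mul_eq_zero, -neg_inj] at this
    refine mul_left_cancel₀ hμ2 ?_
    linear_combination this
  have e5 : (2 * t⁻¹ + 4 + 2 * t) * p * r * a * c - (t⁻¹ - t) * p * r * (a * d + c * c) +
      (t⁻¹ - 1 + t) * p * r * (c * d - b * d) - a * c * d ^ 2 + b ^ 2 * c * d = 0 := by
    have := congrFun (H ![0, 0, 0, 1]) (2 : Fin 4)
    simp [-mul_eq_mul_left_iff, -mul_eq_zero, -neg_inj] at this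
    refine mul_left_cancel₀ hμ2 ?_
    linear_combination -this
  have hp : p ≠ 0 := fun h => hD (by rw [h]; ring)
  have hr : r ≠ 0 := fun h => hD (by rw [h]; ring)
  have hΔ : a * d - b * c ≠ 0 := fun h => hD (by rw [h]; ring)
  refine ⟨?_, ?_, e4, e5⟩
  · refine mul_left_cancel₀ (mul_ne_zero hp hΔ) ?_
    linear_combination -e1
  · by_contra hbc
    have hbc' : b - c ≠ 0 := fun h => hbc (sub_eq_zero.1 h).symm
    have ha : a = 0 := by
      refine mul_left_cancel₀ (mul_ne_zero (mul_ne_zero hp hr) hbc') ?_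
      linear_combination e2
    have hc : c = 0 := by
      refine mul_left_cancel₀ (mul_ne_zero (mul_ne_zero hp hr) hbc') ?_
      linear_combination e3
    exact hΔ (by rw [ha, hc]; ring)

/-- Hermiticity for the sign `-`: the entries of `T² = -T²(1)` on one-forms. -/
theorem coeff_of_hermitian_false {q : ℝ} (h0 : 0 < q) {m : ℝ} (hm : m ≠ 0)
    {Γ : Matrix (Fin 4) (Fin 4) ℂ} {p r a b c d t : ℂ} (hΓ : IsCoeff Γ p r a b c d)
    (ht : (q : ℂ) ^ 2 = t) (hD : p * r * (a * d - b * c) ≠ 0)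
    (H : (∀ x, hodgeLam q false m Γ (rfl : 3 + 1 = 4) (hodgeLam q false m Γ (rfl : 1 + 3 = 4) x) =
      -(hodgeLam q false m Γ (rfl : 4 + 0 = 4) (hodgeLam q false m Γ (rfl : 0 + 4 = 4) fun _ => 1)
        (0 : Fin 1)) • x)) :
    r = t * p ∧ c = b ∧ ((t⁻¹ ^ 2 - t ^ 2) * p * r * a ^ 2 -
      (t⁻¹ ^ 2 - 2 * t⁻¹ + 1 - 2 * t + t ^ 2) * p * r * a * b - p * r * a * c -
      (t⁻¹ - t) * a ^ 2 * (b * c - c ^ 2) - a ^ 2 * c * d + a * b ^ 2 * c = 0) ∧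
    (t⁻¹ ^ 2 - t ^ 2) * p * r * a * c - (t⁻¹ ^ 2 - 2 * t⁻¹ + 1 - 2 * t + t ^ 2) * p * r * a * d -
      p * r * c * c - (t⁻¹ - t) * (a ^ 2 * c * d - a * c ^ 3) + a * b * c * d - a * c ^ 2 * d =
      p * r * (a * d - b * c) := by
  have hμ : Complex.I * (m : ℂ) ≠ 0 := by simp [hm]
  have hμ2 : (Complex.I * (m : ℂ)) ^ 2 ≠ 0 := pow_ne_zero 2 hμ
  simp only [hodgeLam_of_ne _ _ _ _ _ (by norm_num : 1 ≠ 2),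
    hodgeLam_of_ne _ _ _ _ _ (by norm_num : 3 ≠ 2), hodgeLam_of_ne _ _ _ _ _ (by norm_num : 4 ≠ 2),
    hodgeLam_of_ne _ _ _ _ _ (by norm_num : 0 ≠ 2), hod_one h0 _ m hΓ, hod_zero h0 _ m hΓ,
    hod_four h0 _ m hΓ, hod_three_false h0 m hΓ ht] at H
  generalize Complex.I * (m : ℂ) = μ at *
  have e1 : t * p * p * (a * d - b * c) = p * r * (a * d - b * c) := by
    have := congrFun (H ![1, 0, 0, 0]) (0 : Fin 4)
    simp [-mul_eq_mul_left_iff, -mul_eq_zero, -neg_inj] at this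
    refine mul_left_cancel₀ hμ2 ?_
    linear_combination this
  have e2 : p * r * (a * d - b * b) = p * r * (a * d - b * c) := by
    have := congrFun (H ![0, 0, 1, 0]) (2 : Fin 4)
    simp [-mul_eq_mul_left_iff, -mul_eq_zero, -neg_inj] at this
    refine mul_left_cancel₀ hμ2 ?_
    linear_combination this
  have e3 : p * r * d * (c - b) = 0 := by
    have := congrFun (H ![0, 0, 0, 1]) (2 : Fin 4)
    simp [-mul_eq_mul_left_iff, -mul_eq_zero, -neg_inj] at this
    refine mul_left_cancel₀ hμ2 ?_
    linear_combination -this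
  have e4 : (t⁻¹ ^ 2 - t ^ 2) * p * r * a ^ 2 -
      (t⁻¹ ^ 2 - 2 * t⁻¹ + 1 - 2 * t + t ^ 2) * p * r * a * b - p * r * a * c -
      (t⁻¹ - t) * a ^ 2 * (b * c - c ^ 2) - a ^ 2 * c * d + a * b ^ 2 * c = 0 := by
    have := congrFun (H ![0, 0, 1, 0]) (3 : Fin 4)
    simp [-mul_eq_mul_left_iff, -mul_eq_zero, -neg_inj] at this
    refine mul_left_cancel₀ hμ2 ?_
    linear_combination -this
  have e5 : (t⁻¹ ^ 2 - t ^ 2) * p * r * a * c -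
      (t⁻¹ ^ 2 - 2 * t⁻¹ + 1 - 2 * t + t ^ 2) * p * r * a * d - p * r * c * c -
      (t⁻¹ - t) * (a ^ 2 * c * d - a * c ^ 3) + a * b * c * d - a * c ^ 2 * d =
      p * r * (a * d - b * c) := by
    have := congrFun (H ![0, 0, 0, 1]) (3 : Fin 4)
    simp [-mul_eq_mul_left_iff, -mul_eq_zero, -neg_inj] at this
    refine mul_left_cancel₀ hμ2 ?_
    linear_combination this
  have hp : p ≠ 0 := fun h => hD (by rw [h]; ring)
  have hr : r ≠ 0 := fun h => hD (by rw [h]; ring)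
  have hΔ : a * d - b * c ≠ 0 := fun h => hD (by rw [h]; ring)
  refine ⟨?_, ?_, e4, e5⟩
  · refine mul_left_cancel₀ (mul_ne_zero hp hΔ) ?_
    linear_combination -e1
  · by_contra hbc
    have hbc' : c - b ≠ 0 := fun h => hbc (sub_eq_zero.1 h)
    have hd : d = 0 := by
      refine mul_left_cancel₀ (mul_ne_zero (mul_ne_zero hp hr) hbc') ?_
      linear_combination e3
    have hb : b = 0 := by
      refine mul_left_cancel₀ (mul_ne_zero (mul_ne_zero hp hr) hbc') ?_
      linear_combination e2
    exact hΔ (by rw [hd, hb]; ring)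

/-- Maximality for the sign `+`: off-diagonal entries of `T²` at an eigenvector of `A^{(2)}_+` for
each of the two eigenvalues `1 + t` and `1 + t⁻¹`. -/
theorem coeff_of_maximal_true {q : ℝ} (h0 : 0 < q) {m : ℝ} (hm : m ≠ 0)
    {Γ : Matrix (Fin 4) (Fin 4) ℂ} {p a b d t : ℂ} (hΓ : IsCoeff Γ p (t * p) a b b d)
    (ht : (q : ℂ) ^ 2 = t) (hp : p ≠ 0)
    (H : ∀ l : ℂ, ∃ k : ℂ, ∀ x : Lam 2, opM q true 2 x = l • x →
      hodgeLam q true m Γ (rfl : 2 + 2 = 4) (hodgeLam q true m Γ (rfl : 2 + 2 = 4) x) = k • x) :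
    a * ((1 + t) * a - t * (1 - t) * b) = 0 ∧ a * (t * (1 + t) * a - (1 - t) * b) = 0 := by
  have hμ : Complex.I * (m : ℂ) ≠ 0 := by simp [hm]
  have ht0 : t ≠ 0 := ht ▸ sq_ne_zero h0
  obtain ⟨kV, Hv⟩ := H (1 + t)
  obtain ⟨kW, Hw⟩ := H (1 + t⁻¹)
  have hv1 := Hv ![0, 1, 0, 0, 0, 0] (by
    rw [opM_true_two h0 _ ht]
    funext i
    fin_cases i <;> simp)
  have hw2 := Hw ![0, 0, 0, 1, 0, 0] (by
    rw [opM_true_two h0 _ ht]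
    funext i
    fin_cases i <;> simp)
  simp only [hodgeLam_two_true h0 m hΓ ht] at hv1 hw2
  generalize Complex.I * (m : ℂ) = μ at *
  have hK : (μ * p) ^ 2 ≠ 0 := pow_ne_zero 2 (mul_ne_zero hμ hp)
  refine ⟨mul_left_cancel₀ hK ?_, mul_left_cancel₀ hK ?_⟩
  · have := congrFun hv1 (2 : Fin 6)
    simp [-mul_eq_mul_left_iff, -mul_eq_zero, -neg_inj] at this
    linear_combination (norm := (field_simp; ring)) t ^ 2 * this
  · have := congrFun hw2 (4 : Fin 6)
    simp [-mul_eq_mul_left_iff, -mul_eq_zero, -neg_inj] at this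
    linear_combination (norm := (field_simp; ring)) -t⁻¹ ^ 2 * this

/-- Maximality for the sign `-`: off-diagonal entries of `T²` at eigenvectors of `A^{(2)}_-` and, if
`a = 0`, the equality of the diagonal entries at two eigenvectors for the same eigenvalue. -/
theorem coeff_of_maximal_false {q : ℝ} (h0 : 0 < q) (h1 : q < 1) {m : ℝ} (hm : m ≠ 0)
    {Γ : Matrix (Fin 4) (Fin 4) ℂ} {p a b d t : ℂ} (hΓ : IsCoeff Γ p (t * p) a b b d)
    (ht : (q : ℂ) ^ 2 = t) (hp : p ≠ 0)
    (H : ∀ l : ℂ, ∃ k : ℂ, ∀ x : Lam 2, opM q false 2 x = l • x →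
      hodgeLam q false m Γ (rfl : 2 + 2 = 4) (hodgeLam q false m Γ (rfl : 2 + 2 = 4) x) = k • x) :
    a * (1 - 2 * t) * ((1 + t) * a + t * b) = 0 ∧ a * (2 - t) * (b - (1 + t) * a) = 0 ∧
      (a = 0 → b ≠ 0 → b * (1 + t) = d * (1 - t) ∧ b ^ 2 = p ^ 2 * (1 - t) ^ 2) := by
  have hμ : Complex.I * (m : ℂ) ≠ 0 := by simp [hm]
  have ht0 : t ≠ 0 := ht ▸ sq_ne_zero h0
  obtain ⟨kV, Hv⟩ := H (1 + t⁻¹)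
  obtain ⟨kW, Hw⟩ := H (1 + t)
  have hv1 := Hv ![0, 1, 0, 0, 0, 0] (by
    rw [opM_false_two h0 _ ht]
    funext i
    fin_cases i <;> simp)
  have hv3 := Hv ![1 - t, 0, 0, 0, 0, 1] (by
    rw [opM_false_two h0 _ ht]
    funext i
    fin_cases i <;> simp <;> field_simp <;> ring)
  have hw1 := Hw ![0, t, t - 1, 0, 0, 0] (by
    rw [opM_false_two h0 _ ht]
    funext i
    fin_cases i <;> simp <;> field_simp <;> ring)
  have hw2 := Hw ![0, 0, 0, 1, 0, 0] (by
    rw [opM_false_two h0 _ ht]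
    funext i
    fin_cases i <;> simp)
  simp only [hodgeLam_two_false h0 m hΓ ht] at hv1 hv3 hw1 hw2
  generalize Complex.I * (m : ℂ) = μ at *
  have ht1 : 1 - t ≠ 0 := ht ▸ one_sub_sq_ne_zero h0 h1
  have ht2 : 1 - t + t ^ 2 ≠ 0 := by
    have : (1 - q ^ 2 + (q ^ 2) ^ 2 : ℝ) ≠ 0 := by nlinarith [sq_nonneg (q ^ 2)]
    rw [← ht]
    exact_mod_cast this
  have hK : (μ * p) ^ 2 * (1 - t) ≠ 0 := mul_ne_zero (pow_ne_zero 2 (mul_ne_zero hμ hp)) ht1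
  refine ⟨mul_left_cancel₀ hK ?_, mul_left_cancel₀ hK ?_, ?_⟩
  · have := congrFun hv1 (2 : Fin 6)
    simp [-mul_eq_mul_left_iff, -mul_eq_zero, -neg_inj] at this
    linear_combination (norm := (field_simp; ring)) -t * this
  · have := congrFun hw2 (4 : Fin 6)
    simp [-mul_eq_mul_left_iff, -mul_eq_zero, -neg_inj] at this
    linear_combination (norm := (field_simp; ring)) -this
  · rintro rfl hb
    have e1 := congrFun hv1 (1 : Fin 6)
    have e2 := congrFun hw2 (3 : Fin 6)
    have e3 := congrFun hw1 (1 : Fin 6)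
    have e4 := congrFun hv3 (5 : Fin 6)
    simp [-mul_eq_mul_left_iff, -mul_eq_zero, -neg_inj] at e1 e2 e3 e4
    -- `e1`, `e2` give the scalars of `T²` on the two eigenspaces, `e3`, `e4` compare them with the
    -- entries at a second eigenvector in each of them
    have hV : kV = μ ^ 2 * p ^ 2 * b ^ 2 := by linear_combination -e1
    have hW : kW = μ ^ 2 * t ^ 2 * p ^ 2 * b ^ 2 := by linear_combination -e2
    constructor
    · refine mul_left_cancel₀ (mul_ne_zero hK hb) ?_
      linear_combination (norm := (field_simp; ring)) t * e3 + t ^ 2 * hW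
    · refine mul_left_cancel₀ (mul_ne_zero hK ht2) ?_
      linear_combination (norm := (field_simp; ring)) -e4 - hV

/-- The explicit family of the real and maximally hermitian contractions: `Γ_{--} = p`, `Γ_{++} = q²
p`, `Γ_{00} = 0`, `Γ_{0z} = Γ_{z0} = β (1 - q²)`, `Γ_{zz} = β (1 + q²)` with `p ≠ 0` real and `β =
±p`, all other coefficients being `0`. -/
def IsSolution (q : ℝ) (Γ : Matrix (Fin 4) (Fin 4) ℂ) : Prop :=
  ∃ p β : ℝ, p ≠ 0 ∧ (β = p ∨ β = -p) ∧
    IsCoeff Γ p ((q : ℂ) ^ 2 * p) 0 (β * (1 - (q : ℂ) ^ 2)) (β * (1 - (q : ℂ) ^ 2))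
      (β * (1 + (q : ℂ) ^ 2))

/-- The classification of the real and maximally hermitian contractions. Hermiticity and reality
give `r = q² p`, `c = b` and that `p` and `b` are real; the off-diagonal entries in degree `2` give
`a = 0`; the remaining equations fix `b²` and `b d`. -/
theorem isSolution_of_real_of_hermitian_of_maximal {q : ℝ} (h0 : 0 < q) (h1 : q < 1)
    (s : Bool) {m : ℝ} (hm : m ≠ 0) {Γ : Matrix (Fin 4) (Fin 4) ℂ} (hΓ : IsCoinvariant Γ)
    (H1 : hodgeLam q s m Γ (rfl : 4 + 0 = 4) (fun _ => Complex.I * m) ≠ 0)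
    (H2 : ∀ x, hodgeLam q s m Γ (rfl : 1 + 3 = 4) (lamStar q 1 x) =
      lamStar q 3 (hodgeLam q s m Γ rfl x))
    (H3 : ∀ x, hodgeLam q s m Γ (rfl : 3 + 1 = 4) (hodgeLam q s m Γ (rfl : 1 + 3 = 4) x) =
      -(hodgeLam q s m Γ (rfl : 4 + 0 = 4) (hodgeLam q s m Γ (rfl : 0 + 4 = 4) fun _ => 1)
        (0 : Fin 1)) • x)
    (H4 : ∀ l : ℂ, ∃ k : ℂ, ∀ x : Lam 2, opM q s 2 x = l • x →
      hodgeLam q s m Γ (rfl : 2 + 2 = 4) (hodgeLam q s m Γ (rfl : 2 + 2 = 4) x) = k • x) :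
    IsSolution q Γ := by
  obtain ⟨p, r, a, b, c, d, h⟩ : ∃ p r a b c d, IsCoeff Γ p r a b c d :=
    ⟨_, _, _, _, _, _, hΓ, rfl, rfl, rfl, rfl, rfl, rfl⟩
  obtain ⟨t, ht⟩ : ∃ t, (q : ℂ) ^ 2 = t := ⟨_, rfl⟩
  have ht0 : t ≠ 0 := ht ▸ sq_ne_zero h0
  have ht1 : 1 - t ≠ 0 := ht ▸ one_sub_sq_ne_zero h0 h1
  have ht2 : 1 + t ≠ 0 := ht ▸ one_add_sq_ne_zero q
  have hD := det_ne_zero h0 s h H1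
  obtain ⟨hr, hb⟩ := coeff_of_real h0 s hm h ht H2
  have hp : p ≠ 0 := fun e => hD (by rw [e]; ring)
  have key : r = t * p ∧ c = b ∧ a = 0 ∧ b * (1 + t) = d * (1 - t) ∧
      b ^ 2 = p ^ 2 * (1 - t) ^ 2 := by
    cases s
    -- here the two maximality conditions leave `a ≠ 0` possible only for `q² = 1/2`
    · obtain ⟨hr1, hc, e4, e5⟩ := coeff_of_hermitian_false h0 hm h ht hD H3
      subst c
      subst hr1
      obtain ⟨m1, m2, m3⟩ := coeff_of_maximal_false h0 h1 hm h ht hp H4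
      have hΔ : a * d - b * b ≠ 0 := fun e => hD (by rw [e, mul_zero])
      have ha : a = 0 := by
        by_contra ha
        have h2 : 2 - t ≠ 0 := by
          have : (2 - q ^ 2 : ℝ) ≠ 0 := by nlinarith
          rw [← ht]
          exact_mod_cast this
        have hb : b = (1 + t) * a :=
          sub_eq_zero.1 ((mul_eq_zero.1 m2).resolve_left (mul_ne_zero ha h2))
        have ht' : t = 1 / 2 := by
          have : a ^ 2 * (1 + t) ^ 2 * (1 - 2 * t) = 0 := by
            rw [hb] at m1
            linear_combination m1
          have := (mul_eq_zero.1 this).resolve_left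
            (mul_ne_zero (pow_ne_zero 2 ha) (pow_ne_zero 2 ht2))
          linear_combination (-1 / 2 : ℂ) * this
        -- for `q² = 1/2` hermiticity forces the determinant of the block `a, b, c, d` to vanish
        subst ht'
        norm_num at hb
        subst hb
        norm_num at e4 e5 hD hΔ
        have hA : a * d - 9 / 4 * a ^ 2 = 5 / 8 * p ^ 2 := by
          refine mul_left_cancel₀ (pow_ne_zero 2 ha) ?_
          linear_combination (-2 / 3 : ℂ) * e4
        refine hΔ (mul_left_cancel₀ (pow_ne_zero 2 hp) ?_)
        linear_combination (-8 / 5 : ℂ) * e5 - 18 / 5 * a ^ 2 * hA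
      subst a
      have hb0 : b ≠ 0 := fun e => hΔ (by rw [e]; ring)
      exact ⟨rfl, rfl, rfl, m3 rfl hb0⟩
    · obtain ⟨hr1, hc, e4, e5⟩ := coeff_of_hermitian_true h0 hm h ht hD H3
      subst c
      subst hr1
      obtain ⟨m1, m2⟩ := coeff_of_maximal_true h0 hm h ht hp H4
      have ha : a = 0 := by
        by_contra ha
        have e1 := (mul_eq_zero.1 m1).resolve_left ha
        have e2 := (mul_eq_zero.1 m2).resolve_left ha
        have : (1 + t) ^ 2 * (1 - t) * a = 0 := by linear_combination e1 - t * e2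
        exact ha ((mul_eq_zero.1 this).resolve_left (mul_ne_zero (pow_ne_zero 2 ht2) ht1))
      subst a
      have hb0 : b ≠ 0 := fun e => hD (by rw [e]; ring)
      have e6 : b ^ 2 = p ^ 2 * (1 - t) ^ 2 := by
        refine mul_left_cancel₀ (pow_ne_zero 2 hb0) ?_
        linear_combination (norm := (field_simp; ring)) e4
      have e7 : b * d = p ^ 2 * (1 - t ^ 2) := by
        refine mul_left_cancel₀ (pow_ne_zero 2 hb0) ?_
        linear_combination (norm := (field_simp; ring)) e5
      refine ⟨rfl, rfl, rfl, mul_left_cancel₀ hb0 ?_, e6⟩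
      linear_combination (1 + t) * e6 - (1 - t) * e7
  obtain ⟨hr', rfl, rfl, h3, h4⟩ := key
  have hp' : starRingEnd ℂ p = p := mul_left_cancel₀ ht0 (hr.symm.trans hr')
  obtain ⟨P, rfl⟩ := Complex.conj_eq_iff_real.1 hp'
  obtain ⟨B, rfl⟩ := Complex.conj_eq_iff_real.1 hb
  have hq1 : (1 - q ^ 2 : ℝ) ≠ 0 := by nlinarith
  subst hr' ht
  have e1 : ((B / (1 - q ^ 2) : ℝ) : ℂ) * (1 - (q : ℂ) ^ 2) = B := by
    push_cast
    exact div_mul_cancel₀ _ ht1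
  have e2 : ((B / (1 - q ^ 2) : ℝ) : ℂ) * (1 + (q : ℂ) ^ 2) = d := by
    refine mul_right_cancel₀ ht1 ?_
    rw [mul_right_comm, e1, h3]
  refine ⟨P, B / (1 - q ^ 2), by exact_mod_cast hp, ?_, ?_⟩
  · rw [← sq_eq_sq_iff_eq_or_eq_neg, div_pow, div_eq_iff (pow_ne_zero 2 hq1)]
    exact_mod_cast h4
  · rw [e1, e2]
    exact h

/-! ### The Hodge operators of the real and maximally hermitian contractions

In the calls of `simp` in this part the lemmas that cancel a common factor or sign of the two sides
are switched off: they would turn the polynomial identities into disjunctions. -/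

theorem hodgeLam_two_true_of_solution {q : ℝ} (h0 : 0 < q) (m : ℝ)
    {Γ : Matrix (Fin 4) (Fin 4) ℂ} {p β t : ℂ}
    (hβ : β = p ∨ β = -p) (hΓ : IsCoeff Γ p (t * p) 0 (β * (1 - t)) (β * (1 - t)) (β * (1 + t)))
    (ht : (q : ℂ) ^ 2 = t) (h : 2 + 2 = 4)
    (x : Lam 2) : hodgeLam q true m Γ h x = (-(Complex.I * m)) •
    (![p ^ 2 * (1 - t) ^ 2 * (x 5 - x 0), p * β * t * ((1 - t) * x 1 + (1 + t) * x 2),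
      -p * β * (1 - t) * x 2, -p * β * ((1 - t) * x 3 + (1 + t) * x 4), p * β * t * (1 - t) * x 4,
      t * p ^ 2 * x 0] : Fin 6 → ℂ) := by
  have ht0 : t ≠ 0 := ht ▸ sq_ne_zero h0
  rw [hodgeLam_two_true h0 m hΓ ht]
  congr 1
  funext l
  rcases hβ with rfl | rfl <;> fin_cases l <;>
    simp [-mul_eq_mul_left_iff, -mul_eq_mul_right_iff, -mul_eq_zero, -Matrix.cons_sub,
      -neg_inj] <;>
    field_simp <;> ring

theorem hodgeLam_two_false_of_solution {q : ℝ} (h0 : 0 < q) (m : ℝ)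
    {Γ : Matrix (Fin 4) (Fin 4) ℂ} {p β t : ℂ}
    (hβ : β = p ∨ β = -p) (hΓ : IsCoeff Γ p (t * p) 0 (β * (1 - t)) (β * (1 - t)) (β * (1 + t)))
    (ht : (q : ℂ) ^ 2 = t) (h : 2 + 2 = 4)
    (x : Lam 2) : hodgeLam q false m Γ h x = (-(Complex.I * m)) •
    (![p ^ 2 * (1 - t) ^ 2 * x 5, p * β * ((1 - t) * x 1 + t * (1 + t) * x 2),
      -p * β * t * (1 - t) * x 2, -p * β * (t * (1 - t) * x 3 + (1 + t) * x 4),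
      p * β * (1 - t) * x 4, p ^ 2 * (t * x 0 + (1 - t) ^ 2 * x 5)] : Fin 6 → ℂ) := by
  have ht0 : t ≠ 0 := ht ▸ sq_ne_zero h0
  rw [hodgeLam_two_false h0 m hΓ ht]
  congr 1
  funext l
  rcases hβ with rfl | rfl <;> fin_cases l <;>
    simp [-mul_eq_mul_left_iff, -mul_eq_mul_right_iff, -mul_eq_zero, -Matrix.cons_sub,
      -neg_inj] <;>
    field_simp <;> ring

theorem hodgeLam_three_of_solution {q : ℝ} (h0 : 0 < q) (s : Bool) (m : ℝ)
    {Γ : Matrix (Fin 4) (Fin 4) ℂ} {p β t : ℂ}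
    (hβ : β = p ∨ β = -p) (hΓ : IsCoeff Γ p (t * p) 0 (β * (1 - t)) (β * (1 - t)) (β * (1 + t)))
    (ht : (q : ℂ) ^ 2 = t) (h : 3 + 1 = 4)
    (x : Lam 3) : hodgeLam q s m Γ h x = (-(Complex.I * m)) •
    (![t * (1 - t) ^ 2 * p ^ 3 * x 2, -(1 - t) ^ 2 * p ^ 3 * x 3,
      t * p ^ 2 * β * ((1 - t) * x 0 + (1 + t) * x 1), -t * p ^ 2 * β * (1 - t) * x 1] :
      Fin 4 → ℂ) := by
  have ht0 : t ≠ 0 := ht ▸ sq_ne_zero h0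
  rw [hodgeLam_of_ne _ _ _ _ _ (by norm_num)]
  cases s
  · rw [hod_three_false h0 m hΓ ht]
    congr 1
    funext l
    rcases hβ with rfl | rfl <;> fin_cases l <;>
      simp [-mul_eq_mul_left_iff, -mul_eq_mul_right_iff, -mul_eq_zero, -Matrix.cons_sub,
        -neg_inj] <;>
      field_simp <;> ring
  · rw [hod_three_true h0 m hΓ ht]
    congr 1
    funext l
    rcases hβ with rfl | rfl <;> fin_cases l <;>
      simp [-mul_eq_mul_left_iff, -mul_eq_mul_right_iff, -mul_eq_zero, -Matrix.cons_sub,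
        -neg_inj] <;>
      field_simp <;> ring

/-- Away from degree `2` the Hodge operators for the two signs coincide, and their square is a
multiple of the identity. -/
theorem hodgeLam_hodgeLam_of_ne {q : ℝ} (h0 : 0 < q) (s : Bool) (m : ℝ)
    {Γ : Matrix (Fin 4) (Fin 4) ℂ} {p β t : ℂ}
    (hβ : β = p ∨ β = -p) (hΓ : IsCoeff Γ p (t * p) 0 (β * (1 - t)) (β * (1 - t)) (β * (1 + t)))
    (ht : (q : ℂ) ^ 2 = t) (s' : Bool) {k j : ℕ}
    (h : k + j = 4) (h' : j + k = 4) (hk : k ≠ 2) (x : Lam k) :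
    hodgeLam q s m Γ h' (hodgeLam q s' m Γ h x) =
      ((-1) ^ (k * j) * (m ^ 2 * (-t * (1 - t) ^ 2 * p ^ 4))) • x := by
  have hm : (m : ℂ) ^ 2 = -(-(Complex.I * m)) ^ 2 := by
    linear_combination (m : ℂ) ^ 2 * Complex.I_sq
  have hk4 : k ≤ 4 := by omega
  interval_cases k
  · obtain rfl : j = 4 := by omega
    simp only [hodgeLam_of_ne _ _ _ _ _ (by norm_num : 0 ≠ 2),
      hodgeLam_of_ne _ _ _ _ _ (by norm_num : 4 ≠ 2), hod_zero h0 _ m hΓ, hod_four h0 _ m hΓ]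
    rw [hm]
    generalize -(Complex.I * (m : ℂ)) = μ
    funext l
    rcases hβ with rfl | rfl <;> fin_cases l <;>
      simp [-mul_eq_mul_left_iff, -mul_eq_mul_right_iff, -mul_eq_zero, -Matrix.cons_sub,
        -neg_inj] <;>
      field_simp
  · obtain rfl : j = 3 := by omega
    simp only [hodgeLam_of_ne _ _ _ _ _ (by norm_num : 1 ≠ 2), hod_one h0 _ m hΓ,
      hodgeLam_three_of_solution h0 _ m hβ hΓ ht]
    rw [hm]
    generalize -(Complex.I * (m : ℂ)) = μ
    funext l
    rcases hβ with rfl | rfl <;> fin_cases l <;>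
      simp [-mul_eq_mul_left_iff, -mul_eq_mul_right_iff, -mul_eq_zero, -Matrix.cons_sub,
        -neg_inj] <;>
      field_simp <;> ring
  · exact absurd rfl hk
  · obtain rfl : j = 1 := by omega
    simp only [hodgeLam_of_ne _ _ _ _ _ (by norm_num : 1 ≠ 2), hod_one h0 _ m hΓ,
      hodgeLam_three_of_solution h0 _ m hβ hΓ ht]
    rw [hm]
    generalize -(Complex.I * (m : ℂ)) = μ
    funext l
    rcases hβ with rfl | rfl <;> fin_cases l <;>
      simp [-mul_eq_mul_left_iff, -mul_eq_mul_right_iff, -mul_eq_zero, -Matrix.cons_sub,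
        -neg_inj] <;>
      field_simp <;> ring
  · obtain rfl : j = 0 := by omega
    simp only [hodgeLam_of_ne _ _ _ _ _ (by norm_num : 0 ≠ 2),
      hodgeLam_of_ne _ _ _ _ _ (by norm_num : 4 ≠ 2), hod_zero h0 _ m hΓ, hod_four h0 _ m hΓ]
    rw [hm]
    generalize -(Complex.I * (m : ℂ)) = μ
    funext l
    rcases hβ with rfl | rfl <;> fin_cases l <;>
      simp [-mul_eq_mul_left_iff, -mul_eq_mul_right_iff, -mul_eq_zero, -Matrix.cons_sub,
        -neg_inj] <;>
      field_simp

/-- In degree `2` the square of the Hodge operator is a multiple of the operator `opN` for the other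
sign, which is a scalar on each eigenspace of the antisymmetriser. -/
theorem hodgeLam_two_sq {q : ℝ} (h0 : 0 < q) (s : Bool) (m : ℝ)
    {Γ : Matrix (Fin 4) (Fin 4) ℂ} {p β t : ℂ}
    (hβ : β = p ∨ β = -p) (hΓ : IsCoeff Γ p (t * p) 0 (β * (1 - t)) (β * (1 - t)) (β * (1 + t)))
    (ht : (q : ℂ) ^ 2 = t) (h h' : 2 + 2 = 4)
    (x : Lam 2) : hodgeLam q s m Γ h' (hodgeLam q s m Γ h x) =
      (m ^ 2 * (-t * (1 - t) ^ 2 * p ^ 4)) • opN q (!s) 2 x := by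
  have hm : (m : ℂ) ^ 2 = -(-(Complex.I * m)) ^ 2 := by
    linear_combination (m : ℂ) ^ 2 * Complex.I_sq
  have ht0 : t ≠ 0 := ht ▸ sq_ne_zero h0
  rw [opN_two]
  cases s
  · simp only [hodgeLam_two_false_of_solution h0 m hβ hΓ ht, Bool.not_false, Bool.not_true,
      opM_false_two h0 _ ht]
    rw [hm]
    generalize -(Complex.I * (m : ℂ)) = μ
    funext l
    rcases hβ with rfl | rfl <;> fin_cases l <;>
      simp [-mul_eq_mul_left_iff, -mul_eq_mul_right_iff, -mul_eq_zero, -Matrix.cons_sub,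
        -neg_inj] <;>
      field_simp <;> ring
  · simp only [hodgeLam_two_true_of_solution h0 m hβ hΓ ht, Bool.not_false, Bool.not_true,
      opM_true_two h0 _ ht]
    rw [hm]
    generalize -(Complex.I * (m : ℂ)) = μ
    funext l
    rcases hβ with rfl | rfl <;> fin_cases l <;>
      simp [-mul_eq_mul_left_iff, -mul_eq_mul_right_iff, -mul_eq_zero, -Matrix.cons_sub,
        -neg_inj] <;>
      field_simp <;> ring

/-- The Hodge operators for the two signs differ by the operators `opN`. -/
theorem opN_hodgeLam_two_not {q : ℝ} (h0 : 0 < q) (s : Bool) (m : ℝ)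
    {Γ : Matrix (Fin 4) (Fin 4) ℂ} {p β t : ℂ}
    (hβ : β = p ∨ β = -p) (hΓ : IsCoeff Γ p (t * p) 0 (β * (1 - t)) (β * (1 - t)) (β * (1 + t)))
    (ht : (q : ℂ) ^ 2 = t)
    (h : 2 + 2 = 4) (x : Lam 2) : opN q s 2 (hodgeLam q (!s) m Γ h x) =
      hodgeLam q s m Γ h (opN q s 2 (opN q s 2 x)) := by
  have ht0 : t ≠ 0 := ht ▸ sq_ne_zero h0
  simp only [opN_two]
  cases s
  · simp only [hodgeLam_two_false_of_solution h0 m hβ hΓ ht, Bool.not_false,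
      hodgeLam_two_true_of_solution h0 m hβ hΓ ht, opM_true_two h0 _ ht]
    funext l
    rcases hβ with rfl | rfl <;> fin_cases l <;>
      simp [-mul_eq_mul_left_iff, -mul_eq_mul_right_iff, -mul_eq_zero, -Matrix.cons_sub,
        -neg_inj] <;>
      field_simp <;> ring
  · simp only [hodgeLam_two_false_of_solution h0 m hβ hΓ ht, Bool.not_true,
      hodgeLam_two_true_of_solution h0 m hβ hΓ ht, opM_false_two h0 _ ht]
    funext l
    rcases hβ with rfl | rfl <;> fin_cases l <;>
      simp [-mul_eq_mul_left_iff, -mul_eq_mul_right_iff, -mul_eq_zero, -Matrix.cons_sub,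
        -neg_inj] <;>
      field_simp <;> ring

/-- Compatibility of the Hodge operators with the conjugation. -/
theorem hodgeLam_lamStar {q : ℝ} (h0 : 0 < q) (s : Bool) (m : ℝ)
    {Γ : Matrix (Fin 4) (Fin 4) ℂ} {p β t : ℂ}
    (hβ : β = p ∨ β = -p) (hΓ : IsCoeff Γ p (t * p) 0 (β * (1 - t)) (β * (1 - t)) (β * (1 + t)))
    (ht : (q : ℂ) ^ 2 = t)
    (hp : starRingEnd ℂ p = p) {k j : ℕ} (h : k + j = 4) (x : Lam k) :
    hodgeLam q s m Γ h (lamStar q k x) = lamStar q j (hodgeLam q s m Γ h (opN q s k x)) := by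
  have ht0 : t ≠ 0 := ht ▸ sq_ne_zero h0
  have hc : starRingEnd ℂ t = t := by rw [← ht]; simp
  have hβ' : starRingEnd ℂ β = β := by rcases hβ with rfl | rfl <;> simp [hp]
  have h2 : starRingEnd ℂ 2 = 2 := map_ofNat _ 2
  by_cases hk : k = 2
  · subst hk
    obtain rfl : j = 2 := by omega
    simp only [opN_two]
    cases s
    · simp only [hodgeLam_two_false_of_solution h0 m hβ hΓ ht, Bool.not_false,
        lamStar_two _ _ ht, opM_true_two h0 _ ht]
      funext l
      fin_cases l <;>
        simp [-mul_eq_mul_left_iff, -mul_eq_mul_right_iff, -mul_eq_zero, -Matrix.cons_sub,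
          -neg_inj, hc, hβ', hp, h2] <;>
        field_simp <;> ring
    · simp only [hodgeLam_two_true_of_solution h0 m hβ hΓ ht, Bool.not_true,
        lamStar_two _ _ ht, opM_false_two h0 _ ht]
      funext l
      fin_cases l <;>
        simp [-mul_eq_mul_left_iff, -mul_eq_mul_right_iff, -mul_eq_zero, -Matrix.cons_sub,
          -neg_inj, hc, hβ', hp, h2] <;>
        field_simp <;> ring
  rw [opN_of_ne hk]
  have hk4 : k ≤ 4 := by omega
  interval_cases k
  · obtain rfl : j = 4 := by omega
    simp only [hodgeLam_of_ne _ _ _ _ _ (by norm_num : 0 ≠ 2), hod_zero h0 _ m hΓ, lamStar_zero,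
      lamStar_four]
    funext l
    fin_cases l
    simp
  · obtain rfl : j = 3 := by omega
    simp only [hodgeLam_of_ne _ _ _ _ _ (by norm_num : 1 ≠ 2), hod_one h0 _ m hΓ, lamStar_one,
      lamStar_three _ _ ht]
    funext l
    fin_cases l <;>
      simp [-mul_eq_mul_left_iff, -mul_eq_mul_right_iff, -mul_eq_zero, -Matrix.cons_sub,
        -neg_inj, hc, hβ', hp] <;>
      field_simp <;> ring
  · exact absurd rfl hk
  · obtain rfl : j = 1 := by omega
    simp only [hodgeLam_three_of_solution h0 _ m hβ hΓ ht, lamStar_one, lamStar_three _ _ ht]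
    funext l
    fin_cases l <;>
      simp [-mul_eq_mul_left_iff, -mul_eq_mul_right_iff, -mul_eq_zero, -Matrix.cons_sub,
        -neg_inj, hc, hβ', hp] <;>
      field_simp
  · obtain rfl : j = 0 := by omega
    simp only [hodgeLam_of_ne _ _ _ _ _ (by norm_num : 4 ≠ 2), hod_four h0 _ m hΓ, lamStar_zero,
      lamStar_four]
    funext l
    fin_cases l
    simp [-mul_eq_mul_left_iff, -mul_eq_mul_right_iff, -mul_eq_zero, -Matrix.cons_sub,
      -neg_inj, hc, hβ', hp]

/-! ### The real and maximally hermitian contractions and their determinant -/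

/-- The quantum determinant as a formal sum of monomials in the `Γ_{ab}`. -/
theorem detq_table (s : Bool) :
    ((antisymComb s 4 [([0, 1, 2, 3], 0, 1)]).bind (contractWord 4 [0, 1, 2, 3])).collect =
      [(([(0, 0), (1, 1), (2, 2), (3, 3)], []), 0, 1),
        (([(0, 0), (1, 1), (2, 3), (3, 2)], []), 0, -1)] := by
  revert s
  decide +kernel

theorem detq_eq {q : ℝ} (h0 : 0 < q) (s : Bool) {Γ : Matrix (Fin 4) (Fin 4) ℂ}
    (hΓ : IsCoinvariant Γ) :
    detq q s Γ = Γ 0 0 * Γ 1 1 * (Γ 2 2 * Γ 3 3 - Γ 2 3 * Γ 3 2) := by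
  have ht := sq_ne_zero h0
  have hv : volTens 1 = Complex.I • wordT 4 [0, 1, 2, 3] := by
    have : wordT 4 [0, 1, 2, 3] = Pi.single ![0, 1, 2, 3] 1 := wordT_ofFn ![0, 1, 2, 3]
    funext b
    simp [volTens, this, Pi.single_apply]
  have hc := homog_antisymComb s (le_refl 4) (homog_single (k := 4) (w := [0, 1, 2, 3]) rfl 0 1)
  let F : Tens ℂ 4 →ₗ[ℂ] Tens ℂ 0 :=
    { toFun := contract Γ (rfl : 4 + 0 = 4) (wordT 4 [0, 1, 2, 3])
      map_add' := contract_add_right Γ _ _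
      map_smul' := fun r t => contract_smul_right Γ _ r _ t }
  have key : F (act (antisym q s 4) (wordT 4 [0, 1, 2, 3])) =
      fun _ => Γ 0 0 * Γ 1 1 * (Γ 2 2 * Γ 3 3 - Γ 2 3 * Γ 3 2) := by
    have h1 : act (antisym q s 4) (wordT 4 [0, 1, 2, 3]) =
        val q 4 (antisymComb s 4 [([0, 1, 2, 3], 0, 1)]) :=
      antisym_basisWord h0 s (le_refl 4) (0 : Fin 1)
    rw [h1, val, map_eval]
    have h2 : eval ((q : ℂ) ^ 2) (fun v => F (wordT 4 v))
        (antisymComb s 4 [([0, 1, 2, 3], 0, 1)]) = eval ((q : ℂ) ^ 2)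
        (fun x : List (Fin 4 × Fin 4) × List (Fin 4) =>
          (x.1.map fun y => Γ y.1 y.2).prod • wordT 0 x.2)
        (((antisymComb s 4 [([0, 1, 2, 3], 0, 1)]).bind
          (contractWord 4 [0, 1, 2, 3])).collect) := by
      rw [eval_collect, eval_bind ht]
      exact eval_congr _ fun v hv => contract_wordT hΓ (rfl : 4 + 0 = 4) _
        (u := [0, 1, 2, 3]) rfl (hc v hv)
    refine h2.trans ?_
    rw [detq_table]
    funext b
    simp [wordT, Subsingleton.elim _ b]
    ring
  change (contract Γ (rfl : 4 + 0 = 4) (volTens 1)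
    (act (antisym q s 4) (volTens 1))) Fin.elim0 = _
  rw [hv, contract_smul_left, map_smul, contract_smul_right]
  change starRingEnd ℂ Complex.I * (Complex.I *
    (F (act (antisym q s 4) (wordT 4 [0, 1, 2, 3]))) Fin.elim0) = _
  rw [key, Complex.conj_I]
  linear_combination (-(Γ 0 0 * Γ 1 1 * (Γ 2 2 * Γ 3 3 - Γ 2 3 * Γ 3 2))) * Complex.I_sq

/-- The properties of the Hodge operators of a real and maximally hermitian contraction, in
coordinates; `D` is its quantum determinant. -/
structure IsDuality (q : ℝ) (Γ : Matrix (Fin 4) (Fin 4) ℂ) (D : ℝ) : Prop where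
  coinvariant : IsCoinvariant Γ
  neg : D < 0
  detq (s : Bool) : detq q s Γ = D
  sq_of_ne (m : ℝ) (s s' : Bool) {k j : ℕ} (h : k + j = 4) (h' : j + k = 4) (hk : k ≠ 2)
    (x : Lam k) : hodgeLam q s m Γ h' (hodgeLam q s' m Γ h x) =
      ((-1) ^ (k * j) * (m ^ 2 * D : ℂ)) • x
  sq_two (m : ℝ) (s : Bool) (h h' : 2 + 2 = 4) (x : Lam 2) :
    hodgeLam q s m Γ h' (hodgeLam q s m Γ h x) = (m ^ 2 * D : ℂ) • opN q (!s) 2 x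
  opN_hodgeLam (m : ℝ) (s : Bool) (h : 2 + 2 = 4) (x : Lam 2) :
    opN q s 2 (hodgeLam q (!s) m Γ h x) = hodgeLam q s m Γ h (opN q s 2 (opN q s 2 x))
  star (m : ℝ) (s : Bool) {k j : ℕ} (h : k + j = 4) (x : Lam k) :
    hodgeLam q s m Γ h (lamStar q k x) = lamStar q j (hodgeLam q s m Γ h (opN q s k x))

/-- The quantum determinant of a contraction of the explicit family is the negative number
`-q² (1 - q²)² p⁴`, the scalar in the squares of its Hodge operators. -/
theorem IsSolution.isDuality {q : ℝ} (hq : q ∈ Set.Ioo (0 : ℝ) 1)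
    {Γ : Matrix (Fin 4) (Fin 4) ℂ} (hΓ : IsSolution q Γ) : ∃ D, IsDuality q Γ D := by
  obtain ⟨p, β, hp, hβ, hΓ⟩ := hΓ
  have h0 := hq.1
  have hβ' : (β : ℂ) = p ∨ (β : ℂ) = -p := by exact_mod_cast hβ
  have hq1 : 0 < 1 - q ^ 2 := by nlinarith [hq.1, hq.2]
  refine ⟨-q ^ 2 * (1 - q ^ 2) ^ 2 * p ^ 4, hΓ.coinvariant, ?_, fun s => ?_, ?_, ?_, ?_, ?_⟩
  · have : 0 < q ^ 2 * (1 - q ^ 2) ^ 2 * p ^ 4 := by positivity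
    linarith
  · have e (a b : Fin 4) (r : ℝ) (h : starRingEnd ℂ (Γ a b) = r) : Γ a b = r := by
      rw [← Complex.conj_conj (Γ a b), h, Complex.conj_ofReal]
    have e1 := e 0 0 p hΓ.hp
    have e2 := e 1 1 (q ^ 2 * p) (by rw [hΓ.hr]; push_cast; rfl)
    have e3 := e 2 2 0 (by rw [hΓ.ha]; simp)
    have e4 := e 2 3 (β * (1 - q ^ 2)) (by rw [hΓ.hb]; push_cast; rfl)
    have e5 := e 3 2 (β * (1 - q ^ 2)) (by rw [hΓ.hc]; push_cast; rfl)
    have h2 : (β : ℂ) ^ 2 = p ^ 2 := by rcases hβ' with h | h <;> rw [h]; ring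
    rw [detq_eq h0 s hΓ.coinvariant, e1, e2, e3, e4, e5]
    push_cast
    linear_combination (-(q : ℂ) ^ 2 * p ^ 2 * (1 - (q : ℂ) ^ 2) ^ 2) * h2
  · intro m s s' k j h h' hk x
    rw [hodgeLam_hodgeLam_of_ne h0 s m hβ' hΓ rfl s' h h' hk]
    push_cast
    rfl
  · intro m s h h' x
    rw [hodgeLam_two_sq h0 s m hβ' hΓ rfl]
    push_cast
    rfl
  · exact fun m s h x => opN_hodgeLam_two_not h0 s m hβ' hΓ rfl h x
  · exact fun m s k j h x => hodgeLam_lamStar h0 s m hβ' hΓ rfl (Complex.conj_ofReal p) h x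

theorem IsDuality.isRealMaxHerm {q : ℝ} (hq : q ∈ Set.Ioo (0 : ℝ) 1)
    {Γ : Matrix (Fin 4) (Fin 4) ℂ} {D : ℝ} (hΓ : IsDuality q Γ D) {s : Bool} {m : ℝ} (hm : m ≠ 0)
    {T : InvOp q s} (hT : IsHodge q s m Γ T) : IsRealMaxHerm q s m T := by
  have hm' : (m : ℂ) ≠ 0 := by exact_mod_cast hm
  have hD : (D : ℂ) ≠ 0 := by exact_mod_cast hΓ.neg.ne
  rw [isRealMaxHerm_iff hq s m Γ hT]
  refine ⟨fun e => ?_, fun x => ?_, fun x => ?_, fun k j h h' l => ?_⟩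
  · have h1 := hΓ.sq_of_ne m s s (rfl : 4 + 0 = 4) (rfl : 0 + 4 = 4) (by norm_num)
      (fun _ => Complex.I * m)
    rw [e, map_zero] at h1
    have h2 := congrFun h1 (0 : Fin 1)
    simp [hm', hD] at h2
  · rw [hΓ.star, opN_of_ne (by norm_num)]
  · rw [hΓ.sq_of_ne m s s _ _ (by norm_num), hΓ.sq_of_ne m s s _ _ (by norm_num)]
    norm_num
  · by_cases hk : k = 2
    · subst hk
      obtain rfl : j = 2 := by omega
      refine ⟨m ^ 2 * D * (l - 1), fun x hx => ?_⟩
      rw [hΓ.sq_two, opN_two, Bool.not_not, hx]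
      module
    · exact ⟨_, fun x _ => hΓ.sq_of_ne m s s h h' hk x⟩

/-- The set of real and maximally hermitian contractions is the explicit family, whatever the sign
and the scale. -/
theorem realMaxHerm_eq {q : ℝ} (hq : q ∈ Set.Ioo (0 : ℝ) 1) (s : Bool) {m : ℝ} (hm : m ≠ 0) :
    realMaxHerm q s m = {Γ | IsSolution q Γ} := by
  ext Γ
  constructor
  · rintro ⟨hΓ, T, hT, h⟩
    obtain ⟨h1, h2, h3, h4⟩ := (isRealMaxHerm_iff hq s m Γ hT).1 h
    exact isSolution_of_real_of_hermitian_of_maximal hq.1 hq.2 s hm hΓ h1 h2 h3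
      fun l => h4 2 2 rfl rfl l
  · intro hΓ
    obtain ⟨D, hD⟩ := IsSolution.isDuality hq hΓ
    obtain ⟨T, hT, -⟩ := existsUnique_hodge hq s m Γ
    exact ⟨hD.coinvariant, T, hT, hD.isRealMaxHerm hq hm hT⟩

theorem IsDuality.sgn_eq {q : ℝ} {Γ : Matrix (Fin 4) (Fin 4) ℂ} {D : ℝ} (hΓ : IsDuality q Γ D)
    (s : Bool) : sgn q s Γ = -1 := by
  have hD : (D : ℂ) ≠ 0 := by exact_mod_cast hΓ.neg.ne
  rw [sgn, hΓ.detq, Complex.norm_real, Real.norm_eq_abs, abs_of_neg hΓ.neg, Complex.ofReal_neg,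
    div_neg, div_self hD]

/-- The scale for which the Hodge operators square to a sign. -/
theorem IsDuality.exists_scale {q : ℝ} {Γ : Matrix (Fin 4) (Fin 4) ℂ} {D : ℝ}
    (hΓ : IsDuality q Γ D) : ∃ m : ℝ, m ≠ 0 ∧ (m ^ 2 * D : ℂ) = -1 := by
  have hD : 0 < -D := neg_pos.2 hΓ.neg
  refine ⟨√(-D)⁻¹, (Real.sqrt_pos.2 (inv_pos.2 hD)).ne', ?_⟩
  have h : √(-D)⁻¹ ^ 2 * D = -1 := by
    rw [Real.sq_sqrt (inv_pos.2 hD).le]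
    field_simp [hΓ.neg.ne]
  exact_mod_cast h

/-- The square of the Hodge operators on eigenforms. -/
theorem IsDuality.sq_eigenform {q : ℝ} (hq : q ∈ Set.Ioo (0 : ℝ) 1)
    {Γ : Matrix (Fin 4) (Fin 4) ℂ} {D : ℝ} (hΓ : IsDuality q Γ D) {m : ℝ}
    (hm : (m ^ 2 * D : ℂ) = -1) {s : Bool} {T : InvOp q s} (hT : IsHodge q s m Γ T) {k j : ℕ}
    (h : k + j = 4) {ξ : InvForms q s k} {l l' : ℂ} (hl : IsEigenform q s ξ l)
    (hl' : IsEigenform q s (formStar q s ξ) l') :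
    sq T k j h ξ = ((-1) ^ (k * j) * sgn q s Γ * (l / l')) • ξ := by
  have h0 := hq.1
  have hk : k ≤ 4 := by omega
  rw [isHodge_iff hq] at hT
  obtain ⟨x, rfl⟩ := phi_surjective h0 s hk ξ
  rw [formStar_phi h0 s hk, isEigenform_phi h0 s hk] at hl'
  rw [isEigenform_phi h0 s hk] at hl
  obtain ⟨hl0, hl0', e, -⟩ := opN_eigen h0 hk hl.1 hl.2 hl'.2
  rw [sq, LinearMap.comp_apply, hT, hT, ← map_smul, hΓ.sgn_eq]
  congr 1
  by_cases hk' : k = 2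
  · subst hk'
    obtain rfl : j = 2 := by omega
    have e' : x = (l / l') • opN q s 2 x := by
      rw [e, smul_smul, div_mul_div_cancel₀ hl0', div_self hl0, one_smul]
    have e2 : opN q (!s) 2 x = (l / l') • x := by
      have := opN_opN h0 (!s) x
      rw [Bool.not_not, e, map_smul] at this
      rw [← this, smul_smul, div_mul_div_cancel₀ hl0', div_self hl0, one_smul, this]
    rw [hΓ.sq_two, hm, e2, smul_smul]
    norm_num
  · have e3 : l / l' = 1 := by
      rw [opN_of_ne hk'] at e
      have : (1 : ℂ) = l' / l := smul_left_injective ℂ hl.1 (by simpa using e)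
      rw [← inv_div, ← this, inv_one]
    rw [hΓ.sq_of_ne m s s _ _ hk', hm, e3, mul_one]

/-- The conjugation and the Hodge operators on eigenforms. -/
theorem IsDuality.star_eigenform {q : ℝ} (hq : q ∈ Set.Ioo (0 : ℝ) 1)
    {Γ : Matrix (Fin 4) (Fin 4) ℂ} {D : ℝ} (hΓ : IsDuality q Γ D) {m : ℝ}
    {s : Bool} {T : InvOp q s} (hT : IsHodge q s m Γ T) {k j : ℕ}
    (h : k + j = 4) {ξ : InvForms q s k} {l l' : ℂ} (hl : IsEigenform q s ξ l)
    (hl' : IsEigenform q s (formStar q s ξ) l') :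
    l' • formStar q s (T k j h ξ) = l • T k j h (formStar q s ξ) := by
  have h0 := hq.1
  have hk : k ≤ 4 := by omega
  have hj : j ≤ 4 := by omega
  rw [isHodge_iff hq] at hT
  obtain ⟨x, rfl⟩ := phi_surjective h0 s hk ξ
  rw [formStar_phi h0 s hk, isEigenform_phi h0 s hk] at hl'
  rw [isEigenform_phi h0 s hk] at hl
  obtain ⟨hl0, -, e, hr⟩ := opN_eigen h0 hk hl.1 hl.2 hl'.2
  rw [formStar_phi h0 s hk, hT, hT, formStar_phi h0 s hj, hΓ.star, e, map_smul, map_smulₛₗ, hr,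
    map_smul, smul_smul, mul_div_cancel₀ _ hl0]

/-- The Hodge operators for the two signs are inverse to each other, up to a sign. -/
theorem IsDuality.mixed {q : ℝ} (hq : q ∈ Set.Ioo (0 : ℝ) 1)
    {Γ : Matrix (Fin 4) (Fin 4) ℂ} {D : ℝ} (hΓ : IsDuality q Γ D) {m : ℝ}
    (hm : (m ^ 2 * D : ℂ) = -1) {T : (s : Bool) → InvOp q s} (hT : ∀ s, IsHodge q s m Γ (T s))
    (s : Bool) {k j : ℕ} (h : k + j = 4) (h' : j + k = 4) (ξ : InvForms q (!s) k)
    (η : InvForms q s j) (hη : η.1 = (T (!s) k j h ξ).1) :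
    (T s j k h' η).1 = ((-1) ^ (k * j) * sgn q s Γ) • ξ.1 := by
  have h0 := hq.1
  have hk : k ≤ 4 := by omega
  have hj : j ≤ 4 := by omega
  have hT' (s) := (isHodge_iff hq s m Γ (T s)).1 (hT s)
  obtain ⟨x, rfl⟩ := phi_surjective h0 _ hk ξ
  have hn {k : ℕ} (hk : k ≤ 4) (x : Lam k) :
      (phi q (!s) k x).1 = (phi q s k (opN q s k x)).1 := by
    have := phi_not h0 (!s) hk x
    rwa [Bool.not_not] at this
  have hη' : η = phi q s j (opN q s j (hodgeLam q (!s) m Γ h x)) :=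
    Subtype.ext (by rw [hη, hT', hn hj])
  rw [hη', hT', hn hk, hΓ.sgn_eq]
  change _ = ((((-1) ^ (k * j) * -1 : ℂ)) • phi q s k (opN q s k x)).1
  rw [← map_smul]
  congr 2
  by_cases hk' : k = 2
  · subst hk'
    obtain rfl : j = 2 := by omega
    -- `T_s N_s T_{-s} = T_s T_s N_s N_s = -N_{-s} N_s N_s = -N_s`, where `N_s` is `opN`
    rw [hΓ.opN_hodgeLam, hΓ.sq_two, hm]
    have := opN_opN h0 (!s) (opN q s 2 x)
    rw [Bool.not_not] at this
    rw [this]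
    norm_num
  · rw [opN_of_ne (by omega : j ≠ 2), opN_of_ne hk', hΓ.sq_of_ne m s (!s) _ _ hk', hm]

/-! ### The right module structure of the one-forms -/

theorem Alg.induction {q : ℝ} {P : Alg q → Prop} (algebraMap : ∀ r : ℂ, P (algebraMap ℂ (Alg q) r))
    (gen : ∀ g, P (gen q g)) (mul : ∀ x y, P x → P y → P (x * y))
    (add : ∀ x y, P x → P y → P (x + y)) (x : Alg q) : P x := by
  obtain ⟨y, rfl⟩ : ∃ y, quot q y = x := RingQuot.mkAlgHom_surjective ℂ (Rel q) x
  induction y using FreeAlgebra.induction with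
  | grade0 r => rw [AlgHom.commutes]; exact algebraMap r
  | grade1 g => exact gen g
  | mul a b ha hb => rw [map_mul]; exact mul _ _ ha hb
  | add a b ha hb => rw [map_add]; exact add _ _ ha hb

theorem fHom_gen {q : ℝ} (hq : q ∈ Set.Ioo (0 : ℝ) 1) (g : Gen) : fHom hq (gen q g) = fGen q g := by
  have : fHom hq (gen q g) = FreeAlgebra.lift ℂ (fGen q) (FreeAlgebra.ι ℂ g) :=
    RingQuot.liftAlgHom_mkAlgHom_apply ℂ _ _ _
  rw [this, FreeAlgebra.lift_ι_apply]

/-- The matrices `F(x) = (f_{ba} ▷ x)_{ba}` are triangular for the order `z, -, +, 0` of the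
indices. -/
theorem fHom_triangular {q : ℝ} (hq : q ∈ Set.Ioo (0 : ℝ) 1) (x : Alg q) :
    (fHom hq x 0 0 = x ∧ fHom hq x 1 1 = x) ∧ (fHom hq x 0 1 = 0 ∧ fHom hq x 0 3 = 0 ∧
      fHom hq x 1 0 = 0 ∧ fHom hq x 1 3 = 0 ∧ fHom hq x 2 0 = 0 ∧ fHom hq x 2 1 = 0 ∧
      fHom hq x 2 3 = 0) := by
  induction x using Alg.induction with
  | algebraMap r => simp [Matrix.algebraMap_matrix_apply]
  | gen g =>
    rw [fHom_gen]
    cases g <;>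
      simp [fGen_a hq.1 hq.2, fGen_aStar hq.1 hq.2, fGen_c hq.1 hq.2, fGen_cStar hq.1 hq.2, scal,
        fA, fB, fC, fD]
  | mul x y hx hy =>
    obtain ⟨⟨x1, x2⟩, x3, x4, x5, x6, x7, x8, x9⟩ := hx
    obtain ⟨⟨y1, y2⟩, y3, y4, y5, y6, y7, y8, y9⟩ := hy
    simp [Matrix.mul_apply, Fin.sum_univ_four, x1, x2, x3, x4, x5, x6, x7, x8, x9, y1, y2, y3, y4,
      y5, y6, y7, y8, y9]
  | add x y hx hy =>
    obtain ⟨⟨x1, x2⟩, x3, x4, x5, x6, x7, x8, x9⟩ := hx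
    obtain ⟨⟨y1, y2⟩, y3, y4, y5, y6, y7, y8, y9⟩ := hy
    simp [x1, x2, x3, x4, x5, x6, x7, x8, x9, y1, y2, y3, y4, y5, y6, y7, y8, y9]

theorem fHom_mul_diag {q : ℝ} (hq : q ∈ Set.Ioo (0 : ℝ) 1) (x y : Alg q) :
    fHom hq (x * y) 2 2 = fHom hq x 2 2 * fHom hq y 2 2 ∧
    fHom hq (x * y) 3 3 = fHom hq x 3 3 * fHom hq y 3 3 := by
  obtain ⟨-, -, -, -, -, x7, x8, x9⟩ := fHom_triangular hq x
  obtain ⟨-, -, y4, -, y6, -, -, y9⟩ := fHom_triangular hq y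
  simp [Matrix.mul_apply, Fin.sum_univ_four, x7, x8, x9, y4, y6, y9]

/-- The actions of `K²` and `K⁻²`, on the diagonal of `F`, are inverse to each other. -/
theorem fHom_diag_inv {q : ℝ} (hq : q ∈ Set.Ioo (0 : ℝ) 1) (x : Alg q) :
    fHom hq (fHom hq x 3 3) 2 2 = x ∧ fHom hq (fHom hq x 2 2) 3 3 = x := by
  have hq0 : (q : ℂ) ≠ 0 := by exact_mod_cast hq.1.ne'
  induction x using Alg.induction with
  | algebraMap r => simp [Matrix.algebraMap_matrix_apply]
  | gen g =>
    rw [fHom_gen]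
    cases g <;>
      simp [fGen_a hq.1 hq.2, fGen_aStar hq.1 hq.2, fGen_c hq.1 hq.2, fGen_cStar hq.1 hq.2, scal,
        fA, fB, fC, fD, fHom_gen, hq0, smul_smul, -Complex.coe_smul]
  | mul x y hx hy => simp only [fHom_mul_diag, hx, hy, and_self]
  | add x y hx hy => simp only [map_add, Matrix.add_apply, hx, hy, and_self]

/-- Every one-form is uniquely a sum of right multiples of the `ω_a`: the triangular system for the
coefficients is solved from `z` to `0`, since the diagonal of `F` is invertible. -/
theorem fHom_sum_bijective {q : ℝ} (hq : q ∈ Set.Ioo (0 : ℝ) 1) :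
    Function.Bijective fun (y : Fin 4 → Alg q) (b : Fin 4) => ∑ a, fHom hq (y a) a b := by
  have h (y : Fin 4 → Alg q) : (fun b => ∑ a, fHom hq (y a) a b) =
      ![y 0 + fHom hq (y 3) 3 0, y 1 + fHom hq (y 3) 3 1, fHom hq (y 0) 0 2 + fHom hq (y 1) 1 2 +
        fHom hq (y 2) 2 2 + fHom hq (y 3) 3 2, fHom hq (y 3) 3 3] := by
    have h (a) := fHom_triangular hq (y a)
    funext b
    rw [Fin.sum_univ_four]
    fin_cases b <;> simp [h]
  rw [funext h]
  refine Function.bijective_iff_has_inverse.2 ⟨fun z =>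
    let y₃ := fHom hq (z 3) 2 2
    let y₀ := z 0 - fHom hq y₃ 3 0
    let y₁ := z 1 - fHom hq y₃ 3 1
    ![y₀, y₁, fHom hq (z 2 - fHom hq y₀ 0 2 - fHom hq y₁ 1 2 - fHom hq y₃ 3 2) 3 3, y₃],
    fun y => ?_, fun z => ?_⟩
  · funext a
    fin_cases a <;> simp [fHom_diag_inv]
    abel
  · funext a
    fin_cases a <;> simp [fHom_diag_inv]
    abel

/-! ### The braiding is a right module map -/

/-- The rows of the complex matrices `(⟨f_{ba}, U_ij⟩)_{ba}`, as formal sums in powers of `q`. -/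
def fTab : Fin 2 → Fin 2 → Fin 4 → LinComb (Fin 4)
  | 0, 0, 0 => [(0, 0, 1)]
  | 0, 0, 1 => [(1, 0, 1)]
  | 0, 0, 2 => [(2, -1, 1)]
  | 0, 0, 3 => [(2, 1, 1), (3, 1, 1)]
  | 1, 1, 0 => [(0, 0, 1)]
  | 1, 1, 1 => [(1, 0, 1)]
  | 1, 1, 2 => [(2, 1, 1)]
  | 1, 1, 3 => [(2, -1, -1), (3, -1, 1)]
  | 1, 0, 0 => [(2, 0, 1)]
  | 1, 0, 3 => [(1, 1, 1), (1, -1, -1)]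
  | 0, 1, 1 => [(2, 0, 1)]
  | 0, 1, 3 => [(0, 1, 1), (0, -1, -1)]
  | _, _, _ => []

theorem eval_fTab {q : ℝ} (h0 : 0 < q) (h1 : q < 1) {E : Type} [AddCommGroup E] [Module ℂ E]
    (g : Fin 4 → E) (i j : Fin 2) (a : Fin 4) :
    eval (q : ℂ) g (fTab i j a) = ∑ c, fRep q a c i j • g c := by
  simp only [Fin.sum_univ_four, fRep_eq h0 h1]
  fin_cases i <;> fin_cases j <;> fin_cases a <;> simp [fTab, sub_eq_add_neg, add_smul]

/-- The rows of the complex matrices that describe `ω_a ⊗ ω_b · U_ij`, as formal sums. -/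
def fTab₂ (i j : Fin 2) (a : Fin 4 × Fin 4) : LinComb (Fin 4 × Fin 4) :=
  (List.finRange 2).flatMap fun k =>
    (fTab i k a.1).bind fun c => (fTab k j a.2).map fun z => ((c, z.1), z.2)

theorem eval_fTab₂ {q : ℝ} (h0 : 0 < q) (h1 : q < 1) {E : Type} [AddCommGroup E] [Module ℂ E]
    (g : Fin 4 × Fin 4 → E) (i j : Fin 2) (a : Fin 4 × Fin 4) :
    eval (q : ℂ) g (fTab₂ i j a) =
      ∑ c, (∑ k, fRep q a.1 c.1 i k * fRep q a.2 c.2 k j) • g c := by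
  have hq0 : (q : ℂ) ≠ 0 := by exact_mod_cast h0.ne'
  have h (k : Fin 2) : eval (q : ℂ) g ((fTab i k a.1).bind fun c =>
      (fTab k j a.2).map fun z => ((c, z.1), z.2)) =
      ∑ c : Fin 4 × Fin 4, (fRep q a.1 c.1 i k * fRep q a.2 c.2 k j) • g c := by
    rw [eval_bind hq0, eval_fTab h0 h1, Fintype.sum_prod_type]
    refine Finset.sum_congr rfl fun c _ => ?_
    rw [eval_map _ _ (fun z => (c, z)), eval_fTab h0 h1, Finset.smul_sum]
    exact Finset.sum_congr rfl fun d _ => smul_smul _ _ _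
  have e : fTab₂ i j a = ((fTab i 0 a.1).bind fun c => (fTab 0 j a.2).map fun z => ((c, z.1), z.2))
      ++ ((fTab i 1 a.1).bind fun c => (fTab 1 j a.2).map fun z => ((c, z.1), z.2)) := by
    simp [fTab₂, List.finRange_succ]
  rw [e, eval_append, h, h, ← Finset.sum_add_distrib]
  refine Finset.sum_congr rfl fun c _ => ?_
  rw [Fin.sum_univ_two, add_smul]

/-- The table `sigmaTab` in powers of `q` instead of `q²`. -/
def sigmaTab' (s : Bool) (a : Fin 4 × Fin 4) : LinComb (Fin 4 × Fin 4) :=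
  (sigmaTab s a.1 a.2).map fun z => (z.1, 2 * z.2.1, z.2.2)

theorem eval_sigmaTab' {q : ℝ} (h0 : 0 < q) {E : Type} [AddCommGroup E] [Module ℂ E]
    (g : Fin 4 × Fin 4 → E) (s : Bool) (a : Fin 4 × Fin 4) :
    eval (q : ℂ) g (sigmaTab' s a) = ∑ c, sigma q s c a • g c := by
  rw [sum_sigma_smul h0, sigmaTab']
  generalize sigmaTab s a.1 a.2 = l
  induction l with
  | nil => rfl
  | cons x l ih =>
    rw [List.map_cons, eval_cons, eval_cons, ih, zpow_mul]
    rfl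

/-- `σ` commutes with the right multiplication by an entry of the fundamental corepresentation `U`,
as a finite identity of formal sums. -/
theorem sigma_fTab₂ (s : Bool) (i j : Fin 2) : ∀ a,
    (((sigmaTab' s a).bind (fTab₂ i j)).sub ((fTab₂ i j a).bind (sigmaTab' s))).collect = [] := by
  revert s i j
  decide +kernel

/-- `σ` commutes with the right multiplication by an entry of `U`, in coordinates. -/
theorem sigma_fRep {q : ℝ} (h0 : 0 < q) (h1 : q < 1) (s : Bool) (i j : Fin 2)
    (a b : Fin 4 × Fin 4) :
    ∑ c, sigma q s c a * ∑ k, fRep q c.1 b.1 i k * fRep q c.2 b.2 k j =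
      ∑ c, sigma q s b c * ∑ k, fRep q a.1 c.1 i k * fRep q a.2 c.2 k j := by
  have hq0 : (q : ℂ) ≠ 0 := by exact_mod_cast h0.ne'
  have h := eval_eq_of_collect_sub hq0 (Pi.single b (1 : ℂ)) (sigma_fTab₂ s i j a)
  rw [eval_bind hq0, eval_bind hq0, eval_sigmaTab' h0, eval_fTab₂ h0 h1] at h
  simp only [eval_sigmaTab' h0, eval_fTab₂ h0 h1, Pi.single_apply, smul_eq_mul, mul_ite, mul_one,
    mul_zero, Finset.sum_ite_eq', Finset.mem_univ, if_true] at h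
  rw [h]
  exact Finset.sum_congr rfl fun c _ => mul_comm _ _

theorem fHom_fund {q : ℝ} (hq : q ∈ Set.Ioo (0 : ℝ) 1) (i j : Fin 2) (b a : Fin 4) :
    fHom hq (fund q i j) b a = ∑ k, fRep q b a k j • fund q i k := by
  have hq0 : (q : ℂ) ≠ 0 := by exact_mod_cast hq.1.ne'
  have h : fHom hq (fund q i j) = fAct q i j := by
    fin_cases i <;> fin_cases j <;> simp [fund, fHom_gen, fGen, smul_smul, hq0, -Complex.coe_smul]
  rw [h]
  rfl

/-- `σ` commutes with the right multiplication. -/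
theorem sigma_fHom {q : ℝ} (hq : q ∈ Set.Ioo (0 : ℝ) 1) (s : Bool) (x : Alg q)
    (a b : Fin 4 × Fin 4) :
    ∑ c, sigma q s c a • fHom hq (fHom hq x c.2 b.2) c.1 b.1 =
      ∑ c, sigma q s b c • fHom hq (fHom hq x a.2 c.2) a.1 c.1 := by
  have hq0 : (q : ℂ) ≠ 0 := by exact_mod_cast hq.1.ne'
  let F (x : Alg q) : Matrix (Fin 4 × Fin 4) (Fin 4 × Fin 4) (Alg q) :=
    Matrix.of fun a b => fHom hq (fHom hq x a.2 b.2) a.1 b.1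
  have hmul (x y : Alg q) : F (x * y) = F x * F y := by
    ext a b
    simp only [F, Matrix.of_apply, map_mul, Matrix.mul_apply, map_sum, Matrix.sum_apply,
      Fintype.sum_prod_type]
    exact Finset.sum_comm
  have hadd (x y : Alg q) : F (x + y) = F x + F y := by
    ext a b
    simp [F]
  let S : Matrix (Fin 4 × Fin 4) (Fin 4 × Fin 4) (Alg q) :=
    ((sigma q s).transpose).map (algebraMap ℂ (Alg q))
  have hS (x : Alg q) : S * F x = F x * S ↔ ∀ a b : Fin 4 × Fin 4,
      ∑ c, sigma q s c a • fHom hq (fHom hq x c.2 b.2) c.1 b.1 =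
        ∑ c, sigma q s b c • fHom hq (fHom hq x a.2 c.2) a.1 c.1 := by
    rw [← Matrix.ext_iff]
    refine forall_congr' fun a => forall_congr' fun b => ?_
    simp only [Matrix.mul_apply, S, F, Matrix.map_apply, Matrix.transpose_apply, Matrix.of_apply,
      ← Algebra.smul_def, ← Algebra.commutes]
  have hfund (i j : Fin 2) : S * F (fund q i j) = F (fund q i j) * S := by
    rw [hS]
    intro a b
    have h (a b : Fin 4 × Fin 4) : fHom hq (fHom hq (fund q i j) a.2 b.2) a.1 b.1 =
        ∑ l, (∑ k, fRep q a.1 b.1 l k * fRep q a.2 b.2 k j) • fund q i l := by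
      simp only [fHom_fund, map_sum, map_smul, Matrix.sum_apply, Matrix.smul_apply,
        Finset.smul_sum, Finset.sum_smul, smul_smul]
      rw [Finset.sum_comm]
      exact Finset.sum_congr rfl fun l _ => Finset.sum_congr rfl fun k _ => by rw [mul_comm]
    simp only [h, Finset.smul_sum, smul_smul]
    rw [Finset.sum_comm, Finset.sum_comm (s := (Finset.univ : Finset (Fin 4 × Fin 4)))]
    refine Finset.sum_congr rfl fun l _ => ?_
    rw [← Finset.sum_smul, ← Finset.sum_smul, sigma_fRep hq.1 hq.2]
  have hsmul (r : ℂ) (x : Alg q) (h : S * F x = F x * S) : S * F (r • x) = F (r • x) * S := by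
    have : F (r • x) = r • F x := by
      ext a b
      simp [F]
    rw [this, Matrix.mul_smul, Matrix.smul_mul, h]
  refine (hS x).1 ?_ a b
  induction x using Alg.induction with
  | algebraMap r =>
    have h1 : F 1 = 1 := by
      ext a b
      simp only [F, Matrix.of_apply, map_one, Matrix.one_apply, Prod.ext_iff]
      by_cases h : a.2 = b.2 <;> simp [h, Matrix.one_apply]
    rw [Algebra.algebraMap_eq_smul_one]
    exact hsmul r 1 (by rw [h1, mul_one, one_mul])
  | gen g =>
    cases g with
    | a => exact hfund 0 0
    | c => exact hfund 1 0
    | aStar => exact hfund 1 1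
    | cStar =>
      have : gen q .cStar = (-(q : ℂ)⁻¹) • fund q 0 1 := by
        simp [fund, smul_smul, hq0, -Complex.coe_smul]
      rw [this]
      exact hsmul _ _ (hfund 0 1)
  | mul x y hx hy => rw [hmul, ← mul_assoc, hx, mul_assoc, hy, mul_assoc]
  | add x y hx hy => rw [hadd, mul_add, add_mul, hx, hy]

/-! ### The right module structure of the tensors -/

theorem basisMul_add {q : ℝ} (hq : q ∈ Set.Ioo (0 : ℝ) 1) {k : ℕ} (x y : Alg q)
    (a b : Fin k → Fin 4) :
    basisMul hq k (x + y) a b = basisMul hq k x a b + basisMul hq k y a b := by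
  induction k with
  | zero => rfl
  | succ k ih => simp [basisMul, ih]

theorem basisMul_smul {q : ℝ} (hq : q ∈ Set.Ioo (0 : ℝ) 1) {k : ℕ} (r : ℂ) (x : Alg q)
    (a b : Fin k → Fin 4) :
    basisMul hq k (r • x) a b = r • basisMul hq k x a b := by
  induction k with
  | zero => rfl
  | succ k ih => simp [basisMul, ih]

/-- The linear map with `x ω ↦ ω x`, for `x ∈ A(SU_q(2))` and left-invariant tensors `ω`. -/
noncomputable def flipMul {q : ℝ} (hq : q ∈ Set.Ioo (0 : ℝ) 1) (k : ℕ) :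
    Tens (Alg q) k →ₗ[ℂ] Tens (Alg q) k where
  toFun t b := ∑ a, basisMul hq k (t a) a b
  map_add' t u := by
    funext b
    simp [basisMul_add, Finset.sum_add_distrib]
  map_smul' r t := by
    funext b
    simp [basisMul_smul, Finset.smul_sum]

theorem flipMul_apply {q : ℝ} (hq : q ∈ Set.Ioo (0 : ℝ) 1) {k : ℕ} (t : Tens (Alg q) k)
    (b : Fin k → Fin 4) : flipMul hq k t b = ∑ a, basisMul hq k (t a) a b := rfl

theorem flipMul_mulLeft {q : ℝ} (hq : q ∈ Set.Ioo (0 : ℝ) 1) {k : ℕ} (x : Alg q) (ω : Tens ℂ k) :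
    flipMul hq k (mulLeft x ω) = mulRight hq ω x := by
  funext b
  exact Finset.sum_congr rfl fun a _ => basisMul_smul hq _ _ _ _

theorem sum_cons {E : Type} [AddCommMonoid E] {k : ℕ} (f : (Fin (k + 1) → Fin 4) → E) :
    ∑ c, f c = ∑ c₀ : Fin 4, ∑ c' : Fin k → Fin 4, f (Fin.cons c₀ c') := by
  rw [← (Fin.consEquiv fun _ => Fin 4).sum_comp, Fintype.sum_prod_type]
  rfl

theorem flipMul_succ {q : ℝ} (hq : q ∈ Set.Ioo (0 : ℝ) 1) {k : ℕ} (t : Tens (Alg q) (k + 1))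
    (b₀ : Fin 4) (b : Fin k → Fin 4) : flipMul hq (k + 1) t (Fin.cons b₀ b) =
      ∑ a₀, fHom hq (flipMul hq k (fun a => t (Fin.cons a₀ a)) b) a₀ b₀ := by
  rw [flipMul_apply, sum_cons]
  refine Finset.sum_congr rfl fun a₀ _ => ?_
  rw [flipMul_apply, map_sum, Matrix.sum_apply]
  rfl

/-- The tensors are also a free right module on the `ω_{b_1} ⊗ ... ⊗ ω_{b_k}`. -/
theorem flipMul_bijective {q : ℝ} (hq : q ∈ Set.Ioo (0 : ℝ) 1) (k : ℕ) :
    Function.Bijective (flipMul hq k) := by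
  induction k with
  | zero =>
    have h (t : Tens (Alg q) 0) : flipMul hq 0 t = t := by
      funext b
      rw [flipMul_apply, Finset.sum_eq_single b (fun a _ h => absurd (Subsingleton.elim a b) h)
        (fun h => absurd (Finset.mem_univ b) h), basisMul]
    exact ⟨fun t u e => by rwa [h, h] at e, fun t => ⟨t, h t⟩⟩
  | succ k ih =>
    have hb := fHom_sum_bijective hq
    constructor
    · intro t u e
      have h1 (b : Fin k → Fin 4) : (fun a₀ => flipMul hq k (fun a => t (Fin.cons a₀ a)) b) =
          fun a₀ => flipMul hq k (fun a => u (Fin.cons a₀ a)) b := hb.1 (by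
        funext b₀
        have := congrFun e (Fin.cons b₀ b)
        rwa [flipMul_succ, flipMul_succ] at this)
      have h2 (a₀ : Fin 4) : (fun a => t (Fin.cons a₀ a)) = fun a => u (Fin.cons a₀ a) :=
        ih.1 (funext fun b => congrFun (h1 b) a₀)
      funext a
      rw [← Fin.cons_self_tail a]
      exact congrFun (h2 (a 0)) (Fin.tail a)
    · intro u
      choose w hw using fun b : Fin k → Fin 4 => hb.2 fun b₀ => u (Fin.cons b₀ b)
      choose t ht using fun a₀ : Fin 4 => ih.2 fun b => w b a₀
      refine ⟨fun a => t (a 0) (Fin.tail a), ?_⟩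
      funext b
      rw [← Fin.cons_self_tail b, flipMul_succ]
      have : ∀ a₀, (fun a => t ((Fin.cons a₀ a : Fin (k + 1) → Fin 4) 0)
          (Fin.tail (Fin.cons a₀ a : Fin (k + 1) → Fin 4))) = t a₀ := fun a₀ => rfl
      simp only [this, ht]
      exact congrFun (hw (Fin.tail b)) (b 0)

/-- `σ_{j+1}` does not see the first factor. -/
theorem sigmaAt_succ_succ (q : ℝ) (s : Bool) (k j : ℕ) (b₀ a₀ : Fin 4) (b a : Fin k → Fin 4) :
    sigmaAt q s (k + 1) (j + 1) (Fin.cons b₀ b) (Fin.cons a₀ a) =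
      if b₀ = a₀ then sigmaAt q s k j b a else 0 := by
  simp only [sigmaAt, Matrix.of_apply]
  by_cases h : j + 1 < k
  · have h' : j + 1 + 1 < k + 1 := by omega
    have e1 (v : Fin k → Fin 4) (v₀ : Fin 4) (hh : j + 1 < k + 1) :
        (Fin.cons v₀ v : Fin (k + 1) → Fin 4) ⟨j + 1, hh⟩ = v ⟨j, by omega⟩ := rfl
    have e2 (v : Fin k → Fin 4) (v₀ : Fin 4) :
        (Fin.cons v₀ v : Fin (k + 1) → Fin 4) ⟨j + 1 + 1, h'⟩ = v ⟨j + 1, h⟩ := rfl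
    have e3 : (∀ i : Fin (k + 1), (i : ℕ) ≠ j + 1 → (i : ℕ) ≠ j + 1 + 1 →
        (Fin.cons b₀ b : Fin (k + 1) → Fin 4) i = (Fin.cons a₀ a : Fin (k + 1) → Fin 4) i) ↔
        b₀ = a₀ ∧ ∀ i : Fin k, (i : ℕ) ≠ j → (i : ℕ) ≠ j + 1 → b i = a i := by
      rw [Fin.forall_fin_succ]
      simp
    simp only [h, h', dif_pos, e1, e2, e3, ite_and]
  · have h' : ¬ j + 1 + 1 < k + 1 := by omega
    simp [h]

theorem sigmaAt_zero_cons (q : ℝ) (s : Bool) (k : ℕ) (b₀ b₁ a₀ a₁ : Fin 4) (b a : Fin k → Fin 4) :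
    sigmaAt q s (k + 2) 0 (Fin.cons b₀ (Fin.cons b₁ b)) (Fin.cons a₀ (Fin.cons a₁ a)) =
      if b = a then sigma q s (b₀, b₁) (a₀, a₁) else 0 := by
  have e : (∀ i : Fin (k + 2), (i : ℕ) ≠ 0 → (i : ℕ) ≠ 0 + 1 →
      (Fin.cons b₀ (Fin.cons b₁ b : Fin (k + 1) → Fin 4) : Fin (k + 2) → Fin 4) i =
        (Fin.cons a₀ (Fin.cons a₁ a : Fin (k + 1) → Fin 4) : Fin (k + 2) → Fin 4) i) ↔ b = a := by
    rw [Fin.forall_fin_succ, Fin.forall_fin_succ, funext_iff]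
    simp
  simp only [sigmaAt, Matrix.of_apply, e]
  rw [dif_pos (by omega)]
  rfl

/-- `σ_j` commutes with the right multiplication. -/
theorem sigmaAt_basisMul {q : ℝ} (hq : q ∈ Set.Ioo (0 : ℝ) 1) (s : Bool) (k j : ℕ) (x : Alg q)
    (a b : Fin k → Fin 4) :
    ∑ c, sigmaAt q s k j c a • basisMul hq k x c b =
      ∑ c, sigmaAt q s k j b c • basisMul hq k x a c := by
  induction j generalizing k with
  | zero =>
    rcases k with _ | _ | k
    · simp [sigmaAt]
    · simp [sigmaAt]
    · obtain ⟨a₀, a, rfl⟩ : ∃ a₀ a', a = Fin.cons a₀ a' := ⟨_, _, (Fin.cons_self_tail a).symm⟩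
      obtain ⟨a₁, a, rfl⟩ : ∃ a₁ a', a = Fin.cons a₁ a' := ⟨_, _, (Fin.cons_self_tail a).symm⟩
      obtain ⟨b₀, b, rfl⟩ : ∃ b₀ b', b = Fin.cons b₀ b' := ⟨_, _, (Fin.cons_self_tail b).symm⟩
      obtain ⟨b₁, b, rfl⟩ : ∃ b₁ b', b = Fin.cons b₁ b' := ⟨_, _, (Fin.cons_self_tail b).symm⟩
      have h := sigma_fHom hq s (basisMul hq k x a b) (a₀, a₁) (b₀, b₁)
      rw [Fintype.sum_prod_type, Fintype.sum_prod_type] at h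
      have e (v₀ v₁ : Fin 4) (v : Fin k → Fin 4) (w₀ w₁ : Fin 4) (w : Fin k → Fin 4) :
          basisMul hq (k + 2) x (Fin.cons v₀ (Fin.cons v₁ v)) (Fin.cons w₀ (Fin.cons w₁ w)) =
            fHom hq (fHom hq (basisMul hq k x v w) v₁ w₁) v₀ w₀ := rfl
      simp only [sum_cons, sigmaAt_zero_cons, e, ite_smul, zero_smul, Finset.sum_ite_eq,
        Finset.sum_ite_eq', Finset.mem_univ, if_true]
      exact h
  | succ j ih =>
    rcases k with _ | k
    · simp [sigmaAt]
    · obtain ⟨a₀, a, rfl⟩ : ∃ a₀ a', a = Fin.cons a₀ a' := ⟨_, _, (Fin.cons_self_tail a).symm⟩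
      obtain ⟨b₀, b, rfl⟩ : ∃ b₀ b', b = Fin.cons b₀ b' := ⟨_, _, (Fin.cons_self_tail b).symm⟩
      have e (v₀ : Fin 4) (v : Fin k → Fin 4) (w₀ : Fin 4) (w : Fin k → Fin 4) :
          basisMul hq (k + 1) x (Fin.cons v₀ v) (Fin.cons w₀ w) =
            fHom hq (basisMul hq k x v w) v₀ w₀ := rfl
      have h := congrArg (fun y => fHom hq y a₀ b₀) (ih k a b)
      simp only [map_sum, map_smul, Matrix.sum_apply, Matrix.smul_apply] at h
      rw [sum_cons, sum_cons]
      simp only [sigmaAt_succ_succ, e, ite_smul, zero_smul]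
      rw [Finset.sum_comm, Finset.sum_comm (s := (Finset.univ : Finset (Fin 4)))]
      simpa only [Finset.sum_ite_eq, Finset.sum_ite_eq', Finset.mem_univ, if_true] using h

/-- A matrix that commutes with the right multiplication by elements of `A(SU_q(2))` defines a map
that commutes with `flipMul`. -/
theorem flipMul_act {q : ℝ} (hq : q ∈ Set.Ioo (0 : ℝ) 1) {k : ℕ}
    {M : Matrix (Fin k → Fin 4) (Fin k → Fin 4) ℂ}
    (hM : ∀ (x : Alg q) (a b : Fin k → Fin 4),
      ∑ c, M c a • basisMul hq k x c b = ∑ c, M b c • basisMul hq k x a c)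
    (t : Tens (Alg q) k) : flipMul hq k (act M t) = act M (flipMul hq k t) := by
  have hsum {ι : Type} (u : Finset ι) (f : ι → Alg q) (a b : Fin k → Fin 4) :
      basisMul hq k (∑ i ∈ u, f i) a b = ∑ i ∈ u, basisMul hq k (f i) a b :=
    map_sum (AddMonoidHom.mk' (fun x => basisMul hq k x a b) fun x y => basisMul_add hq x y a b) f u
  funext b
  simp only [flipMul_apply, act, LinearMap.coe_mk, AddHom.coe_mk, hsum, basisMul_smul,
    Finset.smul_sum]
  rw [Finset.sum_comm, Finset.sum_comm (s := (Finset.univ : Finset (Fin k → Fin 4))) (t := .univ)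
    (f := fun c a => M b c • basisMul hq k (t a) a c)]
  exact Finset.sum_congr rfl fun a _ => hM (t a) a b

theorem act_sum {R : Type} [Ring R] [Algebra ℂ R] {k : ℕ} {ι : Type} (u : Finset ι)
    (M : ι → Matrix (Fin k → Fin 4) (Fin k → Fin 4) ℂ) (t : Tens R k) :
    act (∑ i ∈ u, M i) t = ∑ i ∈ u, act (M i) t := by
  induction u using Finset.cons_induction with
  | empty => funext b; simp [act]
  | cons i u hi ih => rw [Finset.sum_cons, act_add, ih, Finset.sum_cons]

/-- The antisymmetrisers are right module maps. -/
theorem flipMul_antisym {q : ℝ} (hq : q ∈ Set.Ioo (0 : ℝ) 1) (s : Bool) (k : ℕ)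
    (t : Tens (Alg q) k) :
    flipMul hq k (act (antisym q s k) t) = act (antisym q s k) (flipMul hq k t) := by
  rw [antisym, act_sum, act_sum, map_sum]
  refine Finset.sum_congr rfl fun p _ => ?_
  rw [act_smul, act_smul, map_smul, permOp]
  congr 1
  generalize reducedWord (k * k) p = l
  induction l with
  | nil => simp [act_one]
  | cons j l ih =>
    rw [List.map_cons, List.prod_cons, act_mul, act_mul, ← ih,
      flipMul_act hq (sigmaAt_basisMul hq s k j)]

/-! ### Linear extensions of the Hodge operators -/

theorem act_mulLeft {q : ℝ} {k : ℕ} (M : Matrix (Fin k → Fin 4) (Fin k → Fin 4) ℂ) (x : Alg q)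
    (t : Tens ℂ k) : act M (mulLeft x t) = mulLeft x (act M t) := by
  funext b
  simp only [act, mulLeft, LinearMap.coe_mk, AddHom.coe_mk, smul_smul, Finset.sum_smul, smul_eq_mul]

theorem eq_sum_mulLeft {q : ℝ} {k : ℕ} (t : Tens (Alg q) k) :
    t = ∑ a, mulLeft (t a) (Pi.single a 1) := by
  funext b
  simp [mulLeft, Finset.sum_apply, Pi.single_apply]

theorem mulLeft_mem {q : ℝ} {s : Bool} {k : ℕ} (x : Alg q) (ω : InvForms q s k) :
    mulLeft x ω.1 ∈ Forms q s k := by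
  obtain ⟨_, t, rfl⟩ := ω
  exact ⟨mulLeft x t, act_mulLeft _ _ _⟩

/-- The left-invariant forms for the two signs coincide. -/
theorem invForms_le {q : ℝ} (h0 : 0 < q) (s : Bool) {k : ℕ} (hk : k ≤ 4) :
    InvForms q s k ≤ InvForms q (!s) k := by
  intro ω hω
  obtain ⟨x, hx⟩ := phi_surjective h0 s hk ⟨ω, hω⟩
  have : ω = (phi q s k x).1 := by rw [hx]
  rw [this, phi_not h0 s hk]
  exact (phi q (!s) k _).2

/-- A form is a sum of multiples of left-invariant forms. -/
theorem exists_sum_mulLeft {q : ℝ} {s : Bool} {k : ℕ} {φ : Tens (Alg q) k} (hφ : φ ∈ Forms q s k) :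
    ∃ (x : (Fin k → Fin 4) → Alg q) (ω : (Fin k → Fin 4) → InvForms q s k),
      φ = ∑ a, mulLeft (x a) (ω a).1 := by
  obtain ⟨t, rfl⟩ := hφ
  refine ⟨t, fun a => wedge q s (Pi.single a 1), ?_⟩
  conv_lhs => rw [eq_sum_mulLeft t]
  rw [map_sum]
  exact Finset.sum_congr rfl fun a _ => act_mulLeft _ _ _

/-- The spaces of forms for the two signs coincide. -/
theorem forms_eq {q : ℝ} (h0 : 0 < q) {k : ℕ} (hk : k ≤ 4) : Forms q true k = Forms q false k := by
  have h (s : Bool) : Forms q s k ≤ Forms q (!s) k := by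
    intro φ hφ
    obtain ⟨x, ω, rfl⟩ := exists_sum_mulLeft hφ
    exact Submodule.sum_mem _ fun a _ => mulLeft_mem (x a) ⟨(ω a).1, invForms_le h0 s hk (ω a).2⟩
  exact le_antisymm (h true) (h false)

/-- The left `A(SU_q(2))`-linear extension of a linear map of left-invariant tensors. -/
noncomputable def extend {q : ℝ} {k j : ℕ} (E : Tens ℂ k →ₗ[ℂ] Tens ℂ j) :
    Tens (Alg q) k →ₗ[ℂ] Tens (Alg q) j where
  toFun t b := ∑ a, E (Pi.single a 1) b • t a
  map_add' t u := by
    funext b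
    simp [smul_add, Finset.sum_add_distrib]
  map_smul' r t := by
    funext b
    simp only [Pi.smul_apply, RingHom.id_apply, Finset.smul_sum]
    exact Finset.sum_congr rfl fun a _ => smul_comm _ _ _

theorem extend_mulLeft {q : ℝ} {k j : ℕ} (E : Tens ℂ k →ₗ[ℂ] Tens ℂ j) (x : Alg q)
    (ω : Tens ℂ k) : extend E (mulLeft x ω) = mulLeft x (E ω) := by
  funext b
  have h : ω = ∑ a, ω a • Pi.single a (1 : ℂ) := by
    funext b
    simp [Finset.sum_apply, Pi.single_apply]
  change ∑ a, E (Pi.single a 1) b • ω a • x = E ω b • x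
  conv_rhs => rw [h, map_sum, Finset.sum_apply, Finset.sum_smul]
  refine Finset.sum_congr rfl fun a _ => ?_
  rw [map_smul, smul_smul, mul_comm]
  rfl

/-- `S` extends `T` with respect to the linear isomorphisms `R`: `S(R(x ω)) = R(x T(ω))`.  This
covers the left extensions, for which `R` is the identity, and the right extensions, for which
`R(x ω) = ω x`. -/
def IsExtension {q : ℝ} {s : Bool} (R : (k : ℕ) → Tens (Alg q) k ≃ₗ[ℂ] Tens (Alg q) k)
    (T : InvOp q s) (S : FormOp q s) : Prop :=
  ∀ (k j : ℕ) (h : k + j = 4) (x : Alg q) (ω : InvForms q s k),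
    ∃ hx : R k (mulLeft x ω.1) ∈ Forms q s k,
      (S k j h ⟨R k (mulLeft x ω.1), hx⟩).1 = R j (mulLeft x (T k j h ω).1)

section Extension

variable {q : ℝ} {R : (k : ℕ) → Tens (Alg q) k ≃ₗ[ℂ] Tens (Alg q) k}

theorem map_mem_forms (hR : ∀ (s : Bool) (k : ℕ) (t : Tens (Alg q) k),
    R k (act (antisym q s k) t) = act (antisym q s k) (R k t)) {s : Bool} {k : ℕ}
    {φ : Tens (Alg q) k} (hφ : φ ∈ Forms q s k) : R k φ ∈ Forms q s k := by
  obtain ⟨t, rfl⟩ := hφ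
  exact ⟨R k t, (hR s k t).symm⟩

theorem exists_sum_map_mulLeft (hR : ∀ (s : Bool) (k : ℕ) (t : Tens (Alg q) k),
    R k (act (antisym q s k) t) = act (antisym q s k) (R k t)) {s : Bool} {k : ℕ}
    {φ : Tens (Alg q) k} (hφ : φ ∈ Forms q s k) :
    ∃ (x : (Fin k → Fin 4) → Alg q) (ω : (Fin k → Fin 4) → InvForms q s k),
      φ = ∑ a, R k (mulLeft (x a) (ω a).1) := by
  obtain ⟨t, rfl⟩ := hφ
  have h : act (antisym q s k) ((R k).symm t) ∈ Forms q s k := ⟨_, rfl⟩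
  obtain ⟨x, ω, e⟩ := exists_sum_mulLeft h
  refine ⟨x, ω, ?_⟩
  rw [← map_sum, ← e, hR, LinearEquiv.apply_symm_apply]

theorem IsExtension.apply_sum (hR : ∀ (s : Bool) (k : ℕ) (t : Tens (Alg q) k),
    R k (act (antisym q s k) t) = act (antisym q s k) (R k t)) {s : Bool} {T : InvOp q s}
    {S : FormOp q s} (hS : IsExtension R T S) {k j : ℕ} (h : k + j = 4) {ι : Type} [Fintype ι]
    (x : ι → Alg q) (ω : ι → InvForms q s k) (φ : Forms q s k)
    (hφ : φ.1 = ∑ a, R k (mulLeft (x a) (ω a).1)) :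
    (S k j h φ).1 = ∑ a, R j (mulLeft (x a) (T k j h (ω a)).1) := by
  have e : φ = ∑ a, (⟨R k (mulLeft (x a) (ω a).1),
      map_mem_forms hR (mulLeft_mem (x a) (ω a))⟩ : Forms q s k) := by
    refine Subtype.ext ?_
    rw [hφ, Submodule.coe_sum]
  rw [e, map_sum, Submodule.coe_sum]
  refine Finset.sum_congr rfl fun a _ => ?_
  obtain ⟨_, e'⟩ := hS k j h (x a) (ω a)
  exact e'

/-- Existence and uniqueness of the extensions. The operator `T` is extended to all left-invariant
tensors, then linearly to all tensors; the result maps forms to forms, and depends only on `T`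
there, because the forms are spanned by the `R(x ω)`, `ω` a left-invariant form. -/
theorem existsUnique_extension (hR : ∀ (s : Bool) (k : ℕ) (t : Tens (Alg q) k),
    R k (act (antisym q s k) t) = act (antisym q s k) (R k t)) {s : Bool} (T : InvOp q s) :
    ∃! S : FormOp q s, IsExtension R T S := by
  have hE (k j : ℕ) (h : k + j = 4) : ∃ E : Tens ℂ k →ₗ[ℂ] Tens ℂ j,
      ∀ ω : InvForms q s k, E ω.1 = (T k j h ω).1 := by
    obtain ⟨E, hE⟩ := LinearMap.exists_extend ((InvForms q s j).subtype.comp (T k j h))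
    exact ⟨E, fun ω => LinearMap.congr_fun hE ω⟩
  choose E hE using hE
  have key (k j : ℕ) (h : k + j = 4) (x : Alg q) (ω : InvForms q s k) :
      R j (extend (E k j h) ((R k).symm (R k (mulLeft x ω.1)))) =
        R j (mulLeft x (T k j h ω).1) := by
    rw [LinearEquiv.symm_apply_apply, extend_mulLeft, hE]
  refine ⟨fun k j h =>
    { toFun := fun φ => ⟨R j (extend (E k j h) ((R k).symm φ.1)), ?_⟩
      map_add' := fun φ ψ => Subtype.ext (by simp only [Submodule.coe_add, map_add])
      map_smul' := fun r φ => Subtype.ext (by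
        simp only [Submodule.coe_smul_of_tower, map_smul, RingHom.id_apply]) }, ?_, ?_⟩
  · obtain ⟨x, ω, e⟩ := exists_sum_map_mulLeft hR φ.2
    rw [e]
    simp only [map_sum, key]
    exact Submodule.sum_mem _ fun a _ => map_mem_forms hR (mulLeft_mem _ _)
  · exact fun k j h x ω => ⟨map_mem_forms hR (mulLeft_mem x ω), key k j h x ω⟩
  · intro S hS
    funext k j h
    refine LinearMap.ext fun φ => Subtype.ext ?_
    obtain ⟨x, ω, e⟩ := exists_sum_map_mulLeft hR φ.2
    rw [hS.apply_sum hR h x ω φ e]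
    change _ = R j (extend (E k j h) ((R k).symm φ.1))
    rw [e]
    simp only [map_sum, key]

/-- The extensions of the Hodge operators for the two signs are inverse to each other, up to a
sign. -/
theorem IsExtension.mixed (hq : q ∈ Set.Ioo (0 : ℝ) 1)
    (hR : ∀ (s : Bool) (k : ℕ) (t : Tens (Alg q) k),
      R k (act (antisym q s k) t) = act (antisym q s k) (R k t))
    {Γ : Matrix (Fin 4) (Fin 4) ℂ} {D : ℝ} (hΓ : IsDuality q Γ D) {m : ℝ}
    (hm : (m ^ 2 * D : ℂ) = -1) {T : (s : Bool) → InvOp q s} (hT : ∀ s, IsHodge q s m Γ (T s))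
    {S : (s : Bool) → FormOp q s} (hS : ∀ s, IsExtension R (T s) (S s)) (s : Bool) {k j : ℕ}
    (h : k + j = 4) (h' : j + k = 4) (φ : Forms q (!s) k) (ψ : Forms q s j)
    (hψ : ψ.1 = (S (!s) k j h φ).1) :
    (S s j k h' ψ).1 = ((-1) ^ (k * j) * sgn q s Γ) • φ.1 := by
  obtain ⟨x, ω, e⟩ := exists_sum_map_mulLeft hR φ.2
  rw [(hS (!s)).apply_sum hR h x ω φ e] at hψ
  have hη (a) : (T (!s) k j h (ω a)).1 ∈ InvForms q s j := by
    have := invForms_le hq.1 (!s) (by omega : j ≤ 4) (T (!s) k j h (ω a)).2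
    rwa [Bool.not_not] at this
  rw [(hS s).apply_sum hR h' x (fun a => ⟨_, hη a⟩) ψ hψ, e, Finset.smul_sum]
  refine Finset.sum_congr rfl fun a _ => ?_
  rw [hΓ.mixed hq hm hT s h h' (ω a) ⟨_, hη a⟩ rfl, ← map_smul]
  congr 1
  funext b
  simp only [mulLeft, Pi.smul_apply, smul_assoc]

end Extension

/-- `flipMul` as a linear isomorphism. -/
noncomputable def flipEquiv {q : ℝ} (hq : q ∈ Set.Ioo (0 : ℝ) 1) (k : ℕ) :
    Tens (Alg q) k ≃ₗ[ℂ] Tens (Alg q) k :=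
  LinearEquiv.ofBijective (flipMul hq k) (flipMul_bijective hq k)

theorem isRightExtension_iff {q : ℝ} (hq : q ∈ Set.Ioo (0 : ℝ) 1) {s : Bool} (T : InvOp q s)
    (S : FormOp q s) : IsRightExtension hq T S ↔ IsExtension (flipEquiv hq) T S := by
  have e {k : ℕ} (x : Alg q) (ω : Tens ℂ k) : flipEquiv hq k (mulLeft x ω) = mulRight hq ω x :=
    flipMul_mulLeft hq x ω
  simp only [IsRightExtension, IsExtension, e]

end SUq2

open SUq2 in
theorem mainTheorem1 (q : ℝ) (hq : q ∈ Set.Ioo (0 : ℝ) 1) :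
    -- the Hodge operators are well defined
    (∀ (s : Bool) (m : ℝ) (Γ : Matrix (Fin 4) (Fin 4) ℂ), m ≠ 0 → IsCoinvariant Γ →
      ∃! T : InvOp q s, IsHodge q s m Γ T) ∧
    -- the two sets of contractions coincide (and do not depend on the scale)
    (∀ m m' : ℝ, m ≠ 0 → m' ≠ 0 → realMaxHerm q true m = realMaxHerm q false m') ∧
    -- the spaces of forms coincide, so that the Hodge dualities can be composed
    (∀ k j : ℕ, k + j = 4 → Forms q true k = Forms q false k) ∧
    ∀ (s₀ : Bool) (m₀ : ℝ) (Γ : Matrix (Fin 4) (Fin 4) ℂ), m₀ ≠ 0 → Γ ∈ realMaxHerm q s₀ m₀ →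
      sgn q true Γ = sgn q false Γ ∧
      ∃ m : ℝ, m ≠ 0 ∧
        ∀ T : (s : Bool) → InvOp q s, (∀ s, IsHodge q s m Γ (T s)) →
          -- the square of the Hodge operators, and their behaviour under conjugation
          (∀ (s : Bool) (k j : ℕ) (h : k + j = 4) (ξ : InvForms q s k) (l l' : ℂ),
            IsEigenform q s ξ l → IsEigenform q s (formStar q s ξ) l' →
              sq (T s) k j h ξ = ((-1) ^ (k * j) * sgn q s Γ * (l / l')) • ξ ∧
              l' • formStar q s (T s k j h ξ) = l • T s k j h (formStar q s ξ)) ∧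
          -- the left and right linear extensions
          (∀ s : Bool, ∃! S : FormOp q s, IsLeftExtension (T s) S) ∧
          (∀ s : Bool, ∃! S : FormOp q s, IsRightExtension hq (T s) S) ∧
          ∀ S : (s : Bool) → FormOp q s,
            ((∀ s, IsLeftExtension (T s) (S s)) ∨ (∀ s, IsRightExtension hq (T s) (S s))) →
            ∀ (s : Bool) (k j : ℕ) (h : k + j = 4) (φ : Forms q (!s) k) (ψ : Forms q s j),
              ψ.1 = (S (!s) k j h φ).1 →
              (S s j k ((Nat.add_comm j k).trans h) ψ).1 =
                ((-1) ^ (k * j) * sgn q s Γ) • φ.1 := by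
  have hl : ∀ (s : Bool) (k : ℕ) (t : Tens (Alg q) k), LinearEquiv.refl ℂ (Tens (Alg q) k)
      (act (antisym q s k) t) = act (antisym q s k) (LinearEquiv.refl ℂ (Tens (Alg q) k) t) :=
    fun _ _ _ => rfl
  have hr : ∀ (s : Bool) (k : ℕ) (t : Tens (Alg q) k), flipEquiv hq k (act (antisym q s k) t) =
      act (antisym q s k) (flipEquiv hq k t) := fun s k t => flipMul_antisym hq s k t
  refine ⟨fun s m Γ _ _ => existsUnique_hodge hq s m Γ, fun m m' hm hm' => ?_,
    fun k j h => forms_eq hq.1 (by omega), fun s₀ m₀ Γ hm₀ hΓ => ?_⟩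
  · rw [realMaxHerm_eq hq true hm, realMaxHerm_eq hq false hm']
  rw [realMaxHerm_eq hq s₀ hm₀] at hΓ
  obtain ⟨D, hD⟩ := IsSolution.isDuality hq hΓ
  obtain ⟨m, hm, hmD⟩ := hD.exists_scale
  refine ⟨by rw [hD.sgn_eq, hD.sgn_eq], m, hm, fun T hT => ⟨fun s k j h ξ l l' h1 h2 =>
    ⟨hD.sq_eigenform hq hmD (hT s) h h1 h2, hD.star_eigenform hq (hT s) h h1 h2⟩,
    fun s => existsUnique_extension hl (T s), fun s => ?_, ?_⟩⟩
  · simp only [isRightExtension_iff]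
    exact existsUnique_extension hr (T s)
  · rintro S (hS | hS) s k j h φ ψ hψ
    · exact IsExtension.mixed (R := fun k => LinearEquiv.refl ℂ _) hq hl hD hmD hT hS s h _ φ ψ hψ
    · exact IsExtension.mixed hq hr hD hmD hT (fun s => (isRightExtension_iff hq _ _).1 (hS s)) s h
        _ φ ψ hψ
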